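/- **Setting.** Let $d\ge 3$, let $B$ be a real, spherically symmetric Schwartz function on $\mathbb R^d$ with $0\in\operatorname{supp}\widehat B$ (Fourier transforms with the phase $e^{-2\pi i p\cdot x}$), let $\chi:\mathbb R^d\to[0,1]$ be a smooth, spherically symmetric function, equal to $1$ near $0$ and vanishing for $|p|>1$, let $\psi_0\in L^2(\mathbb R^d)$ be such that $\widehat\psi_0$ has compact support, and let $T_0>0$. Given $\kappa,\delta>0$, $\lambda>0$, $\eta>0$, $t\in[0,T_0\lambda^{-2-\kappa}]$, $\xi\in\mathbb R^d$ and a measurable $Q:\mathbb R^d\to\mathbb C$ with $|Q|\le 1$, put $$\widehat B_\lambda(p)=\chi(\lambda^\delta p)\widehat B(p),\quad e(p)=\tfrac12p^2,\quad \theta(p)=\lim_{\varepsilon\to0+}\int\frac{|\widehat B_\lambda(q-p)|^2\,dq}{e(p)-e(q)+i\varepsilon},\quad \omega(p)=e(p)+\lambda^2\theta(p),$$ $$\zeta=\lambda^{-\kappa-3\delta},\quad Y=\lambda^{-100},\quad K=\lfloor\lambda^{-\delta}\lambda^2t\rfloor,\quad \langle p\rangle=(2+p^2)^{1/2}.$$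 **Graphs.** $\mathcal V_{n,n'}$ is the oriented circle graph with vertices $0,1,\dots,n,0^*,\tilde n',\dots,\tilde1$ in this circular order; $\mathcal L$ is the set of the $n+1$ edges between $0,1,\dots,n,0^*$ and $\widetilde{\mathcal L}$ the set of the other $n'+1$ edges. The edges into and out of $v$ are $e_{v-}$ and $e_{v+}$. Each edge $e$ carries a momentum $w_e\in\mathbb R^d$. For a set $A$ of vertices, $\sum_{e\in L_\pm(A)}\pm w_e$ is the sum of the $w_e$ over edges leaving $A$ minus the sum over edges entering $A$. $\mathcal P_{n,n'}$ is the set of partitions of $\mathcal V_{n,n'}\setminus\{0,0^*\}$ into nonempty lumps. For $\mathbf P=\{P_\mu\}\in\mathcal P_{n,n'}$, $g(\mathbf P)$ is the number of single (one-element) lumps, and $$\Delta(\mathbf P,\mathbf w)=\delta\Big(\xi+\sum_{e\in L_\pm(\{0^*\})}\pm w_e\Big)\prod_\mu\delta\Big(\sum_{e\in L_\pm(P_\mu)}\pm w_e\Big),\qquad d\mu(\mathbf w)=\prod_e\mathbf 1(|w_e|\le\zeta)\,dw_e .$$ **Values.** Set $\alpha_e=\alpha$ for $e\in\mathcal L$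 and $\alpha_e=\beta$ for $e\in\widetilde{\mathcal L}$. For an integer $g\ge0$, $$E_{g}(\mathbf P)=\frac{e^{2t\eta}}{(2\pi)^2}\iint_{-Y}^{Y}d\alpha\,d\beta\;\lambda^{n+n'}\sup_{|\mathcal G|\le g}\int d\mu(\mathbf w)\,\Delta(\mathbf P,\mathbf w)\,\mathcal N_{\mathcal G}(\mathbf w)\prod_e\frac1{|\alpha_e-\omega(w_e)+i\eta|},$$ where $\mathcal G$ runs over subsets of $\mathcal V_{n,n'}\setminus\{0,0^*\}$ and $$\mathcal N_{\mathcal G}(\mathbf w)=|\widehat\psi_0(w_{e_{0+}})|\,|\widehat\psi_0(w_{e_{0-}})|\prod_{v\notin\mathcal G,\,v\ne0,0^*}|\widehat B_\lambda(w_{e_{v-}}-w_{e_{v+}})|\prod_{v\in\mathcal G}\langle w_{e_{v-}}-w_{e_{v+}}\rangle^{-2d}.$$ Further, $$V(\mathbf P)=\frac{e^{2t\eta}}{(2\pi)^2}\iint_{-Y}^{Y}d\alpha\,d\beta\;e^{it(\alpha-\beta)}\lambda^{n+n'+g(\mathbf P)}\int d\mu(\mathbf w)\,\Delta(\mathbf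 P,\mathbf w)\,\mathcal M(\mathbf w)\prod_{e\in\mathcal L}\frac1{\alpha-\overline{\omega(w_e)}-i\eta}\prod_{e\in\widetilde{\mathcal L}}\frac1{\beta-\omega(w_e)+i\eta},$$ where $$\mathcal M(\mathbf w)=\Big(\prod_{v}m_v\Big)\,\overline{\widehat\psi_0(w_{e_{0+}})}\,\widehat\psi_0(w_{e_{0-}})\,Q\big(\tfrac12(w_{e_{0^*-}}+w_{e_{0^*+}})\big),$$ the product runs over $v\ne0,0^*$, and $m_v$ is $-\theta(w_{e_{v-}})$ if $\{v\}$ is a single lump and $\widehat B_\lambda(w_{e_{v-}}-w_{e_{v+}})$ otherwise, complex conjugated if $v\in\{1,\dots,n\}$. The truncated values $E_{*g}(\mathbf P)$, $V_*(\mathbf P)$ are defined in the same way without the propagators (the factors $1/|\cdots|$ and $1/(\cdots)$) of the two edges at $0^*$. $V_{(*)}$, $E_{(*)g}$ mean that the assertion holds both with and without truncation. **Insertions.** Inserting a $\vartheta$ on an edge means adding to the graph a new vertex on that edge and to the partition the single lump consisting of it; inserting a gate means adding two consecutive new vertices on that edge and the lump consisting of these two. For $\upsilon=(\upsilon_e)$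 with $\upsilon_e\in\{0,1,2,\dots\}$ for each edge $e$ of $\mathcal V_{n,n'}$ and $|\upsilon|=\sum_e\upsilon_e$, and for $S\in\{g,\vartheta\}^{|\upsilon|}$, let $\mathbf P_S$ be the partition obtained from $\mathbf P$ by making $\upsilon_e$ insertions on each edge $e$, $S$ prescribing which of them are gates and which are $\vartheta$'s. **Statement.** There is a constant $C>0$, depending only on $d,B,\chi,\psi_0,T_0$, such that for all $\kappa,\delta>0$ there is $c>0$ for which the following holds whenever $0<\lambda\le c$, $\lambda^3\le c\,\eta$ and $\eta\le c\lambda^2$ (that is, for $\lambda^3\ll\eta\ll\lambda^2$), for all $t\in[0,T_0\lambda^{-2-\kappa}]$, all $\xi$, all $Q$ as above, all $n,n'\le K$ and all $\mathbf P\in\mathcal P_{n,n'}$. 1. If $\mathbf P$ has no single lump, and $\mathbf P'$, $\mathbf P''$ arise from $\mathbf P$ by inserting on one and the same edge a $\vartheta$, respectively a gate, then $$\big|V_{(*)}(\mathbf P')+V_{(*)}(\mathbf P'')\big|\le C\lambda^2\eta^{-1/2}E_{(*)g=0}(\mathbf P).$$ 2. For every $\upsilon$, $$\Big|\sum_{S\in\{g,\vartheta\}^{|\upsilon|}}V_{(*)}(\mathbf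 P_S)\Big|\le\big(C\lambda^2\eta^{-1/2}\big)^{|\upsilon|}E_{(*)g(\mathbf P)}(\mathbf P);$$ in particular the right side has $E_{(*)g=0}(\mathbf P)$ if $\mathbf P$ has no single lump. -/

import Mathlib

open MeasureTheory Filter Topology ComplexConjugate FourierTransform
open scoped SchwartzMap ContDiff BigOperators

noncomputable section

namespace Feynman

/-- Momentum (and position) space `ℝ^d` with its Euclidean norm. -/
abbrev Mom (d : ℕ) := EuclideanSpace ℝ (Fin d)

/-! ## The circle graph with `n + n' + 2` vertices -/

/-- The vertices other than `0` and `0*`: `Sum.inl i` is the vertex `i + 1` of `I_n`, and `Sum.inr j`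
is the vertex `tilde (j + 1)` of `tilde I_{n'}`. -/
abbrev Site (n n' : ℕ) := Fin n ⊕ Fin n'

/-- All vertices, in the circular order
`0, 1, …, n, 0*, tilde n', …, tilde 1`, back to `0`. -/
inductive Vertex (n n' : ℕ) : Type
  | zero : Vertex n n'
  | zeroStar : Vertex n n'
  | site : Site n n' → Vertex n n'

/-- The oriented edges. `Sum.inl i` is `e_{i+1} = (i, i + 1)`, where the vertex `n + 1` is `0*`;
`Sum.inr j` is `(tilde (j + 1), tilde j)`, where `tilde (n' + 1)` is `0*` and `tilde 0` is `0`.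
The first summand is the set `L` and the second one the set `tilde L`. -/
abbrev Edge (n n' : ℕ) := Fin (n + 1) ⊕ Fin (n' + 1)

/-- The vertex that an edge leaves. -/
def tail {n n' : ℕ} : Edge n n' → Vertex n n'
  | Sum.inl i => Fin.cases Vertex.zero (fun k : Fin n => Vertex.site (Sum.inl k)) i
  | Sum.inr j => Fin.lastCases Vertex.zeroStar (fun k : Fin n' => Vertex.site (Sum.inr k)) j

/-- The vertex that an edge enters. -/
def head {n n' : ℕ} : Edge n n' → Vertex n n'
  | Sum.inl i => Fin.lastCases Vertex.zeroStar (fun k : Fin n => Vertex.site (Sum.inl k)) i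
  | Sum.inr j => Fin.cases Vertex.zero (fun k : Fin n' => Vertex.site (Sum.inr k)) j

/-- The edge `e_{v-}` that enters the vertex `v`. -/
def edgeIn {n n' : ℕ} : Site n n' → Edge n n'
  | Sum.inl i => Sum.inl i.castSucc
  | Sum.inr j => Sum.inr j.succ

/-- The edge `e_{v+}` that leaves the vertex `v`. -/
def edgeOut {n n' : ℕ} : Site n n' → Edge n n'
  | Sum.inl i => Sum.inl i.succ
  | Sum.inr j => Sum.inr j.castSucc

theorem head_edgeIn {n n' : ℕ} (v : Site n n') : head (edgeIn v) = Vertex.site v := by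
  rcases v with i | j <;> simp [head, edgeIn]

theorem tail_edgeOut {n n' : ℕ} (v : Site n n') : tail (edgeOut v) = Vertex.site v := by
  rcases v with i | j <;> simp [tail, edgeOut]

/-- The four edges at the two distinguished vertices. -/
def zeroOut (n n' : ℕ) : Edge n n' := Sum.inl 0

/-- The edge that enters `0`. -/
def zeroIn (n n' : ℕ) : Edge n n' := Sum.inr 0

/-- The edge that enters `0*`. -/
def starIn (n n' : ℕ) : Edge n n' := Sum.inl (Fin.last n)

/-- The edge that leaves `0*`. -/
def starOut (n n' : ℕ) : Edge n n' := Sum.inr (Fin.last n')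

/-- A momentum for every edge. The volume on this space is the product Lebesgue measure. -/
abbrev EdgeMom (d n n' : ℕ) := Edge n n' → Mom d

open Classical in
/-- `∑_{e ∈ L_±(P)} ± w_e`: momenta of edges going out of `P` minus momenta of edges going
into `P`. -/
def netMomentum (d : ℕ) {n n' : ℕ} (P : Set (Vertex n n')) : EdgeMom d n n' →ₗ[ℝ] Mom d :=
  (∑ e ∈ Finset.univ.filter (fun e : Edge n n' => tail e ∈ P ∧ head e ∉ P), LinearMap.proj e)
    - ∑ e ∈ Finset.univ.filter (fun e : Edge n n' => head e ∈ P ∧ tail e ∉ P), LinearMap.proj e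

/-- A partition of the vertices other than `0` and `0*` into nonempty, pairwise disjoint lumps. -/
abbrev Lumps (n n' : ℕ) := Finpartition (Finset.univ : Finset (Site n n'))

/-- The vertices that form a single lump. The edges of `G(P)` are the `edgeIn v` with `v` in this
set, so that its cardinality is `g(P)`. -/
def singles {n n' : ℕ} (P : Lumps n n') : Finset (Site n n') :=
  Finset.univ.filter (fun v => ({v} : Finset (Site n n')) ∈ P.parts)

/-- `g(P)`. -/
def numSingles {n n' : ℕ} (P : Lumps n n') : ℕ := (singles P).card

/-! ## Products of delta functions -/

/-- The set of points with all coordinates in `[0, 1]`. It has volume one. -/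
def unitCube (ι : Type*) (d : ℕ) : Set (ι → Mom d) := {y | ∀ i k, y i k ∈ Set.Icc (0 : ℝ) 1}

open Classical in
/-- The measure `∏_i δ(A_i w - b_i) dw` for a surjective linear map `A = (A_i)` on a space with
Lebesgue measure `dw`. With a linear right inverse `s` of `A`, the map `w ↦ w - s (A w - b)` moves
`w` to the fibre `{A w = b}`; by translation invariance of Lebesgue measure each fibre `{A w = y}`
is moved to the same measure, and the definition averages it over the `y` in a cube of volume one.
The result does not depend on the choice of `s`. -/
def deltaMeasure {ι W : Type*} [Fintype ι] {d : ℕ} [AddCommGroup W] [Module ℝ W] [MeasureSpace W]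
    (A : W →ₗ[ℝ] (ι → Mom d)) (b : ι → Mom d) : Measure W :=
  if h : Function.Surjective A then
    let s : (ι → Mom d) →ₗ[ℝ] W :=
      (A.exists_rightInverse_of_surjective (LinearMap.range_eq_top.2 h)).choose
    Measure.map (fun w => w - s (A w - b)) (volume.restrict (A ⁻¹' unitCube ι d))
  else 0

theorem volume_unitCube (ι : Type*) [Fintype ι] (d : ℕ) : volume (unitCube ι d) = 1 := by
  have h1 : unitCube ι d
      = Set.univ.pi (fun _ : ι => {y : Mom d | ∀ k, y k ∈ Set.Icc (0 : ℝ) 1}) := by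
    ext y; simp [unitCube]
  have h2 : volume {y : Mom d | ∀ k, y k ∈ Set.Icc (0 : ℝ) 1} = 1 := by
    have : {y : Mom d | ∀ k, y k ∈ Set.Icc (0 : ℝ) 1}
        = (MeasurableEquiv.toLp 2 (Fin d → ℝ)).symm ⁻¹'
          (Set.univ.pi fun _ => Set.Icc (0 : ℝ) 1) := by
      ext y
      exact ⟨fun h k _ => h k, fun h k => h k trivial⟩
    rw [this, (EuclideanSpace.volume_preserving_symm_measurableEquiv_toLp
      (Fin d)).measure_preimage_equiv, volume_pi_pi]
    simp
  rw [h1, volume_pi_pi, h2]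
  simp

theorem measurableSet_unitCube (ι : Type*) [Fintype ι] (d : ℕ) :
    MeasurableSet (unitCube ι d) := by
  have : unitCube ι d = ⋂ i, ⋂ k, {y : ι → Mom d | y i k ∈ Set.Icc (0 : ℝ) 1} := by
    ext y; simp [unitCube]
  rw [this]
  refine MeasurableSet.iInter fun i => MeasurableSet.iInter fun k => ?_
  exact measurableSet_Icc.preimage (f := fun y : ι → Mom d => y i k) (by fun_prop)

/-- The defining property of the delta functions: integration over all `b` of the integrals against
`∏_i δ(A_i w - b_i) dw` gives back the Lebesgue integral. -/
theorem lintegral_lintegral_deltaMeasure {ι W : Type*} [Fintype ι] {d : ℕ}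
    [NormedAddCommGroup W] [NormedSpace ℝ W] [FiniteDimensional ℝ W] [MeasureSpace W]
    [BorelSpace W] [(volume : Measure W).IsAddHaarMeasure]
    (A : W →ₗ[ℝ] (ι → Mom d)) (hA : Function.Surjective A) (f : W → ENNReal)
    (hf : Measurable f) :
    ∫⁻ b, ∫⁻ w, f w ∂(deltaMeasure A b) = ∫⁻ w, f w := by
  classical
  set s : (ι → Mom d) →ₗ[ℝ] W :=
      (A.exists_rightInverse_of_surjective (LinearMap.range_eq_top.2 hA)).choose with hs
  have hAs : ∀ y, A (s y) = y := fun y => LinearMap.congr_fun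
    (A.exists_rightInverse_of_surjective (LinearMap.range_eq_top.2 hA)).choose_spec y
  have cA : Measurable A := A.continuous_of_finiteDimensional.measurable
  have cs : Measurable s := s.continuous_of_finiteDimensional.measurable
  have hQ : MeasurableSet (unitCube ι d) := measurableSet_unitCube ι d
  have hI : Measurable ((unitCube ι d).indicator (1 : (ι → Mom d) → ENNReal)) :=
    measurable_one.indicator hQ
  have : ProperSpace W := FiniteDimensional.proper ℝ W
  have e1 : ∀ b, ∫⁻ w, f w ∂(deltaMeasure A b)
      = ∫⁻ w, (unitCube ι d).indicator 1 (A w) * f (w - s (A w - b)) := by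
    intro b
    rw [deltaMeasure, dif_pos hA]
    simp only []
    rw [lintegral_map hf (by fun_prop), ← lintegral_indicator (cA hQ)]
    congr 1; ext w
    by_cases h : A w ∈ unitCube ι d <;> simp [Set.indicator, h, hs]
  simp_rw [e1]
  have m1 : Measurable (fun p : (ι → Mom d) × W =>
      (unitCube ι d).indicator (1 : (ι → Mom d) → ENNReal) (A p.2)
        * f (p.2 - s (A p.2 - p.1))) :=
    (hI.comp (cA.comp measurable_snd)).mul (hf.comp (by fun_prop))
  rw [lintegral_lintegral_swap m1.aemeasurable]
  have e2 : ∀ w, ∫⁻ b, (unitCube ι d).indicator 1 (A w) * f (w - s (A w - b))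
      = ∫⁻ b, (unitCube ι d).indicator 1 (A w) * f (w + s b) := by
    intro w
    rw [← lintegral_add_right_eq_self (μ := volume)
      (fun b => (unitCube ι d).indicator 1 (A w) * f (w - s (A w - b))) (A w)]
    congr 1; ext b; congr 2; simp [sub_eq_add_neg]
  simp_rw [e2]
  have m2 : Measurable (fun p : W × (ι → Mom d) =>
      (unitCube ι d).indicator (1 : (ι → Mom d) → ENNReal) (A p.1) * f (p.1 + s p.2)) :=
    (hI.comp (cA.comp measurable_fst)).mul (hf.comp (by fun_prop))
  rw [lintegral_lintegral_swap m2.aemeasurable]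
  have e3 : ∀ b, ∫⁻ w, (unitCube ι d).indicator 1 (A w) * f (w + s b)
      = ∫⁻ w, (unitCube ι d).indicator 1 (A w - b) * f w := by
    intro b
    rw [← lintegral_add_right_eq_self (μ := volume)
      (fun w => (unitCube ι d).indicator 1 (A w - b) * f w) (s b)]
    congr 1; ext w; simp [hAs]
  simp_rw [e3]
  have m3 : Measurable (fun p : (ι → Mom d) × W =>
      (unitCube ι d).indicator (1 : (ι → Mom d) → ENNReal) (A p.2 - p.1) * f p.2) :=
    (hI.comp ((cA.comp measurable_snd).sub measurable_fst)).mul (hf.comp (by fun_prop))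
  rw [lintegral_lintegral_swap m3.aemeasurable]
  congr 1; ext w
  have h4 : ∫⁻ b, (unitCube ι d).indicator (1 : (ι → Mom d) → ENNReal) (A w - b) = 1 := by
    have : (volume : Measure (ι → Mom d)).IsNegInvariant :=
      Measure.pi.isNegInvariant _
    rw [lintegral_sub_left_eq_self (μ := volume)
      ((unitCube ι d).indicator (1 : (ι → Mom d) → ENNReal)) (A w),
      lintegral_indicator_one hQ, volume_unitCube]
  have h5 : Measurable fun b =>
      (unitCube ι d).indicator (1 : (ι → Mom d) → ENNReal) (A w - b) :=
    hI.comp (measurable_const.sub measurable_id)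
  rw [lintegral_mul_const _ h5, h4, one_mul]

/-- The arguments of the delta functions of the graph, without their constant terms: the net momentum
at `0*` and the net momentum of each lump. -/
def constraint (d : ℕ) {n n' : ℕ} (P : Lumps n n') :
    EdgeMom d n n' →ₗ[ℝ] (Option P.parts → Mom d) :=
  LinearMap.pi fun o => match o with
    | none => netMomentum d {Vertex.zeroStar}
    | some μ => netMomentum d (Vertex.site '' (μ.1 : Set (Site n n')))

theorem tail_eq_site {n n' : ℕ} (e : Edge n n') (v : Site n n') :
    tail e = Vertex.site v ↔ e = edgeOut v := by
  rcases e with i | j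
  · refine Fin.cases ?_ (fun k => ?_) i <;> rcases v with a | b <;>
      simp [tail, edgeOut, Fin.succ_ne_zero, eq_comm]
  · refine Fin.lastCases ?_ (fun k => ?_) j <;> rcases v with a | b <;>
      simp [tail, edgeOut, Fin.castSucc_ne_last, eq_comm]

theorem head_eq_site {n n' : ℕ} (e : Edge n n') (v : Site n n') :
    head e = Vertex.site v ↔ e = edgeIn v := by
  rcases e with i | j
  · refine Fin.lastCases ?_ (fun k => ?_) i <;> rcases v with a | b <;>
      simp [head, edgeIn, Fin.castSucc_ne_last, eq_comm]
  · refine Fin.cases ?_ (fun k => ?_) j <;> rcases v with a | b <;>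
      simp [head, edgeIn, Fin.succ_ne_zero, eq_comm]

theorem tail_eq_zeroStar {n n' : ℕ} (e : Edge n n') :
    tail e = Vertex.zeroStar ↔ e = starOut n n' := by
  rcases e with i | j
  · refine Fin.cases ?_ (fun k => ?_) i <;> simp [tail, starOut]
  · refine Fin.lastCases ?_ (fun k => ?_) j <;> simp [tail, starOut, Fin.castSucc_ne_last]

theorem head_eq_zeroStar {n n' : ℕ} (e : Edge n n') :
    head e = Vertex.zeroStar ↔ e = starIn n n' := by
  rcases e with i | j
  · refine Fin.lastCases ?_ (fun k => ?_) i <;> simp [head, starIn, Fin.castSucc_ne_last]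
  · refine Fin.cases ?_ (fun k => ?_) j <;> simp [head, starIn]

open Classical in
theorem netMomentum_apply {d n n' : ℕ} (P : Set (Vertex n n')) (w : EdgeMom d n n') :
    netMomentum d P w = (∑ e, if tail e ∈ P then w e else 0)
      - ∑ e, if head e ∈ P then w e else 0 := by
  simp only [netMomentum, LinearMap.sub_apply, LinearMap.sum_apply,
    Finset.sum_filter]
  rw [← Finset.sum_sub_distrib, ← Finset.sum_sub_distrib]
  refine Finset.sum_congr rfl fun e _ => ?_
  by_cases h1 : tail e ∈ P <;> by_cases h2 : head e ∈ P <;> simp [h1, h2]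

theorem netMomentum_site {d n n' : ℕ} (μ : Finset (Site n n')) (w : EdgeMom d n n') :
    netMomentum d (Vertex.site '' (μ : Set (Site n n'))) w
      = ∑ v ∈ μ, (w (edgeOut v) - w (edgeIn v)) := by
  classical
  rw [netMomentum_apply, Finset.sum_sub_distrib]
  have inj : ∀ a b : Site n n', edgeOut a = edgeOut b → a = b := fun a b h => by
    have := congrArg tail h
    rw [tail_edgeOut, tail_edgeOut] at this
    exact Vertex.site.inj this
  have inj' : ∀ a b : Site n n', edgeIn a = edgeIn b → a = b := fun a b h => by
    have := congrArg head h
    rw [head_edgeIn, head_edgeIn] at this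
    exact Vertex.site.inj this
  congr 1
  · rw [← Finset.sum_filter, ← Finset.sum_image (s := μ) (g := edgeOut) (f := w)
      (fun a _ b _ h => inj a b h)]
    refine Finset.sum_congr ?_ fun _ _ => rfl
    ext e
    simp only [Set.mem_image, Finset.mem_coe, Finset.mem_filter, Finset.mem_univ, true_and,
      Finset.mem_image]
    exact exists_congr fun v => and_congr_right fun _ => by
      rw [eq_comm, tail_eq_site, eq_comm]
  · rw [← Finset.sum_filter, ← Finset.sum_image (s := μ) (g := edgeIn) (f := w)
      (fun a _ b _ h => inj' a b h)]
    refine Finset.sum_congr ?_ fun _ _ => rfl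
    ext e
    simp only [Set.mem_image, Finset.mem_coe, Finset.mem_filter, Finset.mem_univ, true_and,
      Finset.mem_image]
    exact exists_congr fun v => and_congr_right fun _ => by
      rw [eq_comm, head_eq_site, eq_comm]

theorem netMomentum_zeroStar {d n n' : ℕ} (w : EdgeMom d n n') :
    netMomentum d {Vertex.zeroStar} w = w (starOut n n') - w (starIn n n') := by
  classical
  rw [netMomentum_apply]
  simp [tail_eq_zeroStar, head_eq_zeroStar]

/-- The delta functions of a graph are independent, so that `graphMeasure` is never the default
value of `deltaMeasure`. -/
theorem constraint_surjective (d : ℕ) {n n' : ℕ} (P : Lumps n n') :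
    Function.Surjective (constraint d P) := by
  classical
  intro y
  choose r hr using fun μ : P.parts => P.nonempty_of_mem_parts μ.2
  let x : Site n n' → Mom d := fun v => ∑ μ : P.parts, if r μ = v then y (some μ) else 0
  let w : EdgeMom d n n' := Sum.elim
    (fun i => -∑ k : Fin n, if i ≤ k.castSucc then x (Sum.inl k) else 0)
    (fun j => y none + ∑ k : Fin n', if j ≤ k.castSucc then x (Sum.inr k) else 0)
  have key : ∀ (m : ℕ) (f : Fin m → Mom d) (i : Fin m),
      (∑ k : Fin m, if i.castSucc ≤ k.castSucc then f k else 0)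
        - (∑ k : Fin m, if i.succ ≤ k.castSucc then f k else 0) = f i := by
    intro m f i
    rw [← Finset.sum_sub_distrib, Finset.sum_eq_single i]
    · simp [Fin.le_def]
    · intro b _ hb
      have hb' : (b : ℕ) ≠ i := fun h => hb (Fin.ext h)
      have : (i.succ ≤ b.castSucc) ↔ (i.castSucc ≤ b.castSucc) := by
        simp only [Fin.le_def, Fin.val_succ, Fin.val_castSucc]; omega
      simp [this]
    · simp
  have hw : ∀ v, w (edgeOut v) - w (edgeIn v) = x v := by
    rintro (i | j)
    · rw [← key n (fun k => x (Sum.inl k)) i]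
      simp only [w, edgeOut, edgeIn, Sum.elim_inl]
      abel
    · rw [← key n' (fun k => x (Sum.inr k)) j]
      simp only [w, edgeOut, edgeIn, Sum.elim_inr]
      abel
  have last0 : ∀ (m : ℕ) (f : Fin m → Mom d),
      (∑ k : Fin m, if Fin.last m ≤ k.castSucc then f k else 0) = 0 := by
    intro m f
    refine Finset.sum_eq_zero fun k _ => if_neg ?_
    simp only [Fin.le_def, Fin.val_last, Fin.val_castSucc]; omega
  refine ⟨w, funext fun o => ?_⟩
  cases o with
  | none =>
    change netMomentum d {Vertex.zeroStar} w = _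
    rw [netMomentum_zeroStar]
    simp only [w, starOut, starIn, Sum.elim_inl, Sum.elim_inr, last0]
    simp
  | some μ =>
    change netMomentum d (Vertex.site '' (μ.1 : Set (Site n n'))) w = _
    rw [netMomentum_site]
    simp only [hw, x]
    rw [Finset.sum_comm, Finset.sum_eq_single μ]
    · rw [Finset.sum_ite_eq, if_pos (hr μ)]
    · intro ν _ hν
      rw [Finset.sum_ite_eq, if_neg]
      intro h
      exact hν (Subtype.ext (P.disjoint.elim_finset ν.2 μ.2 _ (hr ν) h))
    · simp

/-- The measure `Δ(P, w, u) dw`, where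
`Δ(P, w, u) = δ(ξ + ∑_{e ∈ L_±(0*)} ± w_e) ∏_μ δ(∑_{e ∈ L_±(P_μ)} ± w_e - u_μ)`. -/
def graphMeasure {d n n' : ℕ} (ξ : Mom d) (P : Lumps n n') (u : P.parts → Mom d) :
    Measure (EdgeMom d n n') :=
  deltaMeasure (constraint d P) (fun o => match o with
    | none => -ξ
    | some μ => u μ)

/-! ## Potential, self-energy, dispersion relation -/

/-- The data that the values of the graphs depend on. -/
structure Setting (d : ℕ) where
  /-- the single site potential -/
  B : 𝓢(Mom d, ℝ)
  /-- the profile of the momentum cutoff of the potential -/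
  χ : Mom d → ℝ
  /-- the initial wave function -/
  ψ₀ : Lp ℂ 2 (volume : Measure (Mom d))
  /-- the momentum dependence of the observable -/
  Q : Mom d → ℂ
  /-- the momentum shift at `0*` -/
  ξ : Mom d
  /-- the coupling constant `λ` -/
  lam : ℝ
  /-- the regularization of the propagators -/
  η : ℝ
  /-- the exponents of the scaling and of the cutoffs -/
  κ : ℝ
  /-- the small exponent of the cutoffs -/
  δ : ℝ
  /-- the time -/
  t : ℝ

namespace Setting

variable {d : ℕ} (M : Setting d)

/-- The Fourier transform of the potential, cut off at momenta of order `λ^{-δ}`. -/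
def Bhat (p : Mom d) : ℂ :=
  (M.χ (M.lam ^ M.δ • p) : ℂ) * 𝓕 (fun x => (M.B x : ℂ)) p

/-- The Fourier transform of the initial wave function. -/
def ψhat (p : Mom d) : ℂ := (𝓕 M.ψ₀ : Lp ℂ 2 (volume : Measure (Mom d))) p

/-- The momentum cutoff `ζ = λ^{-κ-3δ}`. -/
def ζ : ℝ := M.lam ^ (-M.κ - 3 * M.δ)

/-- The cutoff `Y = λ^{-100}` of the `α` and `β` integrals. -/
def Y : ℝ := M.lam ^ (-100 : ℤ)

/-- The upper threshold `K = [λ^{-δ} (λ² t)]`. -/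
def K : ℕ := ⌊M.lam ^ (-M.δ) * (M.lam ^ 2 * M.t)⌋₊

/-- The kinetic energy `e(p) = p² / 2`. -/
def kin (p : Mom d) : ℝ := ‖p‖ ^ 2 / 2

/-- `Θ_ε(a, r) = ∫ |Bhat(q - r)|² / (a - e(q) + i ε) dq`. -/
def Θε (ε a : ℝ) (r : Mom d) : ℂ :=
  ∫ q : Mom d, (‖M.Bhat (q - r)‖ ^ 2 : ℂ) / ((a : ℂ) - kin q + Complex.I * ε)

/-- The self-energy `θ(p) = Θ(e(p)) = lim_{ε → 0+} Θ_ε(e(p), p)`. -/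
def θ (p : Mom d) : ℂ := limUnder (𝓝[>] (0 : ℝ)) (fun ε : ℝ => M.Θε ε (kin p) p)

/-- The renormalized dispersion relation `ω(p) = e(p) + λ² θ(p)`. -/
def disp (p : Mom d) : ℂ := (kin p : ℂ) + M.lam ^ 2 * M.θ p

/-! ## `V`-values and `E`-values -/

variable {n n' : ℕ}

/-- The set to which the measure `dμ(w)` restricts the Lebesgue measure. -/
def cutoffSet (n n' : ℕ) : Set (EdgeMom d n n') := {w | ∀ e, ‖w e‖ ≤ M.ζ}

/-- `⟨x⟩ = (2 + x²)^{1/2}`. -/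
def bracket (p : Mom d) : ℝ := Real.sqrt (2 + ‖p‖ ^ 2)

/-- `N_𝒢(w)`. -/
def N (G : Finset (Site n n')) (w : EdgeMom d n n') : ℝ :=
  ‖M.ψhat (w (zeroOut n n'))‖ * ‖M.ψhat (w (zeroIn n n'))‖
    * (∏ v ∈ Gᶜ, ‖M.Bhat (w (edgeIn v) - w (edgeOut v))‖)
    * ∏ v ∈ G, bracket (w (edgeIn v) - w (edgeOut v)) ^ (-(2 * d : ℤ))

/-- The edges whose propagators are present: all edges, or, in the truncated case, the edges that
are not adjacent to `0*`. -/
def propEdges (trunc : Bool) (n n' : ℕ) : Finset (Edge n n') :=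
  if trunc then Finset.univ \ {starIn n n', starOut n n'} else Finset.univ

/-- `E_{(*)g}(P, u, α)` with a separate parameter `a e` for each edge; the flag `trunc` selects the
truncated version. -/
def Eint (trunc : Bool) (g : ℕ) (P : Lumps n n') (u : P.parts → Mom d) (a : Edge n n' → ℝ) : ℝ :=
  M.lam ^ (n + n') * ⨆ G : {G : Finset (Site n n') // G.card ≤ g},
    ∫ w in M.cutoffSet n n',
      (∏ e ∈ propEdges trunc n n', 1 / ‖(a e : ℂ) - M.disp (w e) + Complex.I * M.η‖) * M.N G.1 w
      ∂(graphMeasure M.ξ P u)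

/-- `E_{(*)g}(P, u)`. -/
def Eu (trunc : Bool) (g : ℕ) (P : Lumps n n') (u : P.parts → Mom d) : ℝ :=
  Real.exp (2 * M.t * M.η) / (2 * Real.pi) ^ 2 *
    ∫ α in (-M.Y)..M.Y, ∫ β in (-M.Y)..M.Y,
      M.Eint trunc g P u (Sum.elim (fun _ => α) (fun _ => β))

/-- The `E`-value `E_{(*)g}(P) = E_{(*)g}(P, u ≡ 0)`. -/
def E (trunc : Bool) (g : ℕ) (P : Lumps n n') : ℝ := M.Eu trunc g P (fun _ => 0)

/-- The factor of `ℳ(w)` at the vertex `v`, on the edge that enters `v`: a self-energy if `v` is a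
single lump and a potential otherwise, with a complex conjugate on the first arc. -/
def vertexFactor (P : Lumps n n') (w : EdgeMom d n n') (v : Site n n') : ℂ :=
  let x : ℂ := if v ∈ singles P then -M.θ (w (edgeIn v))
    else M.Bhat (w (edgeIn v) - w (edgeOut v))
  match v with
  | Sum.inl _ => conj x
  | Sum.inr _ => x

/-- `ℳ(w)`. -/
def calM (P : Lumps n n') (w : EdgeMom d n n') : ℂ :=
  (∏ v, M.vertexFactor P w v) * conj (M.ψhat (w (zeroOut n n'))) * M.ψhat (w (zeroIn n n'))
    * M.Q ((1 / 2 : ℝ) • (w (starIn n n') + w (starOut n n')))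

/-- The propagator `1 / (α - conj ω(p) - i η)` on the edges of `L` and `1 / (β - ω(p) + i η)` on the
edges of `tilde L`. -/
def prop (α β : ℝ) : Edge n n' → Mom d → ℂ
  | Sum.inl _, p => 1 / ((α : ℂ) - conj (M.disp p) - Complex.I * M.η)
  | Sum.inr _, p => 1 / ((β : ℂ) - M.disp p + Complex.I * M.η)

/-- `V_{(*)}(P, α, β)`. -/
def Vint (trunc : Bool) (P : Lumps n n') (α β : ℝ) : ℂ :=
  (M.lam : ℂ) ^ (n + n' + numSingles P) *
    ∫ w in M.cutoffSet n n', (∏ e ∈ propEdges trunc n n', M.prop α β e (w e)) * M.calM P w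
      ∂(graphMeasure M.ξ P (fun _ => 0))

/-- The `V`-value `V_{(*)}(P)`. -/
def V (trunc : Bool) (P : Lumps n n') : ℂ :=
  ((Real.exp (2 * M.t * M.η) / (2 * Real.pi) ^ 2 : ℝ) : ℂ) *
    ∫ α in (-M.Y)..M.Y, ∫ β in (-M.Y)..M.Y,
      Complex.exp (Complex.I * M.t * (α - β)) * M.Vint trunc P α β

end Setting

/-! ## Insertion of gates and of self-energy labels -/

/-- The two things that can be inserted: a gate `g` or a label `ϑ`. -/
inductive Insert : Type
  | gate : Insert
  | theta : Insert

instance : Fintype Insert :=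
  ⟨⟨[Insert.gate, Insert.theta], by simp⟩, fun x => by cases x <;> simp⟩

/-- The places of the insertions, `υ e` of them on the edge `e`. (The edge `e` stands for the vertex
that it enters, so `υ e` insertions are made between this vertex and the one before it.) -/
abbrev Slot {n n' : ℕ} (υ : Edge n n' → ℕ) := Σ e : Edge n n', Fin (υ e)

/-- The vertices of the extended graph, the two vertices of a gate being denoted by the same
letter. -/
abbrev Letter {n n' : ℕ} (υ : Edge n n' → ℕ) := Site n n' ⊕ Slot υ

/-- The letters inserted on the edge `e`: one for each `ϑ` and two for each gate. -/
def insertedAt {n n' : ℕ} {υ : Edge n n' → ℕ} (S : Slot υ → Insert) (e : Edge n n') :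
    List (Letter υ) :=
  (List.finRange (υ e)).flatMap fun k => match S ⟨e, k⟩ with
    | Insert.gate => [Sum.inr ⟨e, k⟩, Sum.inr ⟨e, k⟩]
    | Insert.theta => [Sum.inr ⟨e, k⟩]

/-- The extended sequence of vertices from `0` to `0*`. -/
def leftWord {n n' : ℕ} {υ : Edge n n' → ℕ} (S : Slot υ → Insert) : List (Letter υ) :=
  ((List.finRange n).flatMap fun i =>
      insertedAt S (Sum.inl i.castSucc) ++ [Sum.inl (Sum.inl i)])
    ++ insertedAt S (Sum.inl (Fin.last n))

/-- The extended sequence of the tilde vertices, in the order of their labels (from `0` to `0*`). -/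
def rightWord {n n' : ℕ} {υ : Edge n n' → ℕ} (S : Slot υ → Insert) : List (Letter υ) :=
  ((List.finRange n').flatMap fun j =>
      insertedAt S (Sum.inr j.castSucc) ++ [Sum.inl (Sum.inr j)])
    ++ insertedAt S (Sum.inr (Fin.last n'))

open Classical in
/-- The partition `P_S` of the extended graph: two old vertices are in the same lump if they are in
the same lump of `P`, each inserted `ϑ` is a single lump, and the two vertices of each inserted gate
form a lump. -/
def extendLumps {n n' : ℕ} (P : Lumps n n') {υ : Edge n n' → ℕ} (S : Slot υ → Insert) :
    Lumps (leftWord S).length (rightWord S).length :=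
  Finpartition.ofSetoid (Setoid.ker fun v : Site (leftWord S).length (rightWord S).length =>
    Sum.map P.part id (Sum.elim (leftWord S).get (rightWord S).get v))

/-- The insertion of one object on the edge `e`. -/
def insertOne {n n' : ℕ} (P : Lumps n n') (e : Edge n n') (x : Insert) :=
  extendLumps P (υ := Pi.single e 1) (fun _ => x)

end Feynman

end

noncomputable section

set_option linter.unusedSectionVars false

/-! Let `q` be the momentum of an edge that receives an insertion, and `R(q)` its propagator. The
two vertices of a gate form a lump, so the momentum returns to `q` after the gate; once its own
momentum is integrated out, the gate contributes `λ² R(q) Γ(q)` with `Γ(q) = ∫ |B̂_λ(p - q)|² / (β -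
ω(p) + iη) dp`. A `ϑ` contributes `-λ² R(q) θ(q)`, the second `λ` coming from the power `g(P)`.
Everything rests on the bound `|Γ(q) - θ(q)| ≤ C η^{-1/2} |β - ω(q) + iη|`: the last factor cancels
`R(q)`, and each insertion costs `C λ² η^{-1/2}` pointwise in the other momenta
(`Setting.Regular.norm_slotBar_add_le`). Gates and `ϑ`'s are chosen independently in the slots, so
the sum over `S` is a product of such two-term sums. The first arc is the complex conjugate
situation.

The bound on `Γ - θ` is `Dispersive.gate_le`. If `θ(p)` in the denominator is frozen at `θ(q)`, the
integral becomes a free resolvent integral at distance `a = |β - ω(q) + iη| ≥ η` from the point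
where its boundary value is `θ(q)`. In dimension at least three the free evolution decays like
`s^{-3/2}`, hence this integral is Hölder continuous of order one half up to the boundary, and `√a ≤
η^{-1/2} a`. The freezing error carries `λ²(θ(p) - θ(q))` over two denominators. For radial data `θ`
is Lipschitz in `|p|` (`exists_lipschitz`), and `||p| - |q|| ≤ 2 |e(p) - e(q)| / |p|`; so one
denominator cancels at the price of `a / η` and of a weight `1 / |p|`. The remaining weighted
integral is `O(η^{-1/6})` (`Dispersive.weight_le`), and `λ² η^{-1} η^{-1/6} ≤ η^{-1/2}` is exactly
the condition `λ³ ≤ η`.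

On the side of the graphs, the product of delta functions is Lebesgue measure in the base momentum
and in all vertex increments but one per lump (`IsChart.graphMeasure_eq`). A gate adds one free
momentum, a `ϑ` none, and the integrand acquires one factor per slot
(`Setting.Regular.integrand_extendLumps`). The cutoff `ζ` does not disturb the gates: increments are
at most `λ^{-δ}` and each arc has at most `K` vertices, so the inner momentum of a gate stays below
`ζ` (`Setting.walk_bound_le`). Single lumps already in `P` are paid by their extra `λ`: since `λ|θ|
≤ ⟨0⟩^{-2d}` for small `λ`, they match the weights of the `E`-value when `𝒢` is the set of single
lumps. -/

namespace Feynman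

/-! ### Multipliers that preserve sup bounds on Fourier transforms. -/

section Multipliers

variable {V : Type*} [NormedAddCommGroup V] [InnerProductSpace ℝ V] [FiniteDimensional ℝ V]
  [MeasurableSpace V] [BorelSpace V]

/-- The character `u ↦ exp (i ⟨y, u⟩)`. -/
def phase (y u : V) : ℂ := Complex.exp (Complex.I * (inner ℝ y u : ℝ))

theorem norm_phase (y u : V) : ‖phase y u‖ = 1 := by
  rw [phase, mul_comm, Complex.norm_exp_ofReal_mul_I]

theorem phase_add (y z u : V) : phase (y + z) u = phase y u * phase z u := by
  rw [phase, phase, phase, ← Complex.exp_add, inner_add_left]; push_cast; ring_nf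

theorem continuous_phase : Continuous fun p : V × V => phase p.1 p.2 := by
  unfold phase; fun_prop

theorem norm_phase_sub_one_le (y u : V) : ‖phase y u - 1‖ ≤ ‖y‖ * ‖u‖ := by
  refine (Real.norm_exp_I_mul_ofReal_sub_one_le (x := inner ℝ y u)).trans ?_
  exact norm_inner_le_norm y u

/-- An integrable function whose Fourier transform is bounded by `A`. -/
def FourierBound (k : V → ℂ) (A : ℝ) : Prop :=
  Integrable k ∧ ∀ y, ‖∫ u, phase y u * k u‖ ≤ A

/-- Multiplication by `m` preserves bounds on Fourier transforms, up to the factor `K`. -/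
def IsMult (m : V → ℂ) (K : ℝ) : Prop :=
  ∀ k A, FourierBound k A → FourierBound (fun u => m u * k u) (K * A)

theorem IsMult.mul {m₁ m₂ : V → ℂ} {K₁ K₂ : ℝ} (h₁ : IsMult m₁ K₁) (h₂ : IsMult m₂ K₂) :
    IsMult (fun u => m₁ u * m₂ u) (K₁ * K₂) := by
  intro k A hk
  simpa [mul_assoc] using h₁ _ _ (h₂ k A hk)

theorem IsMult.add {m₁ m₂ : V → ℂ} {K₁ K₂ : ℝ} (h₁ : IsMult m₁ K₁) (h₂ : IsMult m₂ K₂) :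
    IsMult (fun u => m₁ u + m₂ u) (K₁ + K₂) := by
  intro k A hk
  obtain ⟨i₁, b₁⟩ := h₁ k A hk
  obtain ⟨i₂, b₂⟩ := h₂ k A hk
  have ph : ∀ (y : V) {g : V → ℂ}, Integrable g → Integrable fun u => phase y u * g u := by
    intro y g hg
    refine hg.bdd_mul (c := 1) ?_ ?_
    · exact (continuous_phase.comp (by fun_prop : Continuous fun u : V => (y, u))).aestronglyMeasurable
    · exact ae_of_all _ fun u => (norm_phase y u).le
  refine ⟨(i₁.add i₂).congr (ae_of_all _ fun u => (add_mul _ _ _).symm), fun y => ?_⟩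
  simp only [add_mul, mul_add]
  rw [integral_add (ph y i₁) (ph y i₂)]
  exact (norm_add_le _ _).trans (add_le_add (b₁ y) (b₂ y))

/-- Multiplying by a character only translates the Fourier transform, which leaves its supremum
unchanged; a superposition of characters therefore costs the total mass of its density. The scale
`r` sits in the characters and does not enter the constant. -/
theorem isMult_of_integral {Φ : V → ℂ} (hΦ : Integrable Φ) (r : ℝ) {m : V → ℂ}
    (hm : ∀ u, m u = ∫ x, Φ x * phase (r • x) u) : IsMult m (∫ x, ‖Φ x‖) := by
  rintro k A ⟨hk, hA⟩
  have hF : Integrable (fun p : V × V => Φ p.1 * k p.2) (volume.prod volume) := hΦ.mul_prod hk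
  have hG : ∀ y : V, Integrable
      (fun p : V × V => (phase y p.2 * phase (r • p.1) p.2) * (Φ p.1 * k p.2))
      (volume.prod volume) := by
    intro y
    refine hF.bdd_mul (c := 1) ?_ ?_
    · refine Continuous.aestronglyMeasurable ?_
      exact (continuous_phase.comp (by fun_prop : Continuous fun p : V × V => (y, p.2))).mul
        (continuous_phase.comp (by fun_prop : Continuous fun p : V × V => (r • p.1, p.2)))
    · exact ae_of_all _ fun p => by rw [norm_mul, norm_phase, norm_phase, mul_one]
  have e1 : ∀ y u, ∫ x, (phase y u * phase (r • x) u) * (Φ x * k u) = phase y u * (m u * k u) := by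
    intro y u
    rw [hm u, ← mul_assoc, mul_comm (phase y u), mul_assoc, ← integral_mul_const]
    congr 1; ext x; ring
  refine ⟨?_, fun y => ?_⟩
  · refine (hG 0).integral_prod_right.congr (ae_of_all _ fun u => ?_)
    simp only [e1]
    simp [phase]
  · have : ∫ u, phase y u * (m u * k u)
        = ∫ x, Φ x * ∫ u, phase (y + r • x) u * k u := by
      simp_rw [← e1 y]
      rw [integral_integral_swap
        (f := fun u x => (phase y u * phase (r • x) u) * (Φ x * k u)) (hG y).swap]
      congr 1; ext x
      rw [← integral_const_mul]
      congr 1; ext u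
      rw [phase_add]; ring
    rw [this, ← integral_mul_const]
    refine norm_integral_le_of_norm_le (hΦ.norm.mul_const A) (ae_of_all _ fun x => ?_)
    rw [norm_mul]
    exact mul_le_mul_of_nonneg_left (hA _) (norm_nonneg _)

/-- Fourier inversion, with the dilation moved into the characters: the density is the same for all
`c`, the source of uniformity in the momentum cutoff `λ^{-δ}`. -/
theorem schwartz_eq_integral (φ : 𝓢(V, ℂ)) (c : ℝ) (u : V) :
    φ (c • u) = ∫ x, (𝓕⁻ φ) x * phase ((-(2 * Real.pi) * c) • x) u := by
  have h : 𝓕 (𝓕⁻ φ) = φ := FourierTransform.fourier_fourierInv_eq φ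
  conv_lhs => rw [← h]
  rw [SchwartzMap.fourier_coe, Real.fourier_eq']
  congr 1; ext x
  rw [smul_eq_mul, mul_comm, phase, inner_smul_left, inner_smul_right]
  congr 2
  simp; ring

/-- A translation by `w` multiplies the density by a unimodular factor, and the difference of two
translates multiplies it by that factor minus one, which is at most `2π |c| |x| |w|`. The zeroth and
first moments of the density hence suffice, and `|c| ≤ 1` makes `K` independent of the scale. -/
theorem exists_isMult_comp_smul (φ : 𝓢(V, ℂ)) : ∃ K : ℝ, 0 ≤ K ∧ ∀ c : ℝ, |c| ≤ 1 →
    (∀ w, IsMult (fun u => φ (c • (u - w))) K) ∧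
    (∀ w, IsMult (fun u => φ (c • (u - w)) - φ (c • u)) (K * ‖w‖)) := by
  set Φ : 𝓢(V, ℂ) := 𝓕⁻ φ with hΦ
  have i0 : Integrable Φ := Φ.integrable
  have i1 : Integrable fun x => ‖x‖ * ‖Φ x‖ := by simpa using Φ.integrable_pow_mul volume 1
  have ph : ∀ (y : V) {g : V → ℂ} (r : ℝ), Integrable g → Integrable fun x => g x * phase (r • x) y := by
    intro y g r hg
    refine hg.mul_bdd (c := 1) ?_ ?_
    · exact (continuous_phase.comp (by fun_prop : Continuous fun x : V => (r • x, y))).aestronglyMeasurable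
    · exact ae_of_all _ fun u => (norm_phase _ _).le
  refine ⟨(∫ x, ‖Φ x‖) + 2 * Real.pi * ∫ x, ‖x‖ * ‖Φ x‖, by positivity, fun c hc => ⟨fun w => ?_, fun w => ?_⟩⟩
  · have : IsMult (fun u => φ (c • (u - w))) (∫ x, ‖Φ x * phase ((2 * Real.pi * c) • x) w‖) := by
      refine isMult_of_integral (ph w _ i0) (-(2 * Real.pi) * c) fun u => ?_
      rw [schwartz_eq_integral]
      congr 1; ext x
      rw [mul_assoc]; congr 1
      simp only [phase, ← Complex.exp_add, inner_sub_right, inner_smul_left]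
      congr 1; simp; ring
    intro k A hk
    have hA : 0 ≤ A := (norm_nonneg _).trans (hk.2 0)
    obtain ⟨a, b⟩ := this k A hk
    refine ⟨a, fun y => (b y).trans (mul_le_mul_of_nonneg_right ?_ hA)⟩
    simp only [norm_mul, norm_phase, mul_one]
    have : 0 ≤ 2 * Real.pi * ∫ x, ‖x‖ * ‖Φ x‖ := by positivity
    linarith
  · have : IsMult (fun u => φ (c • (u - w)) - φ (c • u))
        (∫ x, ‖Φ x * (phase ((2 * Real.pi * c) • x) w - 1)‖) := by
      refine isMult_of_integral ?_ (-(2 * Real.pi) * c) fun u => ?_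
      · simp only [mul_sub, mul_one]
        exact (ph w _ i0).sub i0
      · rw [schwartz_eq_integral, schwartz_eq_integral, ← integral_sub (ph _ _ i0) (ph _ _ i0)]
        congr 1; ext x
        rw [mul_sub, sub_mul, mul_one, mul_assoc]; congr 2
        simp only [phase, ← Complex.exp_add, inner_sub_right, inner_smul_left]
        congr 1; simp; ring
    intro k A hk
    have hA : 0 ≤ A := (norm_nonneg _).trans (hk.2 0)
    obtain ⟨a, b⟩ := this k A hk
    refine ⟨a, fun y => (b y).trans (mul_le_mul_of_nonneg_right ?_ hA)⟩
    have h1 : ∫ x, ‖Φ x * (phase ((2 * Real.pi * c) • x) w - 1)‖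
        ≤ ∫ x, (2 * Real.pi * ‖w‖) * (‖x‖ * ‖Φ x‖) := by
      refine integral_mono_of_nonneg (ae_of_all _ fun _ => norm_nonneg _) (i1.const_mul _)
        (ae_of_all _ fun x => ?_)
      have h2 := norm_phase_sub_one_le ((2 * Real.pi * c) • x) w
      have h3 : ‖(2 * Real.pi * c) • x‖ ≤ 2 * Real.pi * ‖x‖ := by
        rw [norm_smul, Real.norm_eq_abs, abs_mul, abs_of_pos Real.two_pi_pos]
        have := mul_le_mul_of_nonneg_left hc Real.two_pi_pos.le
        rw [mul_one] at this
        exact mul_le_mul_of_nonneg_right this (norm_nonneg _)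
      simp only [norm_mul]
      calc ‖Φ x‖ * ‖phase ((2 * Real.pi * c) • x) w - 1‖
          ≤ ‖Φ x‖ * (2 * Real.pi * ‖x‖ * ‖w‖) := by
            gcongr; exact h2.trans (by gcongr)
        _ = _ := by ring
    rw [integral_const_mul] at h1
    have : 0 ≤ (∫ x, ‖Φ x‖) * ‖w‖ := by positivity
    nlinarith

end Multipliers

end Feynman

namespace Feynman

/-! ### Dispersive decay of the free evolution. -/

section Decay

variable {V : Type*} [NormedAddCommGroup V] [InnerProductSpace ℝ V] [FiniteDimensional ℝ V]
  [MeasurableSpace V] [BorelSpace V]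

/-- The transform is again a Gaussian, with exponent `-|y|² / (4b)`, and `Re (1/b) ≥ 0`. Only `|b|`
enters the bound, so the decay survives as `b` approaches the imaginary axis. -/
theorem fourierBound_gaussian {b : ℂ} (hb : 0 < b.re) :
    FourierBound (fun p : V => Complex.exp (-b * ‖p‖ ^ 2))
      ((Real.pi / ‖b‖) ^ ((Module.finrank ℝ V : ℝ) / 2)) := by
  have hb0 : b ≠ 0 := by contrapose! hb; simp [hb]
  refine ⟨by simpa using GaussianFourier.integrable_cexp_neg_mul_sq_norm_add hb 0 (0 : V), fun y => ?_⟩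
  have e : ∫ u, phase y u * Complex.exp (-b * ‖u‖ ^ 2)
      = (Real.pi / b) ^ (Module.finrank ℝ V / 2 : ℂ)
        * Complex.exp (Complex.I ^ 2 * ‖y‖ ^ 2 / (4 * b)) := by
    rw [← GaussianFourier.integral_cexp_neg_mul_sq_norm_add hb Complex.I y]
    congr 1; ext u
    rw [phase, ← Complex.exp_add, add_comm]
  rw [e, norm_mul]
  have h1 : ‖(Real.pi / b : ℂ) ^ (Module.finrank ℝ V / 2 : ℂ)‖
      = (Real.pi / ‖b‖) ^ ((Module.finrank ℝ V : ℝ) / 2) := by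
    have : (Module.finrank ℝ V / 2 : ℂ) = (((Module.finrank ℝ V : ℝ) / 2 : ℝ) : ℂ) := by
      push_cast; rfl
    rw [this, Complex.norm_cpow_real, norm_div, Complex.norm_real,
      Real.norm_of_nonneg Real.pi_pos.le]
  rw [h1]
  refine mul_le_of_le_one_right (by positivity) ?_
  rw [Complex.norm_exp, Real.exp_le_one_iff]
  have h2 : Complex.I ^ 2 * (‖y‖ : ℂ) ^ 2 / (4 * b) = ((-(‖y‖ ^ 2 / 4) : ℝ) : ℂ) * b⁻¹ := by
    rw [Complex.I_sq]; push_cast; field_simp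
  rw [h2, Complex.re_ofReal_mul, Complex.inv_re]
  have : 0 ≤ b.re / Complex.normSq b := div_nonneg hb.le (Complex.normSq_nonneg _)
  have : 0 ≤ ‖y‖ ^ 2 / 4 := by positivity
  nlinarith

theorem norm_exp_quadratic_le_one {b : ℂ} (hb : 0 ≤ b.re) (p : V) :
    ‖Complex.exp (-b * ‖p‖ ^ 2 / 2)‖ ≤ 1 := by
  rw [Complex.norm_exp, Real.exp_le_one_iff]
  have : (-b * (‖p‖ : ℂ) ^ 2 / 2) = ((-(‖p‖ ^ 2 / 2) : ℝ) : ℂ) * b := by push_cast; ring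
  rw [this, Complex.re_ofReal_mul]
  have : 0 ≤ ‖p‖ ^ 2 / 2 := by positivity
  nlinarith

/-- For `Re b > 0` the multiplier acts on the Gaussian and the result is read off at frequency zero.
On the imaginary axis the Gaussian is not integrable, and the bound is obtained as a limit from `b +
1/(n+1)`, dominated by `|m|`. -/
theorem IsMult.norm_integral_gaussian_le {m : V → ℂ} {K : ℝ} (hm : IsMult m K)
    (hi : Integrable m) {b : ℂ} (hb : 0 ≤ b.re) (hb0 : b ≠ 0) :
    ‖∫ p, m p * Complex.exp (-b * ‖p‖ ^ 2 / 2)‖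
      ≤ K * (2 * Real.pi / ‖b‖) ^ ((Module.finrank ℝ V : ℝ) / 2) := by
  have key : ∀ b : ℂ, 0 < b.re → ‖∫ p, m p * Complex.exp (-b * ‖p‖ ^ 2 / 2)‖
      ≤ K * (2 * Real.pi / ‖b‖) ^ ((Module.finrank ℝ V : ℝ) / 2) := by
    intro b hb
    have hb' : 0 < (b / 2).re := by simpa using hb
    have := (hm _ _ (fourierBound_gaussian (V := V) hb')).2 0
    have e : Real.pi / ‖b / 2‖ = 2 * Real.pi / ‖b‖ := by
      rw [norm_div]; simp; field_simp
    rw [e] at this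
    convert this using 3
    ext p
    simp only [phase, inner_zero_left, Complex.ofReal_zero, mul_zero, Complex.exp_zero, one_mul]
    congr 2; ring
  have hlim : Tendsto (fun n : ℕ => b + ((1 / ((n : ℝ) + 1) : ℝ) : ℂ)) atTop (𝓝 b) := by
    have := (Complex.continuous_ofReal.tendsto 0).comp (tendsto_one_div_add_atTop_nhds_zero_nat (𝕜 := ℝ))
    simpa using tendsto_const_nhds.add this
  have hre : ∀ n : ℕ, 0 < (b + ((1 / ((n : ℝ) + 1) : ℝ) : ℂ)).re := fun n => by
    rw [Complex.add_re, Complex.ofReal_re]; positivity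
  have L : Tendsto (fun n : ℕ => ∫ p, m p *
      Complex.exp (-(b + ((1 / ((n : ℝ) + 1) : ℝ) : ℂ)) * ‖p‖ ^ 2 / 2)) atTop
      (𝓝 (∫ p, m p * Complex.exp (-b * ‖p‖ ^ 2 / 2))) := by
    refine tendsto_integral_of_dominated_convergence (fun p => ‖m p‖) (fun n => ?_) hi.norm
      (fun n => ae_of_all _ fun p => ?_) (ae_of_all _ fun p => ?_)
    · exact hi.aestronglyMeasurable.mul (Continuous.aestronglyMeasurable (by fun_prop))
    · rw [norm_mul]
      exact mul_le_of_le_one_right (norm_nonneg _) (norm_exp_quadratic_le_one (hre n).le p)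
    · have : Continuous fun z : ℂ => m p * Complex.exp (-z * ‖p‖ ^ 2 / 2) := by fun_prop
      exact (this.tendsto b).comp hlim
  refine le_of_tendsto_of_tendsto L.norm ?_ (Eventually.of_forall fun n => key _ (hre n))
  have hc : ContinuousAt (fun z : ℂ => K * (2 * Real.pi / ‖z‖) ^ ((Module.finrank ℝ V : ℝ) / 2)) b := by
    have : ‖b‖ ≠ 0 := norm_ne_zero_iff.2 hb0
    refine continuousAt_const.mul (ContinuousAt.rpow_const ?_ (Or.inr (by positivity)))
    exact continuousAt_const.div continuous_norm.continuousAt this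
  exact hc.tendsto.comp hlim

/-- The functions `u ↦ φ₁ (c u) φ₂ u`. -/
def scaledProd (φ₁ φ₂ : 𝓢(V, ℂ)) (c : ℝ) (u : V) : ℂ := φ₁ (c • u) * φ₂ u

theorem continuous_scaledProd (φ₁ φ₂ : 𝓢(V, ℂ)) (c : ℝ) : Continuous (scaledProd φ₁ φ₂ c) := by
  have := φ₁.continuous; have := φ₂.continuous
  unfold scaledProd; fun_prop

theorem exists_norm_le (φ : 𝓢(V, ℂ)) : ∃ C : ℝ, 0 ≤ C ∧ ∀ u, ‖φ u‖ ≤ C := by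
  refine ⟨SchwartzMap.seminorm ℝ 0 0 φ, apply_nonneg _ _, fun u => ?_⟩
  simpa using SchwartzMap.norm_pow_mul_le_seminorm ℝ φ 0 u

theorem integrable_scaledProd (φ₁ φ₂ : 𝓢(V, ℂ)) (c : ℝ) : Integrable (scaledProd φ₁ φ₂ c) := by
  obtain ⟨C, -, hC⟩ := exists_norm_le φ₁
  have := φ₁.continuous
  exact φ₂.integrable.bdd_mul (c := C) (by fun_prop : Continuous fun u => φ₁ (c • u)).aestronglyMeasurable
    (ae_of_all _ fun u => hC _)

theorem integrable_norm_mul_scaledProd (φ₁ φ₂ : 𝓢(V, ℂ)) (c : ℝ) :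
    Integrable fun u => ‖u‖ * ‖scaledProd φ₁ φ₂ c u‖ := by
  obtain ⟨C, hC0, hC⟩ := exists_norm_le φ₁
  have i1 : Integrable fun x => ‖x‖ * ‖φ₂ x‖ := by simpa using φ₂.integrable_pow_mul volume 1
  have := continuous_scaledProd φ₁ φ₂ c
  refine (i1.const_mul C).mono' (by fun_prop : Continuous _).aestronglyMeasurable (ae_of_all _ fun u => ?_)
  rw [norm_mul, norm_norm, norm_norm, scaledProd, norm_mul]
  calc ‖u‖ * (‖φ₁ (c • u)‖ * ‖φ₂ u‖) ≤ ‖u‖ * (C * ‖φ₂ u‖) := by gcongr; exact hC _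
    _ = _ := by ring

theorem exists_integral_bounds (φ₁ φ₂ : 𝓢(V, ℂ)) : ∃ C : ℝ, 0 ≤ C ∧ ∀ c : ℝ,
    (∀ u, ‖scaledProd φ₁ φ₂ c u‖ ≤ C) ∧
    (∫ u, ‖scaledProd φ₁ φ₂ c u‖) ≤ C ∧ (∫ u, ‖u‖ * ‖scaledProd φ₁ φ₂ c u‖) ≤ C := by
  obtain ⟨C, hC0, hC⟩ := exists_norm_le φ₁
  obtain ⟨D, hD0, hD⟩ := exists_norm_le φ₂
  have i0 : Integrable φ₂ := φ₂.integrable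
  have i1 : Integrable fun x => ‖x‖ * ‖φ₂ x‖ := by simpa using φ₂.integrable_pow_mul volume 1
  have a0 : 0 ≤ C * ∫ x, ‖φ₂ x‖ := by positivity
  have a1 : 0 ≤ C * ∫ x, ‖x‖ * ‖φ₂ x‖ := by positivity
  have a2 : 0 ≤ C * D := by positivity
  refine ⟨C * D + C * (∫ x, ‖φ₂ x‖) + C * ∫ x, ‖x‖ * ‖φ₂ x‖, by positivity, fun c => ⟨fun u => ?_, ?_, ?_⟩⟩
  · rw [scaledProd, norm_mul]
    have := mul_le_mul (hC (c • u)) (hD u) (norm_nonneg _) hC0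
    linarith
  · have : (∫ u, ‖scaledProd φ₁ φ₂ c u‖) ≤ ∫ u, C * ‖φ₂ u‖ := by
      refine integral_mono_of_nonneg (ae_of_all _ fun _ => norm_nonneg _) (i0.norm.const_mul _)
        (ae_of_all _ fun u => ?_)
      simp only [scaledProd, norm_mul]
      exact mul_le_mul_of_nonneg_right (hC _) (norm_nonneg _)
    rw [integral_const_mul] at this
    linarith
  · have : (∫ u, ‖u‖ * ‖scaledProd φ₁ φ₂ c u‖) ≤ ∫ u, C * (‖u‖ * ‖φ₂ u‖) := by
      refine integral_mono_of_nonneg (ae_of_all _ fun _ => by positivity) (i1.const_mul _)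
        (ae_of_all _ fun u => ?_)
      simp only [scaledProd, norm_mul]
      calc ‖u‖ * (‖φ₁ (c • u)‖ * ‖φ₂ u‖) ≤ ‖u‖ * (C * ‖φ₂ u‖) := by gcongr; exact hC _
        _ = _ := by ring
    rw [integral_const_mul] at this
    linarith

/-- Dimension at least three gives the exponent `3/2`, integrable at large times. -/
theorem rpow_finrank_le (hd : 3 ≤ Module.finrank ℝ V) {b : ℂ} (hb : 1 ≤ ‖b‖) :
    (2 * Real.pi / ‖b‖) ^ ((Module.finrank ℝ V : ℝ) / 2)
      ≤ (2 * Real.pi) ^ ((Module.finrank ℝ V : ℝ) / 2) * ‖b‖ ^ (-(3 / 2) : ℝ) := by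
  rw [Real.div_rpow (by positivity) (by positivity), div_eq_mul_inv, ← Real.rpow_neg (by positivity)]
  have : (3 : ℝ) ≤ Module.finrank ℝ V := by exact_mod_cast hd
  gcongr

/-- Dispersive decay in dimension at least three, uniform in the scale `c` and the shift `w`. -/
theorem exists_decay (hd : 3 ≤ Module.finrank ℝ V) (φ₁ φ₂ : 𝓢(V, ℂ)) : ∃ C : ℝ, 0 ≤ C ∧
    ∀ c : ℝ, |c| ≤ 1 →
    (∀ (w : V) (b : ℂ), 0 ≤ b.re → b ≠ 0 →
      ‖∫ p, scaledProd φ₁ φ₂ c (p - w) * Complex.exp (-b * ‖p‖ ^ 2 / 2)‖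
        ≤ C * min 1 (‖b‖ ^ (-(3 / 2) : ℝ))) ∧
    (∀ (w : V) (b : ℂ), 0 ≤ b.re → 1 ≤ ‖b‖ →
      ‖∫ p, (scaledProd φ₁ φ₂ c (p - w) - scaledProd φ₁ φ₂ c p)
          * Complex.exp (-b * ‖p‖ ^ 2 / 2)‖ ≤ C * ‖w‖ * ‖b‖ ^ (-(3 / 2) : ℝ)) := by
  obtain ⟨K₁, hK₁, h₁⟩ := exists_isMult_comp_smul φ₁
  obtain ⟨K₂, hK₂, h₂⟩ := exists_isMult_comp_smul φ₂
  obtain ⟨C₀, hC₀, h₀⟩ := exists_integral_bounds φ₁ φ₂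
  set T : ℝ := (2 * Real.pi) ^ ((Module.finrank ℝ V : ℝ) / 2) with hT
  have hT0 : 0 ≤ T := by positivity
  have hKT : 0 ≤ K₁ * K₂ * T := by positivity
  have iw : ∀ (c : ℝ) (w : V), Integrable fun p => scaledProd φ₁ φ₂ c (p - w) := fun c w =>
    (integrable_scaledProd φ₁ φ₂ c).comp_sub_right w
  -- `C₀`, the bound on the `L¹` norm, serves `|b| ≤ 1`; the factor two comes from the two terms of
  -- the product rule for the difference of translates.
  refine ⟨C₀ + 2 * (K₁ * K₂ * T), by positivity, fun c hc => ⟨fun w b hb hb0 => ?_, fun w b hb hb1 => ?_⟩⟩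
  · rcases le_total 1 ‖b‖ with hb1 | hb1
    · have m : IsMult (fun p => scaledProd φ₁ φ₂ c (p - w)) (K₁ * K₂) := by
        have := ((h₁ c hc).1 w).mul ((h₂ 1 (by simp)).1 w)
        simpa [scaledProd] using this
      have := m.norm_integral_gaussian_le (iw c w) hb hb0
      have h3 := mul_le_mul_of_nonneg_left (rpow_finrank_le hd hb1) (mul_nonneg hK₁ hK₂)
      rw [min_eq_right (Real.rpow_le_one_of_one_le_of_nonpos hb1 (by norm_num))]
      refine this.trans (h3.trans ?_)
      rw [← mul_assoc, ← hT]
      gcongr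
      linarith
    · rw [min_eq_left (Real.one_le_rpow_of_pos_of_le_one_of_nonpos (norm_pos_iff.2 hb0) hb1 (by norm_num)), mul_one]
      have : ‖∫ p, scaledProd φ₁ φ₂ c (p - w) * Complex.exp (-b * ‖p‖ ^ 2 / 2)‖
          ≤ ∫ p, ‖scaledProd φ₁ φ₂ c (p - w)‖ := by
        refine norm_integral_le_of_norm_le (iw c w).norm (ae_of_all _ fun p => ?_)
        rw [norm_mul]
        exact mul_le_of_le_one_right (norm_nonneg _) (norm_exp_quadratic_le_one hb p)
      rw [integral_sub_right_eq_self (fun p => ‖scaledProd φ₁ φ₂ c p‖) w] at this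
      have := (h₀ c).2.1
      linarith
  · have m : IsMult (fun p => scaledProd φ₁ φ₂ c (p - w) - scaledProd φ₁ φ₂ c p)
        (K₁ * (K₂ * ‖w‖) + K₁ * ‖w‖ * K₂) := by
      -- Discrete product rule: in each of the two terms one factor is differenced and the other one
      -- is only translated or left in place.
      have := (((h₁ c hc).1 w).mul ((h₂ 1 (by simp)).2 w)).add
        (((h₁ c hc).2 w).mul ((h₂ 1 (by simp)).1 0))
      refine (by simpa only [one_smul, sub_zero] using this : IsMult _ _) |> fun h => ?_
      convert h using 1
      ext p
      simp only [scaledProd]; ring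
    have hb0 : b ≠ 0 := by rintro rfl; simp at hb1; linarith
    have := m.norm_integral_gaussian_le ((iw c w).sub (integrable_scaledProd φ₁ φ₂ c)) hb hb0
    have h3 := mul_le_mul_of_nonneg_left (rpow_finrank_le hd hb1)
      (by positivity : 0 ≤ K₁ * (K₂ * ‖w‖) + K₁ * ‖w‖ * K₂)
    refine this.trans (h3.trans ?_)
    rw [← mul_assoc, ← hT]
    refine mul_le_mul_of_nonneg_right ?_ (by positivity)
    nlinarith [mul_nonneg hC₀ (norm_nonneg w)]

end Decay

end Feynman

/-! ### Scalar time integrals. -/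

namespace Feynman

theorem norm_exp_sub_one_le_min {z : ℂ} (hz : z.re ≤ 0) :
    ‖Complex.exp z - 1‖ ≤ 2 * min 1 ‖z‖ := by
  rcases le_total ‖z‖ 1 with h | h
  · rw [min_eq_right h]; exact Complex.norm_exp_sub_one_le h
  · rw [min_eq_left h]
    refine (norm_sub_le _ _).trans ?_
    have : ‖Complex.exp z‖ ≤ 1 := by rw [Complex.norm_exp, Real.exp_le_one_iff]; exact hz
    simp only [norm_one]; linarith

/-- The time decay of the free evolution. -/
def timeDecay (s : ℝ) : ℝ := min 1 (s ^ (-(3 / 2) : ℝ))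

theorem timeDecay_nonneg {s : ℝ} (hs : 0 < s) : 0 ≤ timeDecay s :=
  le_min zero_le_one (Real.rpow_nonneg hs.le _)

theorem measurable_timeDecay : Measurable timeDecay := by unfold timeDecay; fun_prop

/-- The constant is `1 + 2`, from the intervals `(0, 1]` and `(1, ∞)`. -/
theorem timeDecay_bound : IntegrableOn timeDecay (Set.Ioi 0) ∧ ∫ s in Set.Ioi 0, timeDecay s ≤ 3 := by
  have hu : Set.Ioi (0 : ℝ) = Set.Ioc 0 1 ∪ Set.Ioi 1 := by
    rw [Set.Ioc_union_Ioi_eq_Ioi zero_le_one]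
  have m : ∀ μ : Measure ℝ, AEStronglyMeasurable timeDecay μ := fun μ =>
    measurable_timeDecay.aestronglyMeasurable
  have b1 : ∀ s ∈ Set.Ioc (0 : ℝ) 1, ‖timeDecay s‖ ≤ 1 := fun s hs => by
    rw [Real.norm_of_nonneg (timeDecay_nonneg hs.1)]; exact min_le_left _ _
  have b2 : ∀ s ∈ Set.Ioi (1 : ℝ), ‖timeDecay s‖ ≤ s ^ (-(3 / 2) : ℝ) := fun s hs => by
    rw [Real.norm_of_nonneg (timeDecay_nonneg (zero_lt_one.trans hs))]; exact min_le_right _ _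
  have i2 : IntegrableOn (fun s : ℝ => s ^ (-(3 / 2) : ℝ)) (Set.Ioi 1) :=
    integrableOn_Ioi_rpow_of_lt (by norm_num) one_pos
  have h1 : IntegrableOn timeDecay (Set.Ioc 0 1) :=
    Measure.integrableOn_of_bounded (M := 1) (by simp) (m _) ((ae_restrict_mem measurableSet_Ioc).mono b1)
  have h2 : IntegrableOn timeDecay (Set.Ioi 1) :=
    i2.mono' (m _) ((ae_restrict_mem measurableSet_Ioi).mono b2)
  refine ⟨hu ▸ h1.union h2, ?_⟩
  rw [hu, setIntegral_union (Set.Ioc_disjoint_Ioi le_rfl) measurableSet_Ioi h1 h2]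
  have c1 : ∫ s in Set.Ioc (0 : ℝ) 1, timeDecay s ≤ 1 := by
    have := norm_setIntegral_le_of_norm_le_const (C := 1) (μ := volume) (s := Set.Ioc (0 : ℝ) 1) (by simp) b1
    simpa using (le_abs_self _).trans this
  have c2 : ∫ s in Set.Ioi (1 : ℝ), timeDecay s ≤ 2 := by
    refine (setIntegral_mono_on h2 i2 measurableSet_Ioi fun s hs => min_le_right _ _).trans ?_
    rw [integral_Ioi_rpow_of_lt (by norm_num) one_pos]
    norm_num
  linarith

/-- A dominating function for Hölder estimates of order one half. -/
theorem exists_dominating {x : ℝ} (hx : 0 < x) : ∃ D : ℝ → ℝ, IntegrableOn D (Set.Ioi 0) ∧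
    (∀ s, 0 < s → min 1 (s * x) * timeDecay s ≤ D s) ∧ ∫ s in Set.Ioi 0, D s ≤ 4 * √x := by
  classical
  -- The two bounds on the minimum cross at `s = 1/x`; each of the two pieces integrates to `2√x`.
  set D : ℝ → ℝ := fun s => if s ≤ 1 / x then x * s ^ (-(1 / 2) : ℝ) else s ^ (-(3 / 2) : ℝ) with hD
  have hx' : 0 < 1 / x := by positivity
  have hu : Set.Ioi (0 : ℝ) = Set.Ioc 0 (1 / x) ∪ Set.Ioi (1 / x) := by
    rw [Set.Ioc_union_Ioi_eq_Ioi hx'.le]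
  have i1 : IntegrableOn (fun s : ℝ => x * s ^ (-(1 / 2) : ℝ)) (Set.Ioc 0 (1 / x)) := by
    have := (intervalIntegral.intervalIntegrable_rpow' (a := 0) (b := 1 / x) (r := -(1 / 2)) (by norm_num))
    exact ((intervalIntegrable_iff_integrableOn_Ioc_of_le hx'.le).1 this).const_mul x
  have i2 : IntegrableOn (fun s : ℝ => s ^ (-(3 / 2) : ℝ)) (Set.Ioi (1 / x)) :=
    integrableOn_Ioi_rpow_of_lt (by norm_num) hx'
  have e1 : Set.EqOn D (fun s : ℝ => x * s ^ (-(1 / 2) : ℝ)) (Set.Ioc 0 (1 / x)) := fun s hs => if_pos hs.2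
  have e2 : Set.EqOn D (fun s : ℝ => s ^ (-(3 / 2) : ℝ)) (Set.Ioi (1 / x)) := fun s hs =>
    if_neg (not_le.2 hs)
  have h1 : IntegrableOn D (Set.Ioc 0 (1 / x)) := i1.congr_fun e1.symm measurableSet_Ioc
  have h2 : IntegrableOn D (Set.Ioi (1 / x)) := i2.congr_fun e2.symm measurableSet_Ioi
  refine ⟨D, hu ▸ h1.union h2, fun s hs => ?_, ?_⟩
  · have ht : timeDecay s ≤ s ^ (-(3 / 2) : ℝ) := min_le_right _ _
    have hp : 0 ≤ s ^ (-(3 / 2) : ℝ) := Real.rpow_nonneg hs.le _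
    by_cases h : s ≤ 1 / x
    · simp only [hD, if_pos h]
      calc min 1 (s * x) * timeDecay s ≤ (s * x) * s ^ (-(3 / 2) : ℝ) :=
            mul_le_mul (min_le_right _ _) ht (timeDecay_nonneg hs) (by positivity)
        _ = x * (s ^ (1 : ℝ) * s ^ (-(3 / 2) : ℝ)) := by rw [Real.rpow_one]; ring
        _ = _ := by rw [← Real.rpow_add hs]; norm_num
    · simp only [hD, if_neg h]
      exact (mul_le_mul (min_le_left _ _) ht (timeDecay_nonneg hs) zero_le_one).trans (by rw [one_mul])
  · rw [hu, setIntegral_union (Set.Ioc_disjoint_Ioi le_rfl) measurableSet_Ioi h1 h2,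
      setIntegral_congr_fun measurableSet_Ioc e1, setIntegral_congr_fun measurableSet_Ioi e2,
      integral_Ioi_rpow_of_lt (by norm_num) hx', integral_const_mul,
      ← intervalIntegral.integral_of_le hx'.le, integral_rpow (Or.inl (by norm_num))]
    have h3 : (1 / x) ^ (-(1 / 2) : ℝ) = √x := by
      rw [one_div, Real.inv_rpow hx.le, Real.rpow_neg hx.le, inv_inv, ← Real.sqrt_eq_rpow]
    have h4 : (1 / x) ^ (1 / 2 : ℝ) = (√x)⁻¹ := by
      rw [one_div, Real.inv_rpow hx.le, ← Real.sqrt_eq_rpow]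
    have h5 : x * (√x)⁻¹ = √x := by
      have := Real.sq_sqrt hx.le
      have h6 : √x ≠ 0 := (Real.sqrt_pos.2 hx).ne'
      field_simp; linarith
    rw [show (-(3 / 2) : ℝ) + 1 = -(1 / 2) by norm_num, show (-(1 / 2) : ℝ) + 1 = 1 / 2 by norm_num,
      Real.zero_rpow (by norm_num), h3, h4, sub_zero]
    have h6 : x * ((√x)⁻¹ / (1 / 2)) = 2 * (x * (√x)⁻¹) := by ring
    rw [h6, h5]
    linarith

/-! ### Resolvent integrals in their time representation. -/

section Resolvent

variable {V : Type*} [NormedAddCommGroup V] [InnerProductSpace ℝ V] [FiniteDimensional ℝ V]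
  [MeasurableSpace V] [BorelSpace V]

/-- The increment `e(q + u) - e(q)` of the kinetic energy. -/
def kinInc (q u : V) : ℝ := inner ℝ q u + ‖u‖ ^ 2 / 2

theorem continuous_kinInc (q : V) : Continuous (kinInc q) := by unfold kinInc; fun_prop

theorem kinInc_sub (q p : V) : kinInc q (p - q) = ‖p‖ ^ 2 / 2 - ‖q‖ ^ 2 / 2 := by
  rw [kinInc, norm_sub_sq_real, inner_sub_right, real_inner_self_eq_norm_sq, real_inner_comm]
  ring

/-- The amplitude `∫ h(u) exp(-i s (e(q + u) - e(q))) du`. -/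
def oscInt (h : V → ℂ) (s : ℝ) (q : V) : ℂ :=
  ∫ u, h u * Complex.exp (-(Complex.I * s) * kinInc q u)

/-- The resolvent integral `∫ h(u) / (z - (e(q + u) - e(q))) du`. -/
def resInt (h : V → ℂ) (z : ℂ) (q : V) : ℂ := ∫ u, h u / (z - kinInc q u)

/-- The boundary value of `resInt` at energy zero, in its time representation. -/
def resBdry (h : V → ℂ) (q : V) : ℂ := -Complex.I * ∫ s in Set.Ioi (0 : ℝ), oscInt h s q

theorem norm_exp_neg_I_mul (s x : ℝ) : ‖Complex.exp (-(Complex.I * s) * x)‖ = 1 := by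
  have : -(Complex.I * s) * x = ((-(s * x) : ℝ) : ℂ) * Complex.I := by push_cast; ring
  rw [this, Complex.norm_exp_ofReal_mul_I]

/-- In the variable `p = q + u` the kinetic increment is `e(p) - e(q)`. The part `e(q)` is a pure
phase, and what remains is a Gaussian integral at imaginary time against a translate of `h`. -/
theorem oscInt_eq (h : V → ℂ) (s : ℝ) (q : V) :
    oscInt h s q = Complex.exp (Complex.I * (s * (‖q‖ ^ 2 / 2) : ℝ))
      * ∫ p, h (p - q) * Complex.exp (-(Complex.I * s) * ‖p‖ ^ 2 / 2) := by
  rw [oscInt, ← integral_sub_right_eq_self _ q, ← integral_const_mul]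
  congr 1; ext p
  rw [kinInc_sub, mul_left_comm, ← Complex.exp_add]
  congr 2; push_cast; ring

theorem continuous_oscInt {h : V → ℂ} (hh : Integrable h) (q : V) :
    Continuous fun s => oscInt h s q := by
  have := continuous_kinInc q
  refine continuous_of_dominated (bound := fun u => ‖h u‖) (fun s => ?_) (fun s => ae_of_all _ fun u => ?_)
    hh.norm (ae_of_all _ fun u => by fun_prop)
  · exact hh.aestronglyMeasurable.mul (Continuous.aestronglyMeasurable (by fun_prop))
  · rw [norm_mul, norm_exp_neg_I_mul, mul_one]

/-- `1/(z - x) = -i ∫ exp(i s (z - x)) ds` over the half line for `Im z > 0`, and Fubini, justified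
by the factor `exp(-s Im z)`. -/
theorem resInt_eq {h : V → ℂ} (hh : Integrable h) {z : ℂ} (hz : 0 < z.im) (q : V) :
    resInt h z q
      = -Complex.I * ∫ s in Set.Ioi (0 : ℝ), Complex.exp (Complex.I * s * z) * oscInt h s q := by
  have hre : ∀ x : ℝ, (Complex.I * (z - x)).re < 0 := fun x => by simp [hz]
  have e1 : ∀ x : ℝ, 1 / (z - x)
      = -Complex.I * ∫ s : ℝ in Set.Ioi 0, Complex.exp (Complex.I * (z - x) * s) := by
    intro x
    have hne : z - x ≠ 0 := fun h0 => by have := hre x; simp [h0] at this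
    rw [integral_exp_mul_complex_Ioi (hre x) 0]
    have := Complex.I_ne_zero
    simp; field_simp
  have hF : Integrable (fun p : V × ℝ => h p.1 * Complex.exp (Complex.I * (z - kinInc q p.1) * p.2))
      (volume.prod (volume.restrict (Set.Ioi 0))) := by
    have i1 := hh.norm.mul_prod (integrableOn_exp_mul_Ioi (a := -z.im) (by linarith) 0)
    have := (continuous_kinInc q)
    refine i1.mono' ?_ (ae_of_all _ fun p => ?_)
    · exact hh.aestronglyMeasurable.comp_fst.mul
        (by fun_prop : Continuous fun p : V × ℝ =>
          Complex.exp (Complex.I * (z - kinInc q p.1) * p.2)).aestronglyMeasurable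
    · rw [norm_mul, Complex.norm_exp]
      simp
  calc resInt h z q = ∫ u, -Complex.I * ∫ s : ℝ in Set.Ioi 0,
        h u * Complex.exp (Complex.I * (z - kinInc q u) * s) := by
        rw [resInt]; congr 1; ext u
        rw [div_eq_mul_one_div, e1, integral_const_mul]; ring
    _ = _ := by
        rw [integral_const_mul, integral_integral_swap
          (f := fun (u : V) (s : ℝ) => h u * Complex.exp (Complex.I * (z - kinInc q u) * s)) hF]
        congr 2; ext s
        rw [oscInt, ← integral_const_mul]
        congr 1; ext u
        rw [mul_left_comm, ← Complex.exp_add]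
        congr 2; ring

end Resolvent

/-- The properties of `scaledProd φ₁ φ₂ c` on which the estimates of its resolvent integrals rest. -/
structure Dispersive {V : Type*} [NormedAddCommGroup V] [InnerProductSpace ℝ V]
    [MeasurableSpace V] [BorelSpace V] [FiniteDimensional ℝ V] (h : V → ℂ) (C : ℝ) : Prop where
  nonneg : 0 ≤ C
  integrable : Integrable h
  integrable_norm_mul : Integrable fun u => ‖u‖ * ‖h u‖
  moment : ∫ u, ‖u‖ * ‖h u‖ ≤ C
  decay : ∀ (w : V) (b : ℂ), 0 ≤ b.re → b ≠ 0 →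
      ‖∫ p, h (p - w) * Complex.exp (-b * ‖p‖ ^ 2 / 2)‖ ≤ C * min 1 (‖b‖ ^ (-(3 / 2) : ℝ))
  decay_sub : ∀ (w : V) (b : ℂ), 0 ≤ b.re → 1 ≤ ‖b‖ →
      ‖∫ p, (h (p - w) - h p) * Complex.exp (-b * ‖p‖ ^ 2 / 2)‖
        ≤ C * ‖w‖ * ‖b‖ ^ (-(3 / 2) : ℝ)

/-! ### Boundary values: Hölder continuity, and comparison with zero momentum. -/

section Resolvent

variable {V : Type*} [NormedAddCommGroup V] [InnerProductSpace ℝ V] [FiniteDimensional ℝ V]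
  [MeasurableSpace V] [BorelSpace V]

theorem exists_dispersive (hd : 3 ≤ Module.finrank ℝ V) (φ₁ φ₂ : 𝓢(V, ℂ)) :
    ∃ C : ℝ, ∀ c : ℝ, |c| ≤ 1 → Dispersive (scaledProd φ₁ φ₂ c) C := by
  obtain ⟨C₁, h₁, H₁⟩ := exists_integral_bounds φ₁ φ₂
  obtain ⟨C₂, h₂, H₂⟩ := exists_decay hd φ₁ φ₂
  refine ⟨C₁ + C₂, fun c hc => ⟨by positivity, integrable_scaledProd _ _ _,
    integrable_norm_mul_scaledProd _ _ _, by linarith [(H₁ c).2.2], fun w b hb hb0 => ?_,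
    fun w b hb hb0 => ?_⟩⟩
  · refine ((H₂ c hc).1 w b hb hb0).trans (mul_le_mul_of_nonneg_right (by linarith) ?_)
    exact le_min zero_le_one (by positivity)
  · refine ((H₂ c hc).2 w b hb hb0).trans ?_
    gcongr; linarith

variable {h : V → ℂ} {C : ℝ}

theorem Dispersive.norm_oscInt_le (H : Dispersive h C) {s : ℝ} (hs : 0 < s) (q : V) :
    ‖oscInt h s q‖ ≤ C * timeDecay s := by
  rw [oscInt_eq, norm_mul, mul_comm Complex.I, Complex.norm_exp_ofReal_mul_I, one_mul]
  have := H.decay q (Complex.I * s) (by simp) (by simp [hs.ne'])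
  simpa [timeDecay, abs_of_pos hs] using this

theorem Dispersive.integrableOn_oscInt (H : Dispersive h C) (q : V) :
    IntegrableOn (fun s => oscInt h s q) (Set.Ioi 0) := by
  refine (timeDecay_bound.1.const_mul C).mono' (continuous_oscInt H.integrable q).aestronglyMeasurable ?_
  exact (ae_restrict_mem measurableSet_Ioi).mono fun s hs => H.norm_oscInt_le hs q

theorem Dispersive.norm_resBdry_le (H : Dispersive h C) (q : V) : ‖resBdry h q‖ ≤ 3 * C := by
  rw [resBdry, norm_mul, norm_neg, Complex.norm_I, one_mul]
  refine (norm_integral_le_of_norm_le (timeDecay_bound.1.const_mul C)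
    ((ae_restrict_mem measurableSet_Ioi).mono fun s hs => H.norm_oscInt_le hs q)).trans ?_
  rw [integral_const_mul]
  nlinarith [timeDecay_bound.2, H.nonneg]

theorem norm_exp_I_mul_le_one {s : ℝ} (hs : 0 ≤ s) {z : ℂ} (hz : 0 ≤ z.im) :
    ‖Complex.exp (Complex.I * s * z)‖ ≤ 1 := by
  rw [Complex.norm_exp, Real.exp_le_one_iff]; simp; positivity

/-- The resolvent integral is Hölder continuous of order one half up to the boundary. -/
theorem Dispersive.norm_resInt_sub_resBdry_le (H : Dispersive h C) {z : ℂ} (hz : 0 < z.im) (q : V) :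
    ‖resInt h z q - resBdry h q‖ ≤ 8 * C * √‖z‖ := by
  have hz0 : 0 < ‖z‖ := norm_pos_iff.2 fun h => by simp [h] at hz
  obtain ⟨D, iD, hD, bD⟩ := exists_dominating hz0
  have i1 := H.integrableOn_oscInt q
  have i2 : IntegrableOn (fun s : ℝ => Complex.exp (Complex.I * s * z) * oscInt h s q) (Set.Ioi 0) := by
    refine Integrable.bdd_mul (c := 1) i1 (Continuous.aestronglyMeasurable (by fun_prop)) ?_
    exact (ae_restrict_mem measurableSet_Ioi).mono fun s hs => norm_exp_I_mul_le_one (le_of_lt hs) hz.le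
  rw [resInt_eq H.integrable hz, resBdry, ← mul_sub, ← integral_sub i2 i1, norm_mul, norm_neg,
    Complex.norm_I, one_mul]
  refine (norm_integral_le_of_norm_le (iD.const_mul (2 * C))
    ((ae_restrict_mem measurableSet_Ioi).mono fun s (hs : 0 < s) => ?_)).trans ?_
  · have e : Complex.exp (Complex.I * s * z) * oscInt h s q - oscInt h s q
        = (Complex.exp (Complex.I * s * z) - 1) * oscInt h s q := by ring
    rw [e, norm_mul]
    -- The factor `min 1 (s|z|)` against a decay `s^{-3/2}` is what produces the exponent one half.
    have h1 : ‖Complex.exp (Complex.I * s * z) - 1‖ ≤ 2 * min 1 (s * ‖z‖) := by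
      refine (norm_exp_sub_one_le_min ?_).trans_eq ?_
      · simp; positivity
      · simp [abs_of_pos hs]
    have h2 := mul_le_mul h1 (H.norm_oscInt_le hs q) (norm_nonneg _) (by positivity)
    have h3 := mul_le_mul_of_nonneg_left (hD s hs) (by have := H.nonneg; positivity : 0 ≤ 2 * C)
    refine h2.trans (le_trans (le_of_eq ?_) h3)
    ring
  · rw [integral_const_mul]
    nlinarith [mul_le_mul_of_nonneg_left bD H.nonneg]

theorem Dispersive.tendsto_resInt (H : Dispersive h C) (q : V) :
    Tendsto (fun ε : ℝ => resInt h (Complex.I * ε) q) (𝓝[>] 0) (𝓝 (resBdry h q)) := by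
  rw [tendsto_iff_norm_sub_tendsto_zero]
  have h1 : Tendsto (fun ε : ℝ => 8 * C * √‖Complex.I * (ε : ℂ)‖) (𝓝[>] 0) (𝓝 0) := by
    have : Continuous fun ε : ℝ => 8 * C * √‖Complex.I * (ε : ℂ)‖ := by fun_prop
    have h2 := (this.tendsto 0).mono_left (nhdsWithin_le_nhds (s := Set.Ioi 0))
    simpa using h2
  refine squeeze_zero' (Eventually.of_forall fun _ => norm_nonneg _) ?_ h1
  filter_upwards [self_mem_nhdsWithin] with ε hε
  exact H.norm_resInt_sub_resBdry_le (by simpa using hε) q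

/-- For `s ≤ 1` the two phases differ by `exp(-is⟨q, u⟩)`, controlled by the first moment of `h`.
For `s ≥ 1` the translated form is used: the difference of translates decays with the gain `|q|`,
and the prefactor `exp(is|q|²/2)` differs from one by at most `2 min(1, s|q|²/2)`. -/
theorem Dispersive.norm_oscInt_sub_le (H : Dispersive h C) {s : ℝ} (hs : 0 < s) (q : V) :
    ‖oscInt h s q - oscInt h s 0‖
      ≤ 4 * C * ‖q‖ * timeDecay s + 2 * C * (min 1 (s * (‖q‖ ^ 2 / 2)) * timeDecay s) := by
  have hC := H.nonneg
  have ht := timeDecay_nonneg hs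
  rcases le_total s 1 with h1 | h1
  · have htd : timeDecay s = 1 :=
      min_eq_left (Real.one_le_rpow_of_pos_of_le_one_of_nonpos hs h1 (by norm_num))
    have ii : ∀ q, Integrable fun u => h u * Complex.exp (-(Complex.I * s) * kinInc q u) := by
      intro q
      have := continuous_kinInc q
      exact H.integrable.mul_bdd (c := 1) (by fun_prop : Continuous fun u =>
        Complex.exp (-(Complex.I * s) * kinInc q u)).aestronglyMeasurable
        (ae_of_all _ fun u => (norm_exp_neg_I_mul _ _).le)
    have h2 : ‖oscInt h s q - oscInt h s 0‖ ≤ ∫ u, (2 * ‖q‖) * (‖u‖ * ‖h u‖) := by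
      rw [oscInt, oscInt, ← integral_sub (ii q) (ii 0)]
      refine norm_integral_le_of_norm_le (H.integrable_norm_mul.const_mul _) (ae_of_all _ fun u => ?_)
      have e : h u * Complex.exp (-(Complex.I * s) * kinInc q u)
          - h u * Complex.exp (-(Complex.I * s) * kinInc 0 u)
          = h u * (Complex.exp (-(Complex.I * s) * kinInc 0 u)
            * (Complex.exp (-(Complex.I * s) * (inner ℝ q u : ℝ)) - 1)) := by
        rw [mul_sub, ← Complex.exp_add, mul_one, ← mul_sub]
        congr 3
        simp [kinInc]; ring
      rw [e, norm_mul, norm_mul, norm_exp_neg_I_mul, one_mul]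
      have h3 : ‖Complex.exp (-(Complex.I * s) * (inner ℝ q u : ℝ)) - 1‖ ≤ 2 * (‖q‖ * ‖u‖) := by
        refine (norm_exp_sub_one_le_min (by simp)).trans ?_
        have : ‖-(Complex.I * (s : ℂ)) * (inner ℝ q u : ℝ)‖ ≤ ‖q‖ * ‖u‖ := by
          rw [norm_mul, norm_neg, norm_mul, Complex.norm_I, one_mul, Complex.norm_real,
            Complex.norm_real, Real.norm_of_nonneg hs.le]
          have := norm_inner_le_norm (𝕜 := ℝ) q u
          nlinarith [norm_nonneg (inner ℝ q u : ℝ)]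
        exact mul_le_mul_of_nonneg_left ((min_le_right _ _).trans this) zero_le_two
      calc ‖h u‖ * _ ≤ ‖h u‖ * (2 * (‖q‖ * ‖u‖)) := by gcongr
        _ = _ := by ring
    rw [integral_const_mul] at h2
    have h3 : 2 * ‖q‖ * ∫ u, ‖u‖ * ‖h u‖ ≤ 2 * ‖q‖ * C := by gcongr; exact H.moment
    have h4 : 0 ≤ 2 * C * (min 1 (s * (‖q‖ ^ 2 / 2)) * timeDecay s) := by positivity
    rw [htd] at h4 ⊢
    nlinarith [mul_nonneg hC (norm_nonneg q)]
  · have htd : timeDecay s = s ^ (-(3 / 2) : ℝ) :=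
      min_eq_right (Real.rpow_le_one_of_one_le_of_nonpos h1 (by norm_num))
    have hb : ‖Complex.I * (s : ℂ)‖ = s := by simp [abs_of_pos hs]
    have d0 := H.decay q (Complex.I * s) (by simp) (by simp [hs.ne'])
    have d1 := H.decay_sub q (Complex.I * s) (by simp) (by rw [hb]; exact h1)
    rw [hb] at d0 d1
    rw [← htd] at d1
    change _ ≤ C * timeDecay s at d0
    have ii : ∀ q, Integrable fun p => h (p - q) * Complex.exp (-(Complex.I * s) * ‖p‖ ^ 2 / 2) := by
      intro q
      refine (H.integrable.comp_sub_right q).mul_bdd (c := 1) (by fun_prop : Continuous fun p : V =>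
        Complex.exp (-(Complex.I * s) * ‖p‖ ^ 2 / 2)).aestronglyMeasurable
        (ae_of_all _ fun u => norm_exp_quadratic_le_one (by simp) u)
    set X := ∫ p, h (p - q) * Complex.exp (-(Complex.I * s) * ‖p‖ ^ 2 / 2) with hX
    set Y := ∫ p, h (p - 0) * Complex.exp (-(Complex.I * s) * ‖p‖ ^ 2 / 2) with hY
    have hXY : ‖X - Y‖ ≤ C * ‖q‖ * timeDecay s := by
      rw [hX, hY, ← integral_sub (ii q) (ii 0)]
      simpa only [sub_mul, sub_zero] using d1
    have e : oscInt h s q - oscInt h s 0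
        = (Complex.exp (Complex.I * (s * (‖q‖ ^ 2 / 2) : ℝ)) - 1) * X + (X - Y) := by
      have e0 : Complex.exp (Complex.I * (s * (‖(0 : V)‖ ^ 2 / 2) : ℝ)) = 1 := by simp
      rw [oscInt_eq h s q, oscInt_eq h s 0, ← hX, ← hY, e0]
      ring
    rw [e]
    refine (norm_add_le _ _).trans ?_
    rw [norm_mul]
    have h5 : ‖Complex.exp (Complex.I * (s * (‖q‖ ^ 2 / 2) : ℝ)) - 1‖
        ≤ 2 * min 1 (s * (‖q‖ ^ 2 / 2)) := by
      refine (norm_exp_sub_one_le_min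
        (by rw [mul_comm, Complex.re_ofReal_mul]; simp)).trans_eq ?_
      rw [norm_mul, Complex.norm_I, one_mul, Complex.norm_real, Real.norm_of_nonneg (by positivity)]
    have h6 := mul_le_mul h5 d0 (norm_nonneg _) (by positivity)
    have : 0 ≤ C * ‖q‖ * timeDecay s := by positivity
    nlinarith

/-- Time integration of the preceding bound; the term with the minimum yields `√(|q|²/2) ≤ |q|`, so
a Hölder exponent one half in energy is a Lipschitz bound in momentum near zero. The constant is
`4·3 + 2·4`. Uniformity in `ε` is what later survives the limit to the boundary. -/
theorem Dispersive.norm_resInt_sub_zero_le (H : Dispersive h C) {ε : ℝ} (hε : 0 < ε) (q : V) :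
    ‖resInt h (Complex.I * ε) q - resInt h (Complex.I * ε) 0‖ ≤ 20 * C * ‖q‖ := by
  have hC := H.nonneg
  rcases eq_or_ne q 0 with rfl | hq
  · simp
  have hq0 : 0 < ‖q‖ := norm_pos_iff.2 hq
  have hx : 0 < ‖q‖ ^ 2 / 2 := by positivity
  obtain ⟨D, iD, hD, bD⟩ := exists_dominating hx
  have hz : 0 < (Complex.I * (ε : ℂ)).im := by simpa using hε
  have i2 : ∀ q, IntegrableOn (fun s : ℝ => Complex.exp (Complex.I * s * (Complex.I * ε))
      * oscInt h s q) (Set.Ioi 0) := by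
    intro q
    refine Integrable.bdd_mul (c := 1) (H.integrableOn_oscInt q)
      (Continuous.aestronglyMeasurable (by fun_prop)) ?_
    exact (ae_restrict_mem measurableSet_Ioi).mono fun s hs => norm_exp_I_mul_le_one (le_of_lt hs) hz.le
  rw [resInt_eq H.integrable hz, resInt_eq H.integrable hz, ← mul_sub, ← integral_sub (i2 q) (i2 0),
    norm_mul, norm_neg, Complex.norm_I, one_mul]
  refine (norm_integral_le_of_norm_le ((timeDecay_bound.1.const_mul (4 * C * ‖q‖)).add
    (iD.const_mul (2 * C)))
    ((ae_restrict_mem measurableSet_Ioi).mono fun s (hs : 0 < s) => ?_)).trans ?_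
  · rw [← mul_sub, norm_mul]
    refine (mul_le_of_le_one_left (norm_nonneg _) (norm_exp_I_mul_le_one hs.le hz.le)).trans ?_
    refine (H.norm_oscInt_sub_le hs q).trans ?_
    simp only [Pi.add_apply]
    gcongr
    exact hD s hs
  · simp only [Pi.add_apply]
    rw [integral_add (timeDecay_bound.1.const_mul _) (iD.const_mul _), integral_const_mul, integral_const_mul]
    have h1 : √(‖q‖ ^ 2 / 2) ≤ ‖q‖ := by
      rw [Real.sqrt_le_left hq0.le]; nlinarith
    have h2 := mul_le_mul_of_nonneg_left timeDecay_bound.2 (by positivity : 0 ≤ 4 * C * ‖q‖)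
    have h3 := mul_le_mul_of_nonneg_left (bD.trans (mul_le_mul_of_nonneg_left h1 (by norm_num)))
      (by positivity : 0 ≤ 2 * C)
    linarith

end Resolvent

end Feynman

namespace Feynman

/-! ### Lipschitz continuity of the boundary value in the length of the momentum. -/

section Lipschitz

variable {V : Type*} [NormedAddCommGroup V] [InnerProductSpace ℝ V] [FiniteDimensional ℝ V]
  [MeasurableSpace V] [BorelSpace V]

/-- In the variable `u = t v` the Jacobian `t^dim` meets the factor `t²` of the kinetic energy. All
dependence on `t` then sits in the smooth numerator, so that a radial derivative never falls on the
singular denominator. -/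
theorem resInt_dilate (hd : 2 ≤ Module.finrank ℝ V) (h : V → ℂ) (z : ℂ) (q : V) {t : ℝ} (ht : 0 < t) :
    resInt h (t ^ 2 * z) (t • q)
      = ∫ v, (t : ℂ) ^ (Module.finrank ℝ V - 2) * h (t • v) / (z - kinInc q v) := by
  have e := Measure.integral_comp_smul (volume : Measure V)
    (fun u => h u / (t ^ 2 * z - kinInc (t • q) u)) t
  have ht' : (t : ℂ) ≠ 0 := by exact_mod_cast ht.ne'
  have e1 : resInt h (t ^ 2 * z) (t • q) = (t : ℂ) ^ Module.finrank ℝ V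
      * ∫ v, h (t • v) / (t ^ 2 * z - kinInc (t • q) (t • v)) := by
    rw [e, abs_of_pos (by positivity), Complex.real_smul, ← mul_assoc]
    push_cast
    rw [mul_inv_cancel₀ (pow_ne_zero _ ht'), one_mul, resInt]
  rw [e1, ← integral_const_mul]
  congr 1; ext v
  have e2 : (t : ℂ) ^ 2 * z - kinInc (t • q) (t • v) = t ^ 2 * (z - kinInc q v) := by
    simp only [kinInc, inner_smul_left, inner_smul_right, norm_smul, Real.norm_of_nonneg ht.le]
    push_cast; simp; ring
  obtain ⟨n, hn⟩ := Nat.exists_eq_add_of_le hd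
  rw [e2, hn, Nat.add_sub_cancel_left, pow_add, div_mul_eq_div_div, ← mul_div_assoc, ← mul_div_assoc]
  congr 1
  field_simp

/-- The radial derivative `v ↦ (v · ∇ φ)(v)` of a Schwartz function. -/
def dilDeriv (φ : 𝓢(V, ℂ)) : 𝓢(V, ℂ) :=
  SchwartzMap.bilinLeftCLM (𝕜 := ℝ) (ContinuousLinearMap.id ℝ (V →L[ℝ] ℂ))
    (g := (fun v : V => v)) (ContinuousLinearMap.hasTemperateGrowth (ContinuousLinearMap.id ℝ V))
    (SchwartzMap.fderivCLM ℝ V ℂ φ)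

theorem dilDeriv_apply (φ : 𝓢(V, ℂ)) (v : V) : dilDeriv φ v = fderiv ℝ φ v v := rfl

theorem hasDerivAt_dilate (φ : 𝓢(V, ℂ)) (v : V) {t : ℝ} (ht : t ≠ 0) :
    HasDerivAt (fun s : ℝ => φ (s • v)) ((t : ℂ)⁻¹ * dilDeriv φ (t • v)) t := by
  have h1 : HasDerivAt (fun s : ℝ => s • v) v t := by
    simpa using (hasDerivAt_id t).smul_const v
  have h2 := (φ.differentiableAt (x := t • v)).hasFDerivAt.comp_hasDerivAt t h1
  refine h2.congr_deriv ?_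
  rw [dilDeriv_apply, map_smul, Complex.real_smul, ← mul_assoc,
    inv_mul_cancel₀ (by exact_mod_cast ht), one_mul]

theorem hasDerivAt_scaledProd_dilate (φ₁ φ₂ : 𝓢(V, ℂ)) (c : ℝ) (v : V) {t : ℝ} (ht : t ≠ 0) :
    HasDerivAt (fun s : ℝ => scaledProd φ₁ φ₂ c (s • v))
      ((t : ℂ)⁻¹ * (scaledProd (dilDeriv φ₁) φ₂ c (t • v) + scaledProd φ₁ (dilDeriv φ₂) c (t • v))) t := by
  have h1 := hasDerivAt_dilate φ₁ (c • v) ht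
  have h2 := hasDerivAt_dilate φ₂ v ht
  simp only [scaledProd, smul_comm c]
  exact (h1.fun_mul h2).congr_deriv (by ring)

/-- A majorant common to all scales `c` and all dilations `t ≥ 1/2`, for differentiation under the
integral; the decay comes from `φ₂` alone. -/
theorem exists_integrable_bound (φ₁ φ₂ : 𝓢(V, ℂ)) : ∃ b : V → ℝ, Integrable b ∧
    ∀ (c t : ℝ) (v : V), 1 / 2 ≤ t → ‖scaledProd φ₁ φ₂ c (t • v)‖ ≤ b v := by
  obtain ⟨A, hA, h1⟩ := exists_norm_le φ₁
  set n := Module.finrank ℝ V + 1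
  set S := 2 ^ n * ((Finset.Iic (n, 0)).sup fun m => SchwartzMap.seminorm ℝ m.1 m.2) φ₂ with hS
  have hS0 : 0 ≤ S := by positivity
  have h2 : ∀ u, (1 + ‖u‖) ^ n * ‖φ₂ u‖ ≤ S := fun u => by
    simpa using SchwartzMap.one_add_le_sup_seminorm_apply (𝕜 := ℝ) (m := (n, 0)) le_rfl le_rfl φ₂ u
  have i : Integrable fun v : V => (1 + ‖v‖) ^ (-(n : ℝ)) :=
    integrable_one_add_norm (by simp [n])
  refine ⟨fun v => A * S * 2 ^ n * (1 + ‖v‖) ^ (-(n : ℝ)), i.const_mul _, fun c t v ht => ?_⟩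
  simp only []
  rw [scaledProd, norm_mul, Real.rpow_neg (by positivity), Real.rpow_natCast, ← div_eq_mul_inv,
    le_div_iff₀ (by positivity)]
  have h3 : 1 + ‖v‖ ≤ 2 * (1 + ‖t • v‖) := by
    rw [norm_smul, Real.norm_of_nonneg (by linarith)]
    nlinarith [norm_nonneg v]
  have h4 : (1 + ‖v‖) ^ n ≤ 2 ^ n * (1 + ‖t • v‖) ^ n := by
    rw [← mul_pow]; exact pow_le_pow_left₀ (by positivity) h3 n
  calc ‖φ₁ (c • t • v)‖ * ‖φ₂ (t • v)‖ * (1 + ‖v‖) ^ n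
      ≤ A * ‖φ₂ (t • v)‖ * (2 ^ n * (1 + ‖t • v‖) ^ n) := by gcongr; exact h1 _
    _ = A * ((1 + ‖t • v‖) ^ n * ‖φ₂ (t • v)‖) * 2 ^ n := by ring
    _ ≤ A * S * 2 ^ n := by gcongr; exact h2 _

theorem norm_resolvent_le {ε : ℝ} (hε : 0 < ε) (x : ℝ) : ‖(Complex.I * ε - x : ℂ)⁻¹‖ ≤ ε⁻¹ := by
  rw [norm_inv]
  refine inv_anti₀ hε ?_
  have := Complex.abs_im_le_norm (Complex.I * ε - x : ℂ)
  simpa [abs_of_pos hε] using this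

/-- Differentiating the numerator gives three terms of the same kind, namely resolvent integrals at
the dilated momentum, with one of the Schwartz functions possibly replaced by its radial derivative.
At fixed `ε` the resolvent is bounded by `1/ε`, so domination is no problem. -/
theorem hasDerivAt_resInt_dilate (hd : 3 ≤ Module.finrank ℝ V) (φ₁ φ₂ : 𝓢(V, ℂ)) (c : ℝ) {ε : ℝ}
    (hε : 0 < ε) (q : V) {t : ℝ} (ht : 1 ≤ t) :
    HasDerivAt (fun s : ℝ => ∫ v, (s : ℂ) ^ (Module.finrank ℝ V - 2)
        * scaledProd φ₁ φ₂ c (s • v) / (Complex.I * ε - kinInc q v))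
      ((t : ℂ)⁻¹ * (((Module.finrank ℝ V - 2 : ℕ) : ℂ)
          * resInt (scaledProd φ₁ φ₂ c) (t ^ 2 * (Complex.I * ε)) (t • q)
        + resInt (scaledProd (dilDeriv φ₁) φ₂ c) (t ^ 2 * (Complex.I * ε)) (t • q)
        + resInt (scaledProd φ₁ (dilDeriv φ₂) c) (t ^ 2 * (Complex.I * ε)) (t • q))) t := by
  have ht0 : 0 < t := by linarith
  -- Dimension at least three makes the power of `t` positive, so its derivative has a natural
  -- exponent.
  obtain ⟨n, hn⟩ : ∃ n, Module.finrank ℝ V - 2 = n + 1 := ⟨Module.finrank ℝ V - 3, by omega⟩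
  have cK := continuous_kinInc q
  have nz : ∀ v, (Complex.I * ε - kinInc q v : ℂ) ≠ 0 := fun v h => by
    have := congrArg Complex.im h; simp [hε.ne'] at this
  obtain ⟨b₀, ib₀, hb₀⟩ := exists_integrable_bound φ₁ φ₂
  obtain ⟨b₁, ib₁, hb₁⟩ := exists_integrable_bound (dilDeriv φ₁) φ₂
  obtain ⟨b₂, ib₂, hb₂⟩ := exists_integrable_bound φ₁ (dilDeriv φ₂)
  have c₀ := continuous_scaledProd φ₁ φ₂ c
  have c₁ := continuous_scaledProd (dilDeriv φ₁) φ₂ c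
  have c₂ := continuous_scaledProd φ₁ (dilDeriv φ₂) c
  have kb : ∀ {h : V → ℂ} {b : V → ℝ}, Continuous h → Integrable b →
      (∀ (s : ℝ) v, 1 / 2 ≤ s → ‖h (s • v)‖ ≤ b v) → ∀ s : ℝ, 1 / 2 ≤ s →
      Integrable fun v => (s : ℂ) ^ (n + 1) * h (s • v) / (Complex.I * ε - kinInc q v) := by
    intro h b ch ib hb s hs
    have hcont : Continuous fun v => (s : ℂ) ^ (n + 1) * h (s • v) / (Complex.I * ε - kinInc q v) :=
      Continuous.div (by fun_prop) (by fun_prop) nz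
    refine (ib.const_mul (s ^ (n + 1) * ε⁻¹)).mono' hcont.aestronglyMeasurable (ae_of_all _ fun v => ?_)
    rw [div_eq_mul_inv, norm_mul, norm_mul, norm_pow, Complex.norm_real, Real.norm_of_nonneg (by linarith)]
    calc s ^ (n + 1) * ‖h (s • v)‖ * _ ≤ s ^ (n + 1) * b v * ε⁻¹ := by
          gcongr
          · have := (norm_nonneg _).trans (hb s v hs); positivity
          · exact hb s v hs
          · exact norm_resolvent_le hε _
      _ = _ := by ring
  let F' : ℝ → V → ℂ := fun s v => (((n + 1 : ℕ) : ℂ) * (s : ℂ) ^ n * scaledProd φ₁ φ₂ c (s • v)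
    + (s : ℂ) ^ n * (scaledProd (dilDeriv φ₁) φ₂ c (s • v) + scaledProd φ₁ (dilDeriv φ₂) c (s • v)))
      / (Complex.I * ε - kinInc q v)
  have hF' : Continuous (F' t) :=
    Continuous.div (by fun_prop) (by fun_prop) nz
  have D := (hasDerivAt_integral_of_dominated_loc_of_deriv_le (μ := (volume : Measure V))
    (F := fun (s : ℝ) v => (s : ℂ) ^ (n + 1)
        * scaledProd φ₁ φ₂ c (s • v) / (Complex.I * ε - kinInc q v)) (F' := F') (x₀ := t)
    (bound := fun v => ((n + 1 : ℕ) * (t + 1) ^ n * b₀ v + (t + 1) ^ n * (b₁ v + b₂ v)) * ε⁻¹)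
    -- As `t ≥ 1`, this ball stays in `s ≥ 1/2`, where the majorants hold.
    (s := Metric.ball t (1 / 2)) (Metric.ball_mem_nhds t (by norm_num)) ?_ ?_ ?_ ?_ ?_ ?_).2
  · rw [hn]
    have hd2 : 2 ≤ Module.finrank ℝ V := by omega
    refine D.congr_deriv (Eq.symm ?_)
    rw [resInt_dilate hd2 _ _ _ ht0, resInt_dilate hd2 _ _ _ ht0, resInt_dilate hd2 _ _ _ ht0, hn]
    have i₀ := kb c₀ ib₀ (hb₀ c) t (by linarith)
    have i₁ := kb c₁ ib₁ (hb₁ c) t (by linarith)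
    have i₂ := kb c₂ ib₂ (hb₂ c) t (by linarith)
    have e := integral_add ((i₀.const_mul ((n + 1 : ℕ) : ℂ)).add i₁) i₂
    have e' := integral_add (i₀.const_mul ((n + 1 : ℕ) : ℂ)) i₁
    rw [integral_const_mul] at e'
    simp only [Pi.add_apply] at e
    rw [e'] at e
    refine (congrArg _ e.symm).trans ?_
    rw [← integral_const_mul]
    congr 1; ext v
    have : (t : ℂ) ≠ 0 := by exact_mod_cast ht0.ne'
    have := nz v
    simp only [F', pow_succ]
    field_simp
    ring
  · refine Eventually.of_forall fun s => Continuous.aestronglyMeasurable ?_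
    exact Continuous.div (by fun_prop) (by fun_prop) nz
  · exact kb c₀ ib₀ (hb₀ c) t (by linarith)
  · exact hF'.aestronglyMeasurable
  · refine ae_of_all _ fun v s hs => ?_
    rw [Metric.mem_ball, Real.dist_eq, abs_lt] at hs
    have hs1 : 1 / 2 ≤ s := by linarith
    have hs2 : s ≤ t + 1 := by linarith
    have p0 := (norm_nonneg _).trans (hb₀ c s v hs1)
    have p1 := (norm_nonneg _).trans (hb₁ c s v hs1)
    have p2 := (norm_nonneg _).trans (hb₂ c s v hs1)
    simp only [F']
    rw [div_eq_mul_inv, norm_mul]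
    have hs3 : ‖(s : ℂ)‖ ≤ t + 1 := by rw [Complex.norm_real, Real.norm_of_nonneg (by linarith)]; exact hs2
    gcongr ?_ * ?_
    · refine (norm_add_le _ _).trans (add_le_add ?_ ?_)
      · rw [norm_mul, norm_mul, norm_pow, Complex.norm_natCast]
        gcongr
        exact hb₀ c s v hs1
      · rw [norm_mul, norm_pow]
        gcongr
        exact (norm_add_le _ _).trans (add_le_add (hb₁ c s v hs1) (hb₂ c s v hs1))
    · exact norm_resolvent_le hε _
  · exact (((ib₀.const_mul _).add ((ib₁.add ib₂).const_mul _)).mul_const _)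
  · refine ae_of_all _ fun v s hs => ?_
    rw [Metric.mem_ball, Real.dist_eq, abs_lt] at hs
    have hs0 : s ≠ 0 := by linarith
    have hp : HasDerivAt (fun s : ℝ => (s : ℂ) ^ (n + 1)) (((n + 1 : ℕ) : ℂ) * (s : ℂ) ^ n) s := by
      have := (hasDerivAt_pow (n + 1) (s : ℂ)).comp_ofReal
      simpa using this
    have := (hp.fun_mul (hasDerivAt_scaledProd_dilate φ₁ φ₂ c v hs0)).div_const
      (Complex.I * ε - kinInc q v)
    refine this.congr_deriv ?_
    have : (s : ℂ) ≠ 0 := by exact_mod_cast hs0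
    simp only [F', pow_succ]
    field_simp

/-- The value at momentum zero is subtracted before differentiating. Then `norm_resInt_sub_zero_le`
bounds each term of the derivative by a multiple of `s|q|`, the prefactor `1/s` removes `s`, and the
mean value inequality applies uniformly in `ε`. In the limit the subtracted values cancel, since
both converge to the boundary value at zero. -/
theorem exists_dilate_lipschitz (hd : 3 ≤ Module.finrank ℝ V) (φ₁ φ₂ : 𝓢(V, ℂ)) :
    ∃ L : ℝ, 0 ≤ L ∧ ∀ c : ℝ, |c| ≤ 1 → ∀ (q : V) (t : ℝ), 1 ≤ t →
      ‖resBdry (scaledProd φ₁ φ₂ c) (t • q) - resBdry (scaledProd φ₁ φ₂ c) q‖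
        ≤ L * ‖q‖ * (t - 1) := by
  obtain ⟨C₀, H₀⟩ := exists_dispersive hd φ₁ φ₂
  obtain ⟨C₁, H₁⟩ := exists_dispersive hd (dilDeriv φ₁) φ₂
  obtain ⟨C₂, H₂⟩ := exists_dispersive hd φ₁ (dilDeriv φ₂)
  have p₀ := (H₀ 0 (by simp)).nonneg
  have p₁ := (H₁ 0 (by simp)).nonneg
  have p₂ := (H₂ 0 (by simp)).nonneg
  set N : ℕ := Module.finrank ℝ V - 2 with hN
  set L : ℝ := N * (20 * C₀) + 20 * C₁ + 20 * C₂ with hL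
  refine ⟨L, by positivity, fun c hc q t ht => ?_⟩
  set f := scaledProd φ₁ φ₂ c with hf
  have ht0 : 0 < t := by linarith
  have key : ∀ ε : ℝ, 0 < ε →
      ‖(resInt f (Complex.I * ((t ^ 2 * ε : ℝ) : ℂ)) (t • q) - resInt f (Complex.I * ((t ^ 2 * ε : ℝ) : ℂ)) 0)
        - (resInt f (Complex.I * ε) q - resInt f (Complex.I * ε) 0)‖ ≤ L * ‖q‖ * (t - 1) := by
    intro ε hε
    let Ψ : V → ℝ → ℂ := fun q s => ∫ v, (s : ℂ) ^ N * f (s • v) / (Complex.I * ε - kinInc q v)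
    have hΨ : ∀ q s, 0 < s → Ψ q s = resInt f (Complex.I * ((s ^ 2 * ε : ℝ) : ℂ)) (s • q) := by
      intro q s hs
      have := resInt_dilate (by omega) f (Complex.I * ε) q hs
      rw [← hN] at this
      rw [show Ψ q s = _ from this.symm]
      congr 1; push_cast; ring
    let D : V → ℝ → ℂ := fun q t => (t : ℂ)⁻¹ * ((N : ℂ)
          * resInt (scaledProd φ₁ φ₂ c) (t ^ 2 * (Complex.I * ε)) (t • q)
        + resInt (scaledProd (dilDeriv φ₁) φ₂ c) (t ^ 2 * (Complex.I * ε)) (t • q)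
        + resInt (scaledProd φ₁ (dilDeriv φ₂) c) (t ^ 2 * (Complex.I * ε)) (t • q))
    have hD : ∀ q s, 1 ≤ s → HasDerivAt (Ψ q) (D q s) s := fun q s hs =>
      hasDerivAt_resInt_dilate hd φ₁ φ₂ c hε q hs
    have hb : ∀ s ∈ Set.Icc 1 t, ‖D q s - D 0 s‖ ≤ L * ‖q‖ := by
      intro s hs
      have hs0 : 0 < s := by linarith [hs.1]
      have hε' : 0 < s ^ 2 * ε := by positivity
      have ez : (s : ℂ) ^ 2 * (Complex.I * ε) = Complex.I * ((s ^ 2 * ε : ℝ) : ℂ) := by push_cast; ring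
      have b₀ := (H₀ c hc).norm_resInt_sub_zero_le hε' (s • q)
      have b₁ := (H₁ c hc).norm_resInt_sub_zero_le hε' (s • q)
      have b₂ := (H₂ c hc).norm_resInt_sub_zero_le hε' (s • q)
      have es : ‖s • q‖ = s * ‖q‖ := by rw [norm_smul, Real.norm_of_nonneg hs0.le]
      rw [es] at b₀ b₁ b₂
      simp only [D, ez, smul_zero]
      rw [← mul_sub, norm_mul, norm_inv, Complex.norm_real, Real.norm_of_nonneg hs0.le, inv_mul_le_iff₀ hs0]
      set X₀ := resInt (scaledProd φ₁ φ₂ c) (Complex.I * ((s ^ 2 * ε : ℝ) : ℂ))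
      set X₁ := resInt (scaledProd (dilDeriv φ₁) φ₂ c) (Complex.I * ((s ^ 2 * ε : ℝ) : ℂ))
      set X₂ := resInt (scaledProd φ₁ (dilDeriv φ₂) c) (Complex.I * ((s ^ 2 * ε : ℝ) : ℂ))
      have e : (N : ℂ) * X₀ (s • q) + X₁ (s • q) + X₂ (s • q) - ((N : ℂ) * X₀ 0 + X₁ 0 + X₂ 0)
          = (N : ℂ) * (X₀ (s • q) - X₀ 0) + (X₁ (s • q) - X₁ 0) + (X₂ (s • q) - X₂ 0) := by ring
      rw [e]
      refine (norm_add₃_le).trans ?_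
      rw [norm_mul, Complex.norm_natCast]
      have := mul_le_mul_of_nonneg_left b₀ (Nat.cast_nonneg (α := ℝ) N)
      rw [hL]; nlinarith
    have := (convex_Icc 1 t).norm_image_sub_le_of_norm_hasDerivWithin_le
      (f := fun s => Ψ q s - Ψ 0 s) (f' := fun s => D q s - D 0 s) (C := L * ‖q‖)
      (fun s hs => ((hD q s hs.1).sub (hD 0 s hs.1)).hasDerivWithinAt) hb
      (Set.left_mem_Icc.2 ht) (Set.right_mem_Icc.2 ht)
    rw [hΨ q t ht0, hΨ 0 t ht0, hΨ q 1 one_pos, hΨ 0 1 one_pos, Real.norm_of_nonneg (by linarith)] at this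
    simpa using this
  have T1 : ∀ q, Tendsto (fun ε : ℝ => resInt f (Complex.I * ε) q) (𝓝[>] 0) (𝓝 (resBdry f q)) :=
    (H₀ c hc).tendsto_resInt
  -- Dilation turns the regularization `ε` into `t² ε`, which also tends to zero from above.
  have hmul : Tendsto (fun ε : ℝ => t ^ 2 * ε) (𝓝[>] 0) (𝓝[>] 0) := by
    refine tendsto_nhdsWithin_of_tendsto_nhds_of_eventually_within _ ?_ ?_
    · have : Continuous fun ε : ℝ => t ^ 2 * ε := by fun_prop
      simpa using (this.tendsto 0).mono_left (nhdsWithin_le_nhds (s := Set.Ioi 0))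
    · filter_upwards [self_mem_nhdsWithin] with ε (hε : 0 < ε)
      show 0 < t ^ 2 * ε
      positivity
  have T2 := (((T1 (t • q)).comp hmul).sub ((T1 0).comp hmul)).sub ((T1 q).sub (T1 0))
  have := le_of_tendsto T2.norm (by
    filter_upwards [self_mem_nhdsWithin] with ε (hε : 0 < ε)
    exact key ε hε)
  simpa using this

/-- The reflection in the hyperplane orthogonal to `q - w`. -/
theorem exists_isometry_map {q w : V} (h : ‖q‖ = ‖w‖) : ∃ A : V ≃ₗᵢ[ℝ] V, A q = w :=
  ⟨_, Submodule.reflection_sub h⟩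

theorem resBdry_radial {h : V → ℂ} (hh : ∀ u v, ‖u‖ = ‖v‖ → h u = h v) {q w : V} (hqw : ‖q‖ = ‖w‖) :
    resBdry h q = resBdry h w := by
  obtain ⟨A, rfl⟩ := exists_isometry_map hqw
  have : ∀ s, oscInt h s q = oscInt h s (A q) := by
    intro s
    have e0 := A.measurePreserving.integral_comp A.toHomeomorph.measurableEmbedding
      (fun u => h u * Complex.exp (-(Complex.I * s) * kinInc (A q) u))
    rw [oscInt, oscInt, ← e0]
    congr 1; ext u
    have e : kinInc (A q) (A u) = kinInc q u := by
      rw [kinInc, kinInc, A.inner_map_map, A.norm_map]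
    rw [e, hh (A u) u (A.norm_map u)]
  simp only [resBdry, this]

/-- For radial data, the boundary value is Lipschitz continuous in the length of the momentum. -/
theorem exists_lipschitz (hd : 3 ≤ Module.finrank ℝ V) (φ₁ φ₂ : 𝓢(V, ℂ)) :
    ∃ L : ℝ, 0 ≤ L ∧ ∀ c : ℝ, |c| ≤ 1 →
      (∀ u v, ‖u‖ = ‖v‖ → scaledProd φ₁ φ₂ c u = scaledProd φ₁ φ₂ c v) → ∀ q w : V,
      ‖resBdry (scaledProd φ₁ φ₂ c) q - resBdry (scaledProd φ₁ φ₂ c) w‖ ≤ L * |‖q‖ - ‖w‖| := by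
  obtain ⟨C, H⟩ := exists_dispersive hd φ₁ φ₂
  obtain ⟨L, hL, hLip⟩ := exists_dilate_lipschitz hd φ₁ φ₂
  have hC := (H 0 (by simp)).nonneg
  refine ⟨L + 20 * C, by positivity, fun c hc hrad => ?_⟩
  set f := scaledProd φ₁ φ₂ c
  have key : ∀ q w : V, ‖q‖ ≤ ‖w‖ → ‖resBdry f w - resBdry f q‖ ≤ (L + 20 * C) * (‖w‖ - ‖q‖) := by
    intro q w hqw
    rcases eq_or_ne q 0 with rfl | hq
    -- Zero cannot be dilated to `w`; this case is the comparison with zero momentum, passed to the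
    -- boundary.
    · have T := (((H c hc).tendsto_resInt w).sub ((H c hc).tendsto_resInt 0)).norm
      have := le_of_tendsto T (by
        filter_upwards [self_mem_nhdsWithin] with ε (hε : 0 < ε)
        exact (H c hc).norm_resInt_sub_zero_le hε w)
      rw [norm_zero, sub_zero]
      nlinarith [mul_nonneg hL (norm_nonneg w)]
    · have hq0 : 0 < ‖q‖ := norm_pos_iff.2 hq
      have ht : 1 ≤ ‖w‖ / ‖q‖ := (one_le_div hq0).2 hqw
      -- By radial symmetry `w` may be replaced by the point of the ray through `q` that has the
      -- same length.
      have e : ‖(‖w‖ / ‖q‖) • q‖ = ‖w‖ := by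
        rw [norm_smul, Real.norm_of_nonneg (by positivity)]; field_simp
      have := hLip c hc q _ ht
      rw [resBdry_radial hrad e] at this
      have e2 : L * ‖q‖ * (‖w‖ / ‖q‖ - 1) = L * (‖w‖ - ‖q‖) := by field_simp
      rw [e2] at this
      nlinarith
  intro q w
  rcases le_total ‖q‖ ‖w‖ with h | h
  · rw [norm_sub_rev, abs_sub_comm, abs_of_nonneg (by linarith)]; exact key q w h
  · rw [abs_of_nonneg (by linarith)]; exact key w q h

end Lipschitz

end Feynman

/-! ### The density of states with the weight `1 / |p|`. -/

namespace Feynman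

/-- The exponent is lowered from `3/2` to `4/3` on purpose: after integration against `τ^{-1/2}` the
former would leave `s^{-1}`, not integrable at zero, while the latter leaves `s^{-5/6}`. This is the
origin of the loss `η^{-1/6}`. -/
theorem min_one_rpow_le {x b : ℝ} (hx : 0 < x) (hb : x ≤ b) :
    min 1 (b ^ (-(3 / 2) : ℝ)) ≤ x ^ (-(4 / 3) : ℝ) := by
  rcases le_total 1 b with h | h
  · refine (min_le_right _ _).trans ((Real.rpow_le_rpow_of_exponent_le h
      (by norm_num : (-(3 / 2) : ℝ) ≤ -(4 / 3))).trans ?_)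
    exact Real.rpow_le_rpow_of_nonpos hx hb (by norm_num)
  · exact (min_le_left _ _).trans
      (Real.one_le_rpow_of_pos_of_le_one_of_nonpos hx (hb.trans h) (by norm_num))

/-- The function that dominates the superposition of Gaussians with oscillation `s`. -/
def superDom (s τ : ℝ) : ℝ := τ ^ (-(1 / 2) : ℝ) * max τ s ^ (-(4 / 3) : ℝ)

/-- Splitting at `τ = s` gives `2 s^{-5/6}` and `(6/5) s^{-5/6}`. -/
theorem superDom_bound {s : ℝ} (hs : 0 < s) : IntegrableOn (superDom s) (Set.Ioi 0) ∧
    ∫ τ in Set.Ioi 0, superDom s τ ≤ 4 * s ^ (-(5 / 6) : ℝ) := by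
  have hu : Set.Ioi (0 : ℝ) = Set.Ioc 0 s ∪ Set.Ioi s := by
    rw [Set.Ioc_union_Ioi_eq_Ioi hs.le]
  have i1 : IntegrableOn (fun τ : ℝ => τ ^ (-(1 / 2) : ℝ) * s ^ (-(4 / 3) : ℝ)) (Set.Ioc 0 s) := by
    have := (intervalIntegral.intervalIntegrable_rpow' (a := 0) (b := s) (r := -(1 / 2)) (by norm_num))
    exact ((intervalIntegrable_iff_integrableOn_Ioc_of_le hs.le).1 this).mul_const _
  have i2 : IntegrableOn (fun τ : ℝ => τ ^ (-(11 / 6) : ℝ)) (Set.Ioi s) :=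
    integrableOn_Ioi_rpow_of_lt (by norm_num) hs
  have e1 : Set.EqOn (superDom s) (fun τ : ℝ => τ ^ (-(1 / 2) : ℝ) * s ^ (-(4 / 3) : ℝ)) (Set.Ioc 0 s) :=
    fun τ hτ => by simp only [superDom, max_eq_right hτ.2]
  have e2 : Set.EqOn (superDom s) (fun τ : ℝ => τ ^ (-(11 / 6) : ℝ)) (Set.Ioi s) := fun τ hτ => by
    have h : s < τ := hτ
    simp only [superDom, max_eq_left h.le]
    rw [← Real.rpow_add (hs.trans h)]; norm_num
  have h1 := i1.congr_fun e1.symm measurableSet_Ioc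
  have h2 := i2.congr_fun e2.symm measurableSet_Ioi
  refine ⟨hu ▸ h1.union h2, ?_⟩
  rw [hu, setIntegral_union (Set.Ioc_disjoint_Ioi le_rfl) measurableSet_Ioi h1 h2,
    setIntegral_congr_fun measurableSet_Ioc e1, setIntegral_congr_fun measurableSet_Ioi e2,
    integral_Ioi_rpow_of_lt (by norm_num) hs, integral_mul_const,
    ← intervalIntegral.integral_of_le hs.le, integral_rpow (Or.inl (by norm_num)),
    show (-(11 / 6) : ℝ) + 1 = -(5 / 6) by norm_num, show (-(1 / 2) : ℝ) + 1 = 1 / 2 by norm_num,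
    Real.zero_rpow (by norm_num), sub_zero]
  have h3 : s ^ (1 / 2 : ℝ) * s ^ (-(4 / 3) : ℝ) = s ^ (-(5 / 6) : ℝ) := by
    rw [← Real.rpow_add hs]; norm_num
  have h4 : s ^ (1 / 2 : ℝ) / (1 / 2) * s ^ (-(4 / 3) : ℝ)
      = 2 * (s ^ (1 / 2 : ℝ) * s ^ (-(4 / 3) : ℝ)) := by ring
  rw [h4, h3]
  have : 0 ≤ s ^ (-(5 / 6) : ℝ) := by positivity
  linarith

/-- Represents the weight `1/|p|` by Gaussians, to which the dispersive decay applies. At `x = 0`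
the integral diverges, and both sides are zero by the default values. -/
theorem integral_superposition (x : ℝ) (hx : 0 ≤ x) :
    ∫ τ in Set.Ioi (0 : ℝ), τ ^ (-(1 / 2) : ℝ) * Real.exp (-(x ^ 2 / 2 * τ)) = √(2 * Real.pi) * x⁻¹ := by
  rcases hx.eq_or_lt with rfl | hx
  · simpa using setIntegral_Ioi_zero_rpow (-(1 / 2))
  · have := Real.integral_rpow_mul_exp_neg_mul_Ioi (a := 1 / 2) (r := x ^ 2 / 2) (by norm_num) (by positivity)
    rw [show (1 / 2 : ℝ) - 1 = -(1 / 2) by norm_num] at this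
    rw [this, Real.Gamma_one_half_eq, ← Real.sqrt_eq_rpow, ← Real.sqrt_mul (by positivity)]
    have : 1 / (x ^ 2 / 2) * Real.pi = (2 * Real.pi) * (x⁻¹) ^ 2 := by field_simp
    rw [this, Real.sqrt_mul (by positivity), Real.sqrt_sq (by positivity)]

section Weight

variable {V : Type*} [NormedAddCommGroup V] [InnerProductSpace ℝ V] [FiniteDimensional ℝ V]
  [MeasurableSpace V] [BorelSpace V] {g : V → ℝ} {C : ℝ}

theorem Dispersive.integrable_real (H : Dispersive (fun u => (g u : ℂ)) C) : Integrable g := by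
  simpa using H.integrable.re

/-- A Gaussian weight is the free evolution at an imaginary time, so the decay estimate at real `b =
τ` makes the `τ` integral converge at infinity. -/
theorem Dispersive.integrable_superposition (hg : ∀ u, 0 ≤ g u)
    (H : Dispersive (fun u => (g u : ℂ)) C) (w : V) :
    Integrable (fun p : V × ℝ => g (p.1 - w) * (p.2 ^ (-(1 / 2) : ℝ) * Real.exp (-(‖p.1‖ ^ 2 / 2 * p.2))))
      (volume.prod (volume.restrict (Set.Ioi 0))) := by
  have ig := H.integrable_real.comp_sub_right w
  have meas : AEStronglyMeasurable (fun p : V × ℝ => g (p.1 - w)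
      * (p.2 ^ (-(1 / 2) : ℝ) * Real.exp (-(‖p.1‖ ^ 2 / 2 * p.2))))
      (volume.prod (volume.restrict (Set.Ioi 0))) := by
    refine ig.aestronglyMeasurable.comp_fst.mul (Measurable.aestronglyMeasurable ?_)
    fun_prop
  have ie : ∀ τ : ℝ, 0 < τ → Integrable fun p => g (p - w) * Real.exp (-(‖p‖ ^ 2 / 2 * τ)) := by
    intro τ hτ
    refine ig.mul_bdd (c := 1) (Measurable.aestronglyMeasurable (by fun_prop)) (ae_of_all _ fun p => ?_)
    rw [Real.norm_of_nonneg (Real.exp_pos _).le, Real.exp_le_one_iff]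
    have : 0 ≤ ‖p‖ ^ 2 / 2 * τ := by positivity
    linarith
  rw [integrable_prod_iff' meas]
  refine ⟨?_, ?_⟩
  · refine (ae_restrict_mem measurableSet_Ioi).mono fun τ hτ => ?_
    refine ((ie τ hτ).const_mul (τ ^ (-(1 / 2) : ℝ))).congr (ae_of_all _ fun p => ?_)
    simp only []; ring
  · refine ((superDom_bound one_pos).1.const_mul C).mono' meas.norm.prod_swap.integral_prod_right' ?_
    refine (ae_restrict_mem measurableSet_Ioi).mono fun τ (hτ : 0 < τ) => ?_
    have h0 : ∀ p, 0 ≤ g (p - w) * (τ ^ (-(1 / 2) : ℝ) * Real.exp (-(‖p‖ ^ 2 / 2 * τ))) := fun p =>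
      mul_nonneg (hg _) (by positivity)
    simp only [Real.norm_of_nonneg (h0 _)]
    rw [Real.norm_of_nonneg (integral_nonneg h0)]
    have e : ∫ p, g (p - w) * (τ ^ (-(1 / 2) : ℝ) * Real.exp (-(‖p‖ ^ 2 / 2 * τ)))
        = τ ^ (-(1 / 2) : ℝ) * ∫ p, g (p - w) * Real.exp (-(‖p‖ ^ 2 / 2 * τ)) := by
      rw [← integral_const_mul]; congr 1; ext p; ring
    have hd : ∫ p, g (p - w) * Real.exp (-(‖p‖ ^ 2 / 2 * τ)) ≤ C * min 1 (τ ^ (-(3 / 2) : ℝ)) := by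
      have := H.decay w (τ : ℂ) (by simpa using hτ.le) (by simpa using hτ.ne')
      rw [Complex.norm_real, Real.norm_of_nonneg hτ.le] at this
      refine le_trans (le_of_eq ?_) ((Complex.re_le_norm _).trans this)
      rw [← Complex.ofReal_re (∫ p, g (p - w) * Real.exp (-(‖p‖ ^ 2 / 2 * τ))), ← integral_complex_ofReal]
      congr 2; ext p
      push_cast; congr 2; ring
    have hm : min 1 (τ ^ (-(3 / 2) : ℝ)) ≤ max τ 1 ^ (-(4 / 3) : ℝ) := by
      rcases le_total τ 1 with h | h
      · rw [max_eq_right h, Real.one_rpow]; exact min_le_left _ _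
      · rw [max_eq_left h]; exact min_one_rpow_le hτ le_rfl
    rw [e, superDom, mul_left_comm]
    refine mul_le_mul_of_nonneg_left (hd.trans ?_) (by positivity)
    exact mul_le_mul_of_nonneg_left hm H.nonneg

theorem Dispersive.integrable_inv (hg : ∀ u, 0 ≤ g u) (H : Dispersive (fun u => (g u : ℂ)) C) (w : V) :
    Integrable fun p => g (p - w) * ‖p‖⁻¹ := by
  have hpi : √(2 * Real.pi) ≠ 0 := (Real.sqrt_pos.2 Real.two_pi_pos).ne'
  refine ((H.integrable_superposition hg w).integral_prod_left.const_mul (√(2 * Real.pi))⁻¹).congr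
    (ae_of_all _ fun p => ?_)
  simp only []
  rw [integral_const_mul, integral_superposition _ (norm_nonneg p)]
  field_simp

/-- The Gaussian weight and the oscillation combine into the single complex time `b = τ + is`, with
`|b| ≥ max(τ, s)`; integration over `τ` then gives `s^{-5/6}`. -/
theorem Dispersive.norm_oscInt_inv_le (hg : ∀ u, 0 ≤ g u) (H : Dispersive (fun u => (g u : ℂ)) C)
    (w : V) {s : ℝ} (hs : 0 < s) :
    ‖oscInt (fun p => ((g (p - w) * ‖p‖⁻¹ : ℝ) : ℂ)) s 0‖ ≤ 4 * C * s ^ (-(5 / 6) : ℝ) := by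
  have hpi : 1 ≤ √(2 * Real.pi) := Real.one_le_sqrt.2 (by nlinarith [Real.pi_gt_three])
  have cK := continuous_kinInc (0 : V)
  set F : V → ℝ → ℂ := fun p τ => ((g (p - w) * (τ ^ (-(1 / 2) : ℝ) * Real.exp (-(‖p‖ ^ 2 / 2 * τ))) : ℝ) : ℂ)
    * Complex.exp (-(Complex.I * s) * kinInc 0 p) with hF
  have iF : Integrable (Function.uncurry F) (volume.prod (volume.restrict (Set.Ioi 0))) := by
    refine ((H.integrable_superposition hg w).ofReal (𝕜 := ℂ)).mul_bdd (c := 1)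
      (Continuous.aestronglyMeasurable (f := fun p : V × ℝ =>
        Complex.exp (-(Complex.I * s) * kinInc 0 p.1)) (by fun_prop))
      (ae_of_all _ fun p => (norm_exp_neg_I_mul _ _).le)
  have e1 : (√(2 * Real.pi) : ℂ) * oscInt (fun p => ((g (p - w) * ‖p‖⁻¹ : ℝ) : ℂ)) s 0
      = ∫ τ in Set.Ioi (0 : ℝ), ∫ p, F p τ := by
    rw [← integral_integral_swap iF, oscInt, ← integral_const_mul]
    congr 1; ext p
    simp only [hF]
    rw [integral_mul_const, integral_complex_ofReal, integral_const_mul,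
      integral_superposition _ (norm_nonneg p)]
    push_cast; ring
  have e2 : ∀ τ ∈ Set.Ioi (0 : ℝ), ‖∫ p, F p τ‖ ≤ C * superDom s τ := by
    intro τ (hτ : 0 < τ)
    have hb : max τ s ≤ ‖(τ + Complex.I * s : ℂ)‖ := by
      refine max_le ?_ ?_
      · simpa using (le_abs_self _).trans (Complex.abs_re_le_norm (τ + Complex.I * s : ℂ))
      · simpa using (le_abs_self _).trans (Complex.abs_im_le_norm (τ + Complex.I * s : ℂ))
    have hb0 : (τ + Complex.I * s : ℂ) ≠ 0 := norm_pos_iff.1 ((lt_max_of_lt_left hτ).trans_le hb)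
    have := H.decay w (τ + Complex.I * s) (by simpa using hτ.le) hb0
    have e : ∫ p, F p τ = ((τ ^ (-(1 / 2) : ℝ) : ℝ) : ℂ)
        * ∫ p, (g (p - w) : ℂ) * Complex.exp (-(τ + Complex.I * s) * ‖p‖ ^ 2 / 2) := by
      rw [← integral_const_mul]; congr 1; ext p
      simp only [hF, kinInc, inner_zero_left]
      push_cast
      have : Complex.exp (-(τ + Complex.I * s) * ‖p‖ ^ 2 / 2)
          = Complex.exp (-((‖p‖ : ℂ) ^ 2 / 2 * τ)) * Complex.exp (-(Complex.I * s) * (0 + (‖p‖ : ℂ) ^ 2 / 2)) := by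
        rw [← Complex.exp_add]; congr 1; ring
      rw [this]; ring
    rw [e, norm_mul, Complex.norm_real, Real.norm_of_nonneg (by positivity), superDom, mul_left_comm]
    refine mul_le_mul_of_nonneg_left (this.trans ?_) (by positivity)
    exact mul_le_mul_of_nonneg_left (min_one_rpow_le (lt_max_of_lt_left hτ) hb) H.nonneg
  have h3 : √(2 * Real.pi) * ‖oscInt (fun p => ((g (p - w) * ‖p‖⁻¹ : ℝ) : ℂ)) s 0‖
      ≤ C * (4 * s ^ (-(5 / 6) : ℝ)) := by
    have := congrArg norm e1
    rw [norm_mul, Complex.norm_real, Real.norm_of_nonneg (Real.sqrt_nonneg _)] at this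
    rw [this]
    refine (norm_integral_le_of_norm_le ((superDom_bound hs).1.const_mul C)
      ((ae_restrict_mem measurableSet_Ioi).mono e2)).trans ?_
    rw [integral_const_mul]
    exact mul_le_mul_of_nonneg_left (superDom_bound hs).2 H.nonneg
  nlinarith [norm_nonneg (oscInt (fun p => ((g (p - w) * ‖p‖⁻¹ : ℝ) : ℂ)) s 0)]

/-- Up to the factor `-y`, the integral is the imaginary part of a resolvent integral at energy `a +
iy`. Its time representation is bounded by the Gamma integral of `s^{-5/6} exp(-ys)`, that is, by a
multiple of `y^{-1/6}`. -/
theorem Dispersive.poisson_le (hg : ∀ u, 0 ≤ g u) (H : Dispersive (fun u => (g u : ℂ)) C)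
    (w : V) (a : ℝ) {y : ℝ} (hy : 0 < y) :
    ∫ p, g (p - w) * ‖p‖⁻¹ * ((a - ‖p‖ ^ 2 / 2) ^ 2 + y ^ 2)⁻¹
      ≤ 4 * C * Real.Gamma (1 / 6) * y ^ (-(7 / 6) : ℝ) := by
  set h : V → ℂ := fun p => ((g (p - w) * ‖p‖⁻¹ : ℝ) : ℂ) with hh
  have ih : Integrable h := (H.integrable_inv hg w).ofReal
  have hz : 0 < ((a : ℂ) + Complex.I * y).im := by simpa using hy
  have e1 : (resInt h (a + Complex.I * y) 0).im
      = -(y * ∫ p, g (p - w) * ‖p‖⁻¹ * ((a - ‖p‖ ^ 2 / 2) ^ 2 + y ^ 2)⁻¹) := by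
    have ii : Integrable fun p => h p / ((a + Complex.I * y : ℂ) - kinInc 0 p) := by
      have cK := continuous_kinInc (0 : V)
      refine ih.mul_bdd (c := y⁻¹) (Measurable.aestronglyMeasurable
        (f := fun p => ((a + Complex.I * y : ℂ) - kinInc 0 p)⁻¹)
        (by have := cK.measurable; fun_prop)) (ae_of_all _ fun p => ?_)
      rw [norm_inv]
      refine inv_anti₀ hy ?_
      have := Complex.abs_im_le_norm ((a + Complex.I * y : ℂ) - kinInc 0 p)
      simpa [abs_of_pos hy] using this
    have e2 : (resInt h (a + Complex.I * y) 0).im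
        = ∫ p, (h p / ((a + Complex.I * y : ℂ) - kinInc 0 p)).im := (integral_im (𝕜 := ℂ) ii).symm
    rw [e2, ← integral_const_mul, ← integral_neg]
    congr 1; ext p
    rw [hh, div_eq_mul_inv, Complex.im_ofReal_mul, Complex.inv_im, Complex.normSq_apply]
    have r1 : ((a + Complex.I * y : ℂ) - kinInc 0 p).re = a - ‖p‖ ^ 2 / 2 := by
      simp [kinInc, -Complex.ofReal_pow]
    have r2 : ((a + Complex.I * y : ℂ) - kinInc 0 p).im = y := by simp
    rw [r1, r2]
    simp only [div_eq_mul_inv]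
    ring_nf
  have e3 : ‖resInt h (a + Complex.I * y) 0‖ ≤ 4 * C * Real.Gamma (1 / 6) * y ^ (-(1 / 6) : ℝ) := by
    have iG := integrableOn_rpow_mul_exp_neg_mul_rpow (s := -(5 / 6)) (p := 1) (b := y)
      (by norm_num) (by norm_num) hy
    have vG := Real.integral_rpow_mul_exp_neg_mul_Ioi (a := 1 / 6) (r := y) (by norm_num) hy
    rw [resInt_eq ih hz, norm_mul, norm_neg, Complex.norm_I, one_mul]
    refine (norm_integral_le_of_norm_le (iG.const_mul (4 * C))
      ((ae_restrict_mem measurableSet_Ioi).mono fun s (hs : 0 < s) => ?_)).trans (le_of_eq ?_)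
    · rw [norm_mul, Complex.norm_exp]
      have := H.norm_oscInt_inv_le hg w hs
      have e : (Complex.I * s * (a + Complex.I * y)).re = -y * s ^ (1 : ℝ) := by
        rw [Real.rpow_one]; simp; ring
      rw [e]
      calc Real.exp (-y * s ^ (1 : ℝ)) * ‖oscInt h s 0‖
          ≤ Real.exp (-y * s ^ (1 : ℝ)) * (4 * C * s ^ (-(5 / 6) : ℝ)) := by gcongr
        _ = _ := by ring
    · rw [show (1 / 6 : ℝ) - 1 = -(5 / 6) by norm_num] at vG
      have vI : ∫ s in Set.Ioi (0 : ℝ), s ^ (-(5 / 6) : ℝ) * Real.exp (-y * s ^ (1 : ℝ))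
          = Real.Gamma (1 / 6) * y ^ (-(1 / 6) : ℝ) := by
        simp only [Real.rpow_one, neg_mul]
        rw [vG, one_div y, Real.inv_rpow hy.le, Real.rpow_neg hy.le, mul_comm]
      rw [integral_const_mul, vI]
      ring
  have e4 := (Complex.abs_im_le_norm _).trans e3
  rw [e1, abs_neg] at e4
  have e5 := (le_abs_self _).trans e4
  have e6 : y ^ (-(1 / 6) : ℝ) = y * y ^ (-(7 / 6) : ℝ) := by
    rw [← Real.rpow_one_add' hy.le (by norm_num)]; norm_num
  rw [e6] at e5
  have e7 : 4 * C * Real.Gamma (1 / 6) * (y * y ^ (-(7 / 6) : ℝ))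
      = y * (4 * C * Real.Gamma (1 / 6) * y ^ (-(7 / 6) : ℝ)) := by ring
  rw [e7] at e5
  exact le_of_mul_le_mul_left e5 hy

/-- With `X = |x| + η`, the interval `(X, 2X]` lies beyond `η`, and there `x² + y² ≤ 5X²`. This
converts Poisson kernels into the first power of the propagator. -/
theorem inv_add_le_integral (x : ℝ) {η : ℝ} (hη : 0 < η) :
    (|x| + η)⁻¹ ≤ 5 * ∫ y in Set.Ioi η, (x ^ 2 + y ^ 2)⁻¹ := by
  set X := |x| + η with hX
  have hXη : η ≤ X := by have := abs_nonneg x; linarith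
  have hX0 : 0 < X := hη.trans_le hXη
  have i0 : IntegrableOn (fun y : ℝ => (x ^ 2 + y ^ 2)⁻¹) (Set.Ioi η) := by
    refine (integrableOn_Ioi_rpow_of_lt (a := -2) (by norm_num) hη).mono'
      (Measurable.aestronglyMeasurable (by fun_prop))
      ((ae_restrict_mem measurableSet_Ioi).mono fun y (hy : η < y) => ?_)
    have hy0 := hη.trans hy
    rw [Real.norm_of_nonneg (by positivity), Real.rpow_neg hy0.le, Real.rpow_two]
    exact inv_anti₀ (by positivity) (by nlinarith [sq_nonneg x])
  have h1 : ∫ y in Set.Ioc X (2 * X), (5 * X ^ 2)⁻¹ ≤ ∫ y in Set.Ioc X (2 * X), (x ^ 2 + y ^ 2)⁻¹ := by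
    refine setIntegral_mono_on (integrableOn_const (by simp)) (i0.mono_set ?_) measurableSet_Ioc fun y hy => ?_
    · exact fun y hy => hXη.trans_lt hy.1
    · have hy0 := hX0.trans hy.1
      refine inv_anti₀ (by positivity) ?_
      have : x ^ 2 ≤ X ^ 2 := by rw [← sq_abs x]; gcongr; linarith
      have : y ^ 2 ≤ (2 * X) ^ 2 := by gcongr; exact hy.2
      linarith
  have h2 : ∫ y in Set.Ioc X (2 * X), (x ^ 2 + y ^ 2)⁻¹ ≤ ∫ y in Set.Ioi η, (x ^ 2 + y ^ 2)⁻¹ :=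
    setIntegral_mono_set i0 (ae_of_all _ fun y => by positivity)
      (Eventually.of_forall fun y (hy : y ∈ Set.Ioc X (2 * X)) => hXη.trans_lt hy.1)
  have h3 : ∫ y in Set.Ioc X (2 * X), (5 * X ^ 2)⁻¹ = X⁻¹ / 5 := by
    rw [setIntegral_const, measureReal_def, Real.volume_Ioc, ENNReal.toReal_ofReal (by linarith), smul_eq_mul]
    field_simp; ring
  linarith

/-- The density of states estimate with the weight `1 / |p|`, up to a small power of `η`. -/
theorem Dispersive.weight_le (hg : ∀ u, 0 ≤ g u) (H : Dispersive (fun u => (g u : ℂ)) C)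
    (w : V) (a : ℝ) {η : ℝ} (hη : 0 < η) :
    Integrable (fun p => g (p - w) * ‖p‖⁻¹ * (|a - ‖p‖ ^ 2 / 2| + η)⁻¹) ∧
    ∫ p, g (p - w) * ‖p‖⁻¹ * (|a - ‖p‖ ^ 2 / 2| + η)⁻¹
      ≤ 120 * Real.Gamma (1 / 6) * C * η ^ (-(1 / 6) : ℝ) := by
  have ih := H.integrable_inv hg w
  have h0 : ∀ p, 0 ≤ g (p - w) * ‖p‖⁻¹ := fun p => mul_nonneg (hg _) (by positivity)
  have i1 : Integrable (fun p => g (p - w) * ‖p‖⁻¹ * (|a - ‖p‖ ^ 2 / 2| + η)⁻¹) := by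
    refine ih.mul_bdd (c := η⁻¹) (Measurable.aestronglyMeasurable (by fun_prop)) (ae_of_all _ fun p => ?_)
    rw [Real.norm_of_nonneg (by positivity)]
    exact inv_anti₀ hη (by linarith [abs_nonneg (a - ‖p‖ ^ 2 / 2)])
  refine ⟨i1, ?_⟩
  set F : V → ℝ → ℝ := fun p y => g (p - w) * ‖p‖⁻¹ * ((a - ‖p‖ ^ 2 / 2) ^ 2 + y ^ 2)⁻¹ with hF
  have i2 : IntegrableOn (fun y : ℝ => y ^ (-2 : ℝ)) (Set.Ioi η) :=
    integrableOn_Ioi_rpow_of_lt (a := -2) (by norm_num) hη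
  have iF : Integrable (Function.uncurry F) (volume.prod (volume.restrict (Set.Ioi η))) := by
    refine (ih.mul_prod i2).mono' ?_ ?_
    · exact ih.aestronglyMeasurable.comp_fst.mul (Measurable.aestronglyMeasurable (by fun_prop))
    · have : ∀ᵐ p : V × ℝ ∂(volume.prod (volume.restrict (Set.Ioi η))), p.2 ∈ Set.Ioi η :=
        Measure.quasiMeasurePreserving_snd.ae (ae_restrict_mem measurableSet_Ioi)
      filter_upwards [this] with p (hp : η < p.2)
      have hp0 := hη.trans hp
      simp only [Function.uncurry, hF]
      rw [norm_mul, Real.norm_of_nonneg (h0 _), Real.norm_of_nonneg (by positivity),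
        Real.rpow_neg hp0.le, Real.rpow_two]
      exact mul_le_mul_of_nonneg_left (inv_anti₀ (by positivity)
        (by nlinarith [sq_nonneg (a - ‖p.1‖ ^ 2 / 2)])) (h0 _)
  have i3 : IntegrableOn (fun y : ℝ => y ^ (-(7 / 6) : ℝ)) (Set.Ioi η) :=
    integrableOn_Ioi_rpow_of_lt (by norm_num) hη
  calc ∫ p, g (p - w) * ‖p‖⁻¹ * (|a - ‖p‖ ^ 2 / 2| + η)⁻¹
      ≤ ∫ p, 5 * ∫ y in Set.Ioi η, F p y := by
        refine integral_mono i1 (iF.integral_prod_left.const_mul 5) fun p => ?_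
        simp only [hF]
        rw [integral_const_mul, mul_left_comm]
        exact mul_le_mul_of_nonneg_left (inv_add_le_integral _ hη) (h0 p)
    _ = 5 * ∫ y in Set.Ioi η, ∫ p, F p y := by rw [integral_const_mul, integral_integral_swap iF]
    _ ≤ 5 * ∫ y in Set.Ioi η, 4 * C * Real.Gamma (1 / 6) * y ^ (-(7 / 6) : ℝ) := by
        refine mul_le_mul_of_nonneg_left ?_ (by norm_num)
        refine setIntegral_mono_on iF.integral_prod_right (i3.const_mul _) measurableSet_Ioi fun y hy => ?_
        exact H.poisson_le hg w a (hη.trans hy)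
    _ = _ := by
        -- The last integration contributes a factor `6`, whence `120 = 5·4·6`.
        rw [integral_const_mul, integral_Ioi_rpow_of_lt (by norm_num) hη,
          show (-(7 / 6) : ℝ) + 1 = -(1 / 6) by norm_num]
        ring

end Weight

end Feynman

namespace Feynman

/-! ### The gate integral compared with the self-energy. -/

section Gate

variable {V : Type*} [NormedAddCommGroup V] [InnerProductSpace ℝ V] [FiniteDimensional ℝ V]
  [MeasurableSpace V] [BorelSpace V] {g : V → ℝ} {C L : ℝ}

theorem resInt_im_nonpos (hg : ∀ u, 0 ≤ g u) (hi : Integrable g) {ε : ℝ} (hε : 0 < ε) (q : V) :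
    (resInt (fun u => (g u : ℂ)) (Complex.I * ε) q).im ≤ 0 := by
  have cK := continuous_kinInc q
  have ii : Integrable fun p => (g p : ℂ) / (Complex.I * ε - kinInc q p) := by
    refine (hi.ofReal (𝕜 := ℂ)).mul_bdd (c := ε⁻¹) (Measurable.aestronglyMeasurable
      (f := fun p => (Complex.I * ε - kinInc q p : ℂ)⁻¹)
      (by have := cK.measurable; fun_prop)) (ae_of_all _ fun p => norm_resolvent_le hε _)
  have e2 : (resInt (fun u => (g u : ℂ)) (Complex.I * ε) q).im
      = ∫ p, ((g p : ℂ) / (Complex.I * ε - kinInc q p)).im := (integral_im (𝕜 := ℂ) ii).symm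
  rw [e2]
  refine integral_nonpos fun p => ?_
  rw [div_eq_mul_inv, Complex.im_ofReal_mul, Complex.inv_im]
  have : 0 ≤ (Complex.I * ε - kinInc q p : ℂ).im := by simpa using hε.le
  have h2 : 0 ≤ (Complex.I * ε - kinInc q p : ℂ).im / Complex.normSq (Complex.I * ε - kinInc q p) :=
    div_nonneg this (Complex.normSq_nonneg _)
  have := mul_nonneg (hg p) h2
  simp only [Pi.zero_apply, neg_div]
  linarith

/-- With this sign, the self-energy pushes the denominators away from the real axis in the same
direction as `η`, so that no propagator exceeds `1/η`. -/
theorem Dispersive.resBdry_im_nonpos (hg : ∀ u, 0 ≤ g u) (H : Dispersive (fun u => (g u : ℂ)) C)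
    (q : V) : (resBdry (fun u => (g u : ℂ)) q).im ≤ 0 := by
  have T := (Complex.continuous_im.tendsto _).comp (H.tendsto_resInt q)
  refine le_of_tendsto T ?_
  filter_upwards [self_mem_nhdsWithin] with ε (hε : 0 < ε)
  exact resInt_im_nonpos hg H.integrable_real hε q

theorem continuous_of_radial_lipschitz {θ : V → ℂ} (hL0 : 0 ≤ L)
    (hL : ∀ q w, ‖θ q - θ w‖ ≤ L * |‖q‖ - ‖w‖|) : Continuous θ := by
  refine (LipschitzWith.of_dist_le_mul (K := ⟨L, hL0⟩) fun q w => ?_).continuous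
  rw [dist_eq_norm, dist_eq_norm]
  exact (hL q w).trans (mul_le_mul_of_nonneg_left (abs_norm_sub_norm_le q w) hL0)

/-- The renormalized propagator is bounded below by a shifted free one. -/
theorem exists_shift_le [Nontrivial V] {θ : V → ℂ} {C₀ : ℝ} (hL0 : 0 ≤ L)
    (hL : ∀ q w, ‖θ q - θ w‖ ≤ L * |‖q‖ - ‖w‖|) (hC : ∀ q, ‖θ q‖ ≤ C₀) (him : ∀ q, (θ q).im ≤ 0)
    {lam η : ℝ} (hlam : 0 < lam) (hlam1 : lam ≤ 1) (hη : lam ^ 3 ≤ η) (α : ℝ) :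
    ∃ a : ℝ, ∀ q : V, |a - ‖q‖ ^ 2 / 2| + η ≤ (2 * (1 + C₀ / 2 + L * (L + 1)) + 1)
      * ‖(α : ℂ) - ((‖q‖ ^ 2 / 2 : ℝ) + lam ^ 2 * θ q) + Complex.I * η‖ := by
  -- A momentum on the energy shell of `α`, or zero if `α` is negative; the shift is the self-energy
  -- on this shell.
  obtain ⟨q₀, hq₀⟩ := exists_norm_eq V (Real.sqrt_nonneg (2 * max α 0))
  have hq₀2 : ‖q₀‖ ^ 2 = 2 * max α 0 := by rw [hq₀, Real.sq_sqrt (by positivity)]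
  have hC0 : 0 ≤ C₀ := (norm_nonneg _).trans (hC 0)
  have hη0 : 0 < η := lt_of_lt_of_le (by positivity) hη
  refine ⟨α - lam ^ 2 * (θ q₀).re, fun q => ?_⟩
  set A : ℂ := (α : ℂ) - ((‖q‖ ^ 2 / 2 : ℝ) + lam ^ 2 * θ q) + Complex.I * η with hA
  have e2 : (lam : ℂ) ^ 2 = ((lam ^ 2 : ℝ) : ℂ) := by push_cast; rfl
  have hre : A.re = α - ‖q‖ ^ 2 / 2 - lam ^ 2 * (θ q).re := by
    rw [hA, e2]; simp only [Complex.add_re, Complex.sub_re, Complex.ofReal_re,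
      Complex.mul_re, Complex.I_re, Complex.I_im, Complex.ofReal_im]; ring
  have him' : A.im = η - lam ^ 2 * (θ q).im := by
    rw [hA, e2]; simp only [Complex.add_im, Complex.sub_im, Complex.ofReal_re,
      Complex.mul_im, Complex.I_re, Complex.I_im, Complex.ofReal_im]; ring
  have h1 : η ≤ ‖A‖ := by
    have := (le_abs_self _).trans (Complex.abs_im_le_norm A)
    have := mul_nonneg (sq_nonneg lam) (neg_nonneg.2 (him q))
    linarith
  have h2 := Complex.abs_re_le_norm A
  set x := |α - lam ^ 2 * (θ q₀).re - ‖q‖ ^ 2 / 2| with hx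
  set y := |‖q‖ - ‖q₀‖| with hy
  have hx0 : 0 ≤ x := abs_nonneg _
  have hy0 : 0 ≤ y := abs_nonneg _
  have h3 : x ≤ |A.re| + lam ^ 2 * (L * y) := by
    have : α - lam ^ 2 * (θ q₀).re - ‖q‖ ^ 2 / 2 = A.re + lam ^ 2 * (θ q - θ q₀).re := by
      rw [hre, Complex.sub_re]; ring
    rw [hx, this]
    refine (abs_add_le _ _).trans (add_le_add_right ?_ _)
    rw [abs_mul, abs_of_nonneg (sq_nonneg lam)]
    exact mul_le_mul_of_nonneg_left ((Complex.abs_re_le_norm _).trans (hL q q₀)) (sq_nonneg lam)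
  -- Distance in length is at most the square root of distance in energy, even near zero momentum.
  have h4 : y ^ 2 ≤ 2 * x + 2 * lam ^ 2 * C₀ := by
    have a1 : y ^ 2 ≤ |‖q‖ ^ 2 - ‖q₀‖ ^ 2| := by
      have : |‖q‖ ^ 2 - ‖q₀‖ ^ 2| = y * (‖q‖ + ‖q₀‖) := by
        rw [hy, show ‖q‖ ^ 2 - ‖q₀‖ ^ 2 = (‖q‖ - ‖q₀‖) * (‖q‖ + ‖q₀‖) by ring, abs_mul,
          abs_of_nonneg (by positivity : 0 ≤ ‖q‖ + ‖q₀‖)]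
      rw [this, sq]
      refine mul_le_mul_of_nonneg_left ?_ hy0
      rw [hy, abs_le]; constructor <;> linarith [norm_nonneg q, norm_nonneg q₀]
    have a2 : |‖q‖ ^ 2 - ‖q₀‖ ^ 2| ≤ 2 * |‖q‖ ^ 2 / 2 - α| := by
      rw [hq₀2]
      have := sq_nonneg ‖q‖
      rcases le_total α 0 with h | h
      · rw [max_eq_right h, abs_of_nonneg (by linarith), abs_of_nonneg (by linarith)]; linarith
      · rw [max_eq_left h, show ‖q‖ ^ 2 - 2 * α = 2 * (‖q‖ ^ 2 / 2 - α) by ring, abs_mul, abs_two]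
    have a3 : |‖q‖ ^ 2 / 2 - α| ≤ x + lam ^ 2 * C₀ := by
      have : ‖q‖ ^ 2 / 2 - α = -(α - lam ^ 2 * (θ q₀).re - ‖q‖ ^ 2 / 2) + -(lam ^ 2 * (θ q₀).re) := by ring
      rw [this]
      refine (abs_add_le _ _).trans (add_le_add (by rw [abs_neg]) ?_)
      rw [abs_neg, abs_mul, abs_of_nonneg (sq_nonneg lam)]
      exact mul_le_mul_of_nonneg_left ((Complex.abs_re_le_norm _).trans (hC q₀)) (sq_nonneg lam)
    linarith
  -- The change of the self-energy is of order `λ² y` with `y² ≲ x + λ²`. By the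
  -- arithmetic-geometric inequality half of `x` absorbs it up to an error of order `λ³`, which is
  -- at most of order `η`.
  have h5 : lam ^ 2 * (L * y) ≤ x / 2 + lam ^ 3 * (C₀ / 2 + L * (L + 1)) := by
    have b1 : 4 * (L + 1) * lam * y ≤ y ^ 2 + (2 * (L + 1) * lam) ^ 2 := by nlinarith [sq_nonneg (y - 2 * (L + 1) * lam)]
    have b2 : lam * L * (4 * (L + 1) * lam * y)
        ≤ lam * L * (2 * x + 2 * lam ^ 2 * C₀ + (2 * (L + 1) * lam) ^ 2) :=
      mul_le_mul_of_nonneg_left (b1.trans (by linarith)) (by positivity)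
    have hL1 : 0 < 4 * (L + 1) := by positivity
    refine le_of_mul_le_mul_left ?_ hL1
    have b3 : lam * L * (2 * x) ≤ (L + 1) * (2 * x) := by
      refine mul_le_mul_of_nonneg_right ?_ (by positivity)
      nlinarith
    have b4 : 0 ≤ lam ^ 3 * C₀ := by positivity
    nlinarith
  have h6 : lam ^ 3 * (C₀ / 2 + L * (L + 1)) ≤ ‖A‖ * (C₀ / 2 + L * (L + 1)) :=
    mul_le_mul_of_nonneg_right (hη.trans h1) (by positivity)
  nlinarith

/-- `Z` is the denominator with the self-energy frozen at `w`. The frozen integral is a free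
resolvent integral at `z = A w`, handled by Hölder continuity; the freezing error is handled by the
Lipschitz bound on `θ` and the weighted density of states. -/
theorem Dispersive.gate_le (hd : 3 ≤ Module.finrank ℝ V) (hg : ∀ u, 0 ≤ g u)
    (H : Dispersive (fun u => (g u : ℂ)) C) {θ : V → ℂ} (hθ : θ = resBdry (fun u => (g u : ℂ)))
    (hL0 : 0 ≤ L) (hL : ∀ q w, ‖θ q - θ w‖ ≤ L * |‖q‖ - ‖w‖|)
    {lam η : ℝ} (hlam : 0 < lam) (hlam1 : lam ≤ 1) (hη : lam ^ 3 ≤ η) (α : ℝ) (w : V) :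
    ‖(∫ q, (g (q - w) : ℂ) / ((α : ℂ) - ((‖q‖ ^ 2 / 2 : ℝ) + lam ^ 2 * θ q) + Complex.I * η)) - θ w‖
      ≤ (8 * C + 4 * L * (2 * (1 + 3 * C / 2 + L * (L + 1)) + 1) * (120 * Real.Gamma (1 / 6) * C))
        * η ^ (-(1 / 2) : ℝ)
        * ‖(α : ℂ) - ((‖w‖ ^ 2 / 2 : ℝ) + lam ^ 2 * θ w) + Complex.I * η‖ := by
  have : Nontrivial V := Module.nontrivial_of_finrank_pos (R := ℝ) (by omega)
  have hC := H.nonneg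
  have hη0 : 0 < η := lt_of_lt_of_le (by positivity) hη
  have him : ∀ q, (θ q).im ≤ 0 := fun q => hθ ▸ H.resBdry_im_nonpos hg q
  have hbd : ∀ q, ‖θ q‖ ≤ 3 * C := fun q => hθ ▸ H.norm_resBdry_le q
  have hcont := continuous_of_radial_lipschitz hL0 hL
  obtain ⟨a', ha'⟩ := exists_shift_le hL0 hL hbd him hlam hlam1 hη α
  set K := 2 * (1 + 3 * C / 2 + L * (L + 1)) + 1 with hK
  have hK0 : 0 < K := by positivity
  have e2 : (lam : ℂ) ^ 2 = ((lam ^ 2 : ℝ) : ℂ) := by push_cast; rfl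
  have imb : ∀ r s : V, η ≤ ((α : ℂ) - ((‖s‖ ^ 2 / 2 : ℝ) + lam ^ 2 * θ r) + Complex.I * η).im := by
    intro r s
    rw [e2]; simp only [Complex.add_im, Complex.sub_im, Complex.ofReal_re,
      Complex.mul_im, Complex.I_re, Complex.I_im, Complex.ofReal_im]
    nlinarith [mul_nonneg (sq_nonneg lam) (neg_nonneg.2 (him r))]
  have nb : ∀ r s : V, η ≤ ‖(α : ℂ) - ((‖s‖ ^ 2 / 2 : ℝ) + lam ^ 2 * θ r) + Complex.I * η‖ := fun r s =>
    (imb r s).trans ((le_abs_self _).trans (Complex.abs_im_le_norm _))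
  set A : V → ℂ := fun q => (α : ℂ) - ((‖q‖ ^ 2 / 2 : ℝ) + lam ^ 2 * θ q) + Complex.I * η with hA
  set Z : V → ℂ := fun q => (α : ℂ) - ((‖q‖ ^ 2 / 2 : ℝ) + lam ^ 2 * θ w) + Complex.I * η with hZ
  have hAn : ∀ q, η ≤ ‖A q‖ := fun q => nb q q
  have hZn : ∀ q, η ≤ ‖Z q‖ := fun q => nb w q
  have ig := H.integrable_real.comp_sub_right w
  have intA : Integrable fun q => (g (q - w) : ℂ) / A q := by
    refine (ig.ofReal (𝕜 := ℂ)).mul_bdd (c := η⁻¹) (Measurable.aestronglyMeasurable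
      (f := fun p => (A p)⁻¹) ?_) (ae_of_all _ fun p => ?_)
    · have := hcont.measurable
      simp only [hA]; fun_prop
    · rw [norm_inv]; exact inv_anti₀ hη0 (hAn p)
  have intZ : Integrable fun q => (g (q - w) : ℂ) / Z q := by
    refine (ig.ofReal (𝕜 := ℂ)).mul_bdd (c := η⁻¹) (Measurable.aestronglyMeasurable
      (f := fun p => (Z p)⁻¹) ?_) (ae_of_all _ fun p => ?_)
    · simp only [hZ]; fun_prop
    · rw [norm_inv]; exact inv_anti₀ hη0 (hZn p)
  set a := ‖A w‖ with ha
  have haη : η ≤ a := hAn w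
  have ha0 : 0 < a := hη0.trans_le haη
  have hT : ∫ q, (g (q - w) : ℂ) / Z q = resInt (fun u => (g u : ℂ)) (A w) w := by
    rw [resInt, ← integral_sub_right_eq_self (fun u => (g u : ℂ) / (A w - kinInc w u)) w]
    congr 1; ext q
    rw [kinInc_sub]; congr 1
    simp only [hZ, hA]; push_cast; ring
  -- Since `a ≥ η`, the Hölder bound `√a` is at most `η^{-1/2} a`.
  have step1 : ‖resInt (fun u => (g u : ℂ)) (A w) w - θ w‖ ≤ 8 * C * (η ^ (-(1 / 2) : ℝ) * a) := by
    have h := H.norm_resInt_sub_resBdry_le (hη0.trans_le (imb w w)) w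
    rw [← hθ] at h
    refine h.trans (mul_le_mul_of_nonneg_left ?_ (by positivity))
    rw [Real.rpow_neg hη0.le, ← Real.sqrt_eq_rpow, inv_mul_eq_div, le_div_iff₀ (Real.sqrt_pos.2 hη0)]
    calc √a * √η ≤ √a * √a := mul_le_mul_of_nonneg_left (Real.sqrt_le_sqrt haη) (Real.sqrt_nonneg _)
      _ = a := Real.mul_self_sqrt ha0.le
  obtain ⟨iW, hW⟩ := H.weight_le hg w a' hη0
  -- The estimate below divides by `|q|`.
  have hne : ∀ᵐ q : V, q ≠ 0 := by
    have h0 : ({0} : Set V)ᶜ ∈ ae (volume : Measure V) := compl_mem_ae_iff.2 (measure_singleton 0)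
    filter_upwards [h0] with q hq
    simpa using hq
  have step2 : ‖(∫ q, (g (q - w) : ℂ) / A q) - ∫ q, (g (q - w) : ℂ) / Z q‖
      ≤ ∫ q, (4 * L * lam ^ 2 * (a / η) * K) * (g (q - w) * ‖q‖⁻¹ * (|a' - ‖q‖ ^ 2 / 2| + η)⁻¹) := by
    rw [← integral_sub intA intZ]
    refine norm_integral_le_of_norm_le (iW.const_mul _) ?_
    filter_upwards [hne] with q hq
    have hq0 : 0 < ‖q‖ := norm_pos_iff.2 hq
    have hAq : 0 < ‖A q‖ := hη0.trans_le (hAn q)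
    have hZq : 0 < ‖Z q‖ := hη0.trans_le (hZn q)
    have e : (g (q - w) : ℂ) / A q - (g (q - w) : ℂ) / Z q
        = (g (q - w) : ℂ) * (lam ^ 2 * (θ q - θ w)) / (A q * Z q) := by
      have h1 := norm_pos_iff.1 hAq
      have h2 := norm_pos_iff.1 hZq
      have h3 : Z q - A q = lam ^ 2 * (θ q - θ w) := by simp only [hZ, hA]; ring
      rw [← h3]; field_simp
    -- Radial Lipschitz continuity is turned into a bound by the difference of energies, which is
    -- `|A w - Z q|` because the frozen self-energy cancels.
    have d1 : ‖θ q - θ w‖ ≤ 2 * L * ‖q‖⁻¹ * (‖Z q‖ + a) := by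
      have h1 : |‖q‖ - ‖w‖| * ‖q‖ ≤ 2 * |‖q‖ ^ 2 / 2 - ‖w‖ ^ 2 / 2| := by
        have : 2 * |‖q‖ ^ 2 / 2 - ‖w‖ ^ 2 / 2| = |‖q‖ - ‖w‖| * (‖q‖ + ‖w‖) := by
          rw [show ‖q‖ ^ 2 / 2 - ‖w‖ ^ 2 / 2 = (‖q‖ - ‖w‖) * ((‖q‖ + ‖w‖) / 2) by ring, abs_mul,
            abs_of_nonneg (by positivity : 0 ≤ (‖q‖ + ‖w‖) / 2)]
          ring
        rw [this]
        exact mul_le_mul_of_nonneg_left (by linarith [norm_nonneg w]) (abs_nonneg _)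
      have h2 : |‖q‖ ^ 2 / 2 - ‖w‖ ^ 2 / 2| ≤ ‖Z q‖ + a := by
        have : ((‖q‖ ^ 2 / 2 - ‖w‖ ^ 2 / 2 : ℝ) : ℂ) = A w - Z q := by
          simp only [hZ, hA]; push_cast; ring
        rw [← Real.norm_eq_abs, ← Complex.norm_real, this, add_comm]
        exact norm_sub_le _ _
      refine (hL q w).trans ?_
      have h3 : |‖q‖ - ‖w‖| ≤ 2 * (‖Z q‖ + a) * ‖q‖⁻¹ := by
        rw [← div_eq_mul_inv, le_div_iff₀ hq0]; linarith
      calc L * |‖q‖ - ‖w‖| ≤ L * (2 * (‖Z q‖ + a) * ‖q‖⁻¹) := by gcongr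
        _ = _ := by ring
    -- Both terms are multiples of `|Z q|` since `|Z q| ≥ η` and `a ≥ η`; this removes the frozen
    -- denominator at the cost of `a/η`.
    have d2 : ‖Z q‖ + a ≤ 2 * (a / η) * ‖Z q‖ := by
      have h1 : ‖Z q‖ ≤ a / η * ‖Z q‖ :=
        le_mul_of_one_le_left hZq.le ((one_le_div hη0).2 haη)
      have h2 : a ≤ a / η * ‖Z q‖ := by
        rw [div_mul_eq_mul_div, le_div_iff₀ hη0]
        exact mul_le_mul_of_nonneg_left (hZn q) ha0.le
      linarith
    have d3 : ‖A q‖⁻¹ ≤ K * (|a' - ‖q‖ ^ 2 / 2| + η)⁻¹ := by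
      rw [← div_eq_mul_inv, le_div_iff₀ (by positivity), inv_mul_le_iff₀ hAq]
      linarith [ha' q]
    rw [e, norm_div, norm_mul, norm_mul, norm_mul, norm_pow, Complex.norm_real, Complex.norm_real,
      Real.norm_of_nonneg (hg _), Real.norm_of_nonneg hlam.le]
    have hgq := hg (q - w)
    calc g (q - w) * (lam ^ 2 * ‖θ q - θ w‖) / (‖A q‖ * ‖Z q‖)
        ≤ g (q - w) * (lam ^ 2 * (2 * L * ‖q‖⁻¹ * (2 * (a / η) * ‖Z q‖))) / (‖A q‖ * ‖Z q‖) := by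
          gcongr
          exact d1.trans (mul_le_mul_of_nonneg_left d2 (by positivity))
      _ = 4 * L * lam ^ 2 * (a / η) * (g (q - w) * ‖q‖⁻¹) * ‖A q‖⁻¹ := by field_simp; ring
      _ ≤ 4 * L * lam ^ 2 * (a / η) * (g (q - w) * ‖q‖⁻¹) * (K * (|a' - ‖q‖ ^ 2 / 2| + η)⁻¹) := by
          gcongr
      _ = _ := by ring
  -- Exponents: `2/3 - 1 - 1/6 = -1/2`, with `λ² ≤ η^{2/3}` from `λ³ ≤ η`.
  have hpow : lam ^ 2 * (1 / η) * η ^ (-(1 / 6) : ℝ) ≤ η ^ (-(1 / 2) : ℝ) := by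
    have h1 : lam ^ 2 ≤ η ^ (2 / 3 : ℝ) := by
      have := Real.rpow_le_rpow (by positivity) hη (by norm_num : (0 : ℝ) ≤ 2 / 3)
      rwa [← Real.rpow_natCast lam 3, ← Real.rpow_mul hlam.le, show ((3 : ℕ) : ℝ) * (2 / 3) = (2 : ℕ) by norm_num,
        Real.rpow_natCast] at this
    calc lam ^ 2 * (1 / η) * η ^ (-(1 / 6) : ℝ) ≤ η ^ (2 / 3 : ℝ) * (1 / η) * η ^ (-(1 / 6) : ℝ) := by gcongr
      _ = η ^ (-(1 / 2) : ℝ) := by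
        rw [one_div, ← Real.rpow_neg_one, ← Real.rpow_add hη0, ← Real.rpow_add hη0]; norm_num
  have hG : 0 < Real.Gamma (1 / 6) := Real.Gamma_pos_of_pos (by norm_num)
  rw [integral_const_mul] at step2
  have step3 : ‖(∫ q, (g (q - w) : ℂ) / A q) - ∫ q, (g (q - w) : ℂ) / Z q‖
      ≤ 4 * L * K * (120 * Real.Gamma (1 / 6) * C) * (η ^ (-(1 / 2) : ℝ) * a) := by
    refine step2.trans ((mul_le_mul_of_nonneg_left hW (by positivity)).trans ?_)
    calc 4 * L * lam ^ 2 * (a / η) * K * (120 * Real.Gamma (1 / 6) * C * η ^ (-(1 / 6) : ℝ))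
        = 4 * L * K * (120 * Real.Gamma (1 / 6) * C) * a * (lam ^ 2 * (1 / η) * η ^ (-(1 / 6) : ℝ)) := by ring
      _ ≤ 4 * L * K * (120 * Real.Gamma (1 / 6) * C) * a * η ^ (-(1 / 2) : ℝ) := by gcongr
      _ = _ := by ring
  rw [hT] at step3
  calc _ = ‖((∫ q, (g (q - w) : ℂ) / A q) - resInt (fun u => (g u : ℂ)) (A w) w)
        + (resInt (fun u => (g u : ℂ)) (A w) w - θ w)‖ := by congr 1; ring
    _ ≤ _ := (norm_add_le _ _).trans (add_le_add step3 step1)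
    _ = _ := by ring

end Gate

end Feynman

namespace Feynman

/-! ### Symmetries of the potential and constants uniform in the coupling. -/

section Potential

variable {V : Type*} [NormedAddCommGroup V] [InnerProductSpace ℝ V] [FiniteDimensional ℝ V]
  [MeasurableSpace V] [BorelSpace V]

theorem conj_fourier_ofReal (B : V → ℝ) (p : V) :
    conj (𝓕 (fun x => (B x : ℂ)) p) = 𝓕 (fun x => (B x : ℂ)) (-p) := by
  rw [Real.fourier_eq, Real.fourier_eq, ← integral_conj]
  congr 1; ext v
  rw [Circle.smul_def, Circle.smul_def, smul_eq_mul, smul_eq_mul, map_mul, Complex.conj_ofReal,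
    ← Circle.coe_inv_eq_conj, ← AddChar.map_neg_eq_inv, inner_neg_right]

theorem fourier_radial {B : V → ℝ} (hB : ∀ x y, ‖x‖ = ‖y‖ → B x = B y) {p q : V} (h : ‖p‖ = ‖q‖) :
    𝓕 (fun x => (B x : ℂ)) p = 𝓕 (fun x => (B x : ℂ)) q := by
  obtain ⟨A, rfl⟩ := exists_isometry_map h
  have : (fun x => (B x : ℂ)) ∘ A = fun x => (B x : ℂ) := funext fun x => by
    rw [Function.comp_apply, hB (A x) x (A.norm_map x)]
  rw [← Real.fourier_comp_linearIsometry, this]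

/-- The complexification of a real Schwartz function. -/
def complexify (B : 𝓢(V, ℝ)) : 𝓢(V, ℂ) := B.postcompCLM Complex.ofRealCLM

theorem coe_complexify (B : 𝓢(V, ℝ)) : ⇑(complexify B) = fun x => (B x : ℂ) := rfl

/-- The square of a Schwartz function. -/
def schwartzSq (φ : 𝓢(V, ℂ)) : 𝓢(V, ℂ) := SchwartzMap.smulLeftCLM ℂ φ φ

theorem schwartzSq_apply (φ : 𝓢(V, ℂ)) (v : V) : schwartzSq φ v = φ v * φ v := by
  rw [schwartzSq, SchwartzMap.smulLeftCLM_apply_apply φ.hasTemperateGrowth, smul_eq_mul]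

theorem exists_schwartz_eq {χ : V → ℝ} (hχ : ContDiff ℝ ∞ χ) (hs : ∀ p, 1 < ‖p‖ → χ p = 0) :
    ∃ φ : 𝓢(V, ℂ), ∀ p, φ p = χ p := by
  have h1 : HasCompactSupport fun p => (χ p : ℂ) := by
    refine HasCompactSupport.intro (isCompact_closedBall (0 : V) 1) fun p hp => ?_
    rw [hs p (by simpa using hp), Complex.ofReal_zero]
  exact ⟨h1.toSchwartzMap (Complex.ofRealCLM.contDiff.comp hχ), fun p => rfl⟩

end Potential

namespace Setting

variable {d : ℕ}

/-- The properties of the potential and of the self-energy that enter the estimates of graphs. -/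
structure Regular (M : Setting d) (C : ℝ) : Prop where
  lam_pos : 0 < M.lam
  η_pos : 0 < M.η
  continuous_Bhat : Continuous M.Bhat
  Bhat_neg : ∀ p, M.Bhat (-p) = M.Bhat p
  conj_Bhat : ∀ p, conj (M.Bhat p) = M.Bhat p
  Bhat_eq_zero : ∀ p, M.lam ^ (-M.δ) < ‖p‖ → M.Bhat p = 0
  norm_Bhat_le : ∀ p, ‖M.Bhat p‖ ≤ C
  continuous_θ : Continuous M.θ
  norm_θ_le : ∀ p, ‖M.θ p‖ ≤ C
  θ_im_nonpos : ∀ p, (M.θ p).im ≤ 0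
  norm_gate_sub_le : ∀ (α : ℝ) (p : Mom d),
    ‖(∫ q, (‖M.Bhat (q - p)‖ ^ 2 : ℂ) / ((α : ℂ) - M.disp q + Complex.I * M.η)) - M.θ p‖
      ≤ C * M.η ^ (-(1 / 2) : ℝ) * ‖(α : ℂ) - M.disp p + Complex.I * M.η‖

theorem Θε_eq_resInt (M : Setting d) (ε : ℝ) (p : Mom d) :
    M.Θε ε (kin p) p = resInt (fun u => ((‖M.Bhat u‖ ^ 2 : ℝ) : ℂ)) (Complex.I * ε) p := by
  rw [Θε, resInt, ← integral_sub_right_eq_self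
    (fun u => ((‖M.Bhat u‖ ^ 2 : ℝ) : ℂ) / (Complex.I * ε - kinInc p u)) p]
  congr 1; ext q
  rw [kinInc_sub, kin, kin]
  push_cast
  congr 1; ring

/-- A real radial potential has a real even Fourier transform, so `|B̂_λ|²` is the product of two
squares of Schwartz functions, the cutoff one at scale `c = λ^δ ≤ 1`. All preceding constants are
uniform in such `c`, hence in `λ` and `δ`. -/
theorem exists_regular (hd : 3 ≤ d) (B : 𝓢(Mom d, ℝ)) (hB : ∀ x y, ‖x‖ = ‖y‖ → B x = B y)
    (χ : Mom d → ℝ) (hχ : ContDiff ℝ ∞ χ) (hχrad : ∀ p q, ‖p‖ = ‖q‖ → χ p = χ q)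
    (hχsupp : ∀ p, 1 < ‖p‖ → χ p = 0) :
    ∃ C : ℝ, 0 < C ∧ ∀ M : Setting d, M.B = B → M.χ = χ → 0 < M.δ → 0 < M.lam → M.lam ≤ 1 →
      M.lam ^ 3 ≤ M.η → M.Regular C := by
  have hd' : 3 ≤ Module.finrank ℝ (Mom d) := by simpa using hd
  obtain ⟨φ, hφ⟩ := exists_schwartz_eq hχ hχsupp
  set ψ : 𝓢(Mom d, ℂ) := 𝓕 (complexify B) with hψ
  have hψ' : ∀ p, ψ p = 𝓕 (fun x => (B x : ℂ)) p := fun p => by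
    rw [hψ, SchwartzMap.fourier_coe, coe_complexify]
  obtain ⟨C₁, H₁⟩ := exists_dispersive hd' (schwartzSq φ) (schwartzSq ψ)
  obtain ⟨L, hL, H₂⟩ := exists_lipschitz hd' (schwartzSq φ) (schwartzSq ψ)
  obtain ⟨b₁, hb₁, Hb₁⟩ := exists_norm_le φ
  obtain ⟨b₂, hb₂, Hb₂⟩ := exists_norm_le ψ
  have hC₁ := (H₁ 0 (by simp)).nonneg
  have hG : 0 < Real.Gamma (1 / 6) := Real.Gamma_pos_of_pos (by norm_num)
  set K := 8 * C₁ + 4 * L * (2 * (1 + 3 * C₁ / 2 + L * (L + 1)) + 1) * (120 * Real.Gamma (1 / 6) * C₁)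
    with hK
  have hK0 : 0 ≤ K := by positivity
  refine ⟨K + 3 * C₁ + b₁ * b₂ + 1, by positivity, fun M hMB hMχ hδ hlam hlam1 hη => ?_⟩
  have hη0 : 0 < M.η := lt_of_lt_of_le (by positivity) hη
  set c := M.lam ^ M.δ with hc
  have hc0 : 0 < c := Real.rpow_pos_of_pos hlam _
  have hc1 : |c| ≤ 1 := by
    rw [abs_of_pos hc0]; exact Real.rpow_le_one hlam.le hlam1 hδ.le
  have eB : ∀ p, M.Bhat p = φ (c • p) * ψ p := fun p => by
    rw [Bhat, hMB, hMχ, hφ, hψ']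
  have hψneg : ∀ p, ψ (-p) = ψ p := fun p => by
    rw [hψ', hψ']; exact fourier_radial hB (norm_neg p)
  have hψconj : ∀ p, conj (ψ p) = ψ p := fun p => by
    rw [hψ', conj_fourier_ofReal, ← hψ', hψneg, hψ']
  have hconj : ∀ p, conj (M.Bhat p) = M.Bhat p := fun p => by
    rw [eB, map_mul, hψconj, hφ, Complex.conj_ofReal]
  have hf : (fun u => ((‖M.Bhat u‖ ^ 2 : ℝ) : ℂ)) = scaledProd (schwartzSq φ) (schwartzSq ψ) c := by
    ext u
    rw [Complex.ofReal_pow, ← Complex.mul_conj', hconj, scaledProd, schwartzSq_apply,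
      schwartzSq_apply, eB]
    ring
  have hrad : ∀ u v : Mom d, ‖u‖ = ‖v‖ → scaledProd (schwartzSq φ) (schwartzSq ψ) c u
      = scaledProd (schwartzSq φ) (schwartzSq ψ) c v := fun u v h => by
    have h1 : φ (c • u) = φ (c • v) := by
      rw [hφ, hφ, hχrad (c • u) (c • v) (by rw [norm_smul, norm_smul, h])]
    have h2 : ψ u = ψ v := by rw [hψ', hψ']; exact fourier_radial hB h
    rw [scaledProd, scaledProd, schwartzSq_apply, schwartzSq_apply, schwartzSq_apply,
      schwartzSq_apply, h1, h2]
  have hD : Dispersive (fun u => ((‖M.Bhat u‖ ^ 2 : ℝ) : ℂ)) C₁ := hf ▸ H₁ c hc1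
  have hθ : M.θ = resBdry (fun u => ((‖M.Bhat u‖ ^ 2 : ℝ) : ℂ)) := by
    ext p
    -- The limit exists, so the self-energy is the true boundary value and not a default value of
    -- `limUnder`.
    refine Tendsto.limUnder_eq ?_
    simp only [Θε_eq_resInt]
    exact hD.tendsto_resInt p
  have hLip : ∀ q w, ‖M.θ q - M.θ w‖ ≤ L * |‖q‖ - ‖w‖| := by
    rw [hθ, hf]; exact H₂ c hc1 hrad
  refine ⟨hlam, hη0, ?_, fun p => ?_, hconj, fun p hp => ?_, fun p => ?_,
    continuous_of_radial_lipschitz hL hLip, fun p => ?_, fun p => ?_, fun α p => ?_⟩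
  · rw [funext eB]; exact (φ.continuous.comp (by fun_prop)).mul ψ.continuous
  · rw [eB, eB, hψneg, hφ, hφ, hχrad (c • -p) (c • p) (by rw [norm_smul, norm_smul, norm_neg])]
  · rw [eB, hφ, hχsupp, Complex.ofReal_zero, zero_mul]
    rw [Real.rpow_neg hlam.le] at hp
    rw [norm_smul, Real.norm_of_nonneg hc0.le]
    exact (inv_lt_iff_one_lt_mul₀' hc0).1 hp
  · rw [eB, norm_mul]
    refine (mul_le_mul (Hb₁ _) (Hb₂ _) (norm_nonneg _) hb₁).trans ?_
    linarith
  · rw [hθ]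
    refine (hD.norm_resBdry_le p).trans ?_
    nlinarith [mul_nonneg hb₁ hb₂]
  · rw [hθ]; exact hD.resBdry_im_nonpos (fun u => by positivity) p
  · have h := hD.gate_le hd' (fun u => by positivity) hθ hL hLip hlam hlam1 hη α p
    simp only [Complex.ofReal_pow] at h
    refine h.trans ?_
    have : 0 ≤ M.η ^ (-(1 / 2) : ℝ) := Real.rpow_nonneg hη0.le _
    refine mul_le_mul_of_nonneg_right (mul_le_mul_of_nonneg_right ?_ this) (norm_nonneg _)
    nlinarith [mul_nonneg hb₁ hb₂]

end Setting

end Feynman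

namespace Feynman

/-! ### Partial sums along an arc. -/

section PartialSums

variable {A : Type*} [AddCommGroup A]

/-- The partial sums of a finite sequence, as sums over the whole index set. -/
def psum {m : ℕ} (x : Fin m → A) (i : Fin (m + 1)) : A :=
  ∑ k, if k.castSucc < i then x k else 0

theorem psum_zero_right {m : ℕ} (x : Fin m → A) : psum x 0 = 0 := by simp [psum]

theorem psum_last {m : ℕ} (x : Fin m → A) : psum x (Fin.last m) = ∑ k, x k := by
  simp [psum, Fin.castSucc_lt_last]

theorem psum_succ_cons {m : ℕ} (x : Fin (m + 1) → A) (i : Fin (m + 1)) :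
    psum x i.succ = x 0 + psum (fun k => x k.succ) i := by
  rw [psum, Fin.sum_univ_succ, psum]
  simp [Fin.castSucc_succ]

theorem psum_succ {m : ℕ} (x : Fin m → A) (k : Fin m) :
    psum x k.succ = psum x k.castSucc + x k := by
  rw [psum, psum, ← Finset.add_sum_erase _ _ (Finset.mem_univ k),
    ← Finset.add_sum_erase (a := k) _ (fun j => if j.castSucc < k.castSucc then x j else 0)
      (Finset.mem_univ k), if_pos Fin.castSucc_lt_succ, if_neg (lt_irrefl _), zero_add, add_comm]
  congr 1
  refine Finset.sum_congr rfl fun j hj => ?_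
  have hj' : (j : ℕ) ≠ k := fun h => Finset.ne_of_mem_erase hj (Fin.ext h)
  have : (j.castSucc < k.succ) ↔ (j.castSucc < k.castSucc) := by
    simp only [Fin.lt_def, Fin.val_succ, Fin.val_castSucc]; omega
  simp only [this]

theorem psum_add {m : ℕ} (x y : Fin m → A) (i : Fin (m + 1)) :
    psum (fun k => x k + y k) i = psum x i + psum y i := by
  rw [psum, psum, psum, ← Finset.sum_add_distrib]
  exact Finset.sum_congr rfl fun k _ => by split_ifs <;> simp

theorem psum_neg {m : ℕ} (x : Fin m → A) (i : Fin (m + 1)) :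
    psum (fun k => -x k) i = -psum x i := by
  rw [psum, psum, ← Finset.sum_neg_distrib]
  exact Finset.sum_congr rfl fun k _ => by split_ifs <;> simp

theorem psum_smul [Module ℝ A] {m : ℕ} (c : ℝ) (x : Fin m → A) (i : Fin (m + 1)) :
    psum (fun k => c • x k) i = c • psum x i := by
  rw [psum, psum, Finset.smul_sum]
  exact Finset.sum_congr rfl fun k _ => by split_ifs <;> simp

end PartialSums

/-! ### Volume-preserving maps and delta measures. -/

section MeasurePreserving

variable {d : ℕ}

theorem measurable_psum {X : Type*} [MeasurableSpace X] {m : ℕ} {x : X → Fin m → Mom d}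
    (hx : ∀ k, Measurable fun y => x y k) (i : Fin (m + 1)) : Measurable fun y => psum (x y) i := by
  unfold psum
  refine Finset.measurable_sum _ fun k _ => ?_
  split_ifs
  · exact hx k
  · exact measurable_const

/-- The map is triangular with unit diagonal. By induction, the first coordinate is split off and
added to the partial sums of the others, a translation for each of its values. -/
theorem measurePreserving_psum (m : ℕ) :
    MeasurePreserving (fun (x : Fin m → Mom d) (i : Fin m) => psum x i.succ) := by
  induction m with
  | zero =>
    have : (fun (x : Fin 0 → Mom d) (i : Fin 0) => psum x i.succ) = id := Subsingleton.elim _ _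
    rw [this]; exact MeasurePreserving.id _
  | succ m ih =>
    have h1 := volume_preserving_piFinSuccAbove (fun _ : Fin (m + 1) => Mom d) 0
    have h2 : MeasurePreserving (fun p : Mom d × (Fin m → Mom d) =>
        (p.1, ((fun _ => p.1) + fun i : Fin m => psum p.2 i.succ : Fin m → Mom d))) := by
      refine (MeasurePreserving.id _).skew_product (g := fun (a : Mom d) (z : Fin m → Mom d) =>
        ((fun _ => a) + fun i : Fin m => psum z i.succ : Fin m → Mom d)) ?_ (ae_of_all _ fun a => ?_)
      · refine measurable_pi_iff.2 fun i => ?_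
        exact measurable_fst.add ((measurable_pi_iff.1 ih.measurable i).comp measurable_snd)
      · exact ((measurePreserving_add_left volume (fun _ : Fin m => a)).comp ih).map_eq
    have h3 := h1.symm.comp (h2.comp h1)
    convert h3 using 1
    ext x i : 2
    refine Fin.cases ?_ (fun i => ?_) i
    · have : psum x (Fin.succ 0) = x 0 := by rw [psum_succ_cons, psum_zero_right, add_zero]
      simpa [MeasurableEquiv.piFinSuccAbove] using this
    · simp [MeasurableEquiv.piFinSuccAbove, psum_succ_cons]
      rfl

open Classical in
/-- A shear, adding to some of the coordinates a function of the other ones, preserves Lebesgue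
measure. -/
theorem measurePreserving_shear {I : Type*} [Fintype I] (s : Set I) (N : (I → Mom d) → I → Mom d)
    (hN : Measurable N) (h0 : ∀ x, ∀ i ∈ s, N x i = 0)
    (hs : ∀ x y, (∀ i ∈ s, x i = y i) → N x = N y) :
    MeasurePreserving fun x : I → Mom d => x + N x := by
  have h1 := volume_preserving_piEquivPiSubtypeProd (fun _ : I => Mom d) (· ∈ s)
  set e := MeasurableEquiv.piEquivPiSubtypeProd (fun _ : I => Mom d) (· ∈ s) with he
  have h2 : MeasurePreserving (fun p : ({i // i ∈ s} → Mom d) × ({i // i ∉ s} → Mom d) =>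
      (p.1, (fun i : {i // i ∉ s} => N (e.symm (p.1, 0)) i) + p.2)) := by
    refine (MeasurePreserving.id _).skew_product
      (g := fun (a : {i // i ∈ s} → Mom d) (z : {i // i ∉ s} → Mom d) =>
        (fun i : {i // i ∉ s} => N (e.symm (a, 0)) i) + z) ?_ (ae_of_all _ fun a => ?_)
    · refine measurable_pi_iff.2 fun i => ?_
      refine Measurable.add ?_ ((measurable_pi_apply i).comp measurable_snd)
      exact (measurable_pi_apply i.1).comp (hN.comp (e.symm.measurable.comp
        (measurable_fst.prodMk measurable_const)))
    · exact (measurePreserving_add_left volume _).map_eq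
  have h3 := h1.symm.comp (h2.comp h1)
  convert h3 using 1
  funext x i
  have hx : ∀ x : I → Mom d, ∀ p : {i // i ∈ s} → Mom d, p = (e x).1 → N (e.symm (p, 0)) = N x := by
    rintro x _ rfl
    refine hs _ _ fun i hi => ?_
    simp [he, MeasurableEquiv.piEquivPiSubtypeProd, Equiv.piEquivPiSubtypeProd, hi]
  simp only [Function.comp_apply, Pi.add_apply]
  rw [hx x _ rfl]
  by_cases hi : i ∈ s
  · simp [he, MeasurableEquiv.piEquivPiSubtypeProd, Equiv.piEquivPiSubtypeProd, hi, h0]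
  · simp [he, MeasurableEquiv.piEquivPiSubtypeProd, Equiv.piEquivPiSubtypeProd, hi, add_comm]

theorem measurePreserving_reindex {I J : Type*} [Fintype I] [Fintype J] (e : I ≃ J) :
    MeasurePreserving fun (x : I → Mom d) (j : J) => x (e.symm j) := by
  have : (fun (x : I → Mom d) (j : J) => x (e.symm j))
      = MeasurableEquiv.piCongrLeft (fun _ : J => Mom d) e := by
    funext x j
    obtain ⟨i, rfl⟩ := e.surjective j
    rw [MeasurableEquiv.piCongrLeft_apply_apply]
    simp
  rw [this]
  exact volume_measurePreserving_piCongrLeft (fun _ : J => Mom d) e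

/-- A parametrization of the fibres of `A` computes its delta measure. -/
theorem deltaMeasure_eq_map {ι N W : Type*} [Fintype ι] [AddCommGroup N] [Module ℝ N]
    [MeasureSpace N] [MeasurableAdd N] [SFinite (volume : Measure N)]
    [(volume : Measure N).IsAddRightInvariant]
    [NormedAddCommGroup W] [NormedSpace ℝ W] [FiniteDimensional ℝ W] [MeasureSpace W]
    [BorelSpace W] [(volume : Measure W).IsAddHaarMeasure]
    (A : W →ₗ[ℝ] (ι → Mom d)) (Φ : N × (ι → Mom d) →ₗ[ℝ] W)
    (hΦ : MeasurePreserving Φ) (hA : ∀ x y, A (Φ (x, y)) = y) (b : ι → Mom d) :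
    deltaMeasure A b = Measure.map (fun x => Φ (x, b)) volume := by
  classical
  have hsurj : Function.Surjective A := fun y => ⟨_, hA 0 y⟩
  -- A proper subspace is a null set, which a measure-preserving map cannot have as its range.
  have hr : LinearMap.range Φ = ⊤ := by
    by_contra h
    have h1 := Measure.addHaar_submodule (volume : Measure W) (LinearMap.range Φ) h
    have h2 : MeasurableSet (LinearMap.range Φ : Set W) :=
      (Submodule.closed_of_finiteDimensional (LinearMap.range Φ)).measurableSet
    have h3 := hΦ.measure_preimage h2.nullMeasurableSet
    have h4 : Φ ⁻¹' (LinearMap.range Φ : Set W) = Set.univ :=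
      Set.eq_univ_of_forall fun x => LinearMap.mem_range_self Φ x
    rw [h1, h4] at h3
    have h5 : (volume : Measure W) Set.univ = 0 := by
      rw [← hΦ.measure_preimage MeasurableSet.univ.nullMeasurableSet, Set.preimage_univ, h3]
    exact (NeZero.ne (volume : Measure W)) (Measure.measure_univ_eq_zero.1 h5)
  set s : (ι → Mom d) →ₗ[ℝ] W :=
      (A.exists_rightInverse_of_surjective (LinearMap.range_eq_top.2 hsurj)).choose with hs
  have hAs : ∀ y, A (s y) = y := fun y => LinearMap.congr_fun
    (A.exists_rightInverse_of_surjective (LinearMap.range_eq_top.2 hsurj)).choose_spec y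
  -- The chosen right inverse, read in the coordinates of `Φ`, has `z` itself as its second
  -- component. Moving to the fibre over `b` is then a translation in the first component, which is
  -- why the choice does not matter.
  have hσ : ∀ z, ∃ σ, s z = Φ (σ, z) := by
    intro z
    obtain ⟨⟨σ, z'⟩, h⟩ := LinearMap.range_eq_top.1 hr (s z)
    have h1 := hA σ z'
    rw [h, hAs] at h1
    exact ⟨σ, by rw [h1] at h ⊢; exact h.symm⟩
  choose σ hσ using hσ
  have cA : Measurable A := A.continuous_of_finiteDimensional.measurable
  have cs : Measurable s := s.continuous_of_finiteDimensional.measurable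
  have hQ : MeasurableSet (unitCube ι d) := measurableSet_unitCube ι d
  have hI : Measurable ((unitCube ι d).indicator (1 : (ι → Mom d) → ENNReal)) :=
    measurable_one.indicator hQ
  have m2 : Measurable fun x => Φ (x, b) := hΦ.measurable.comp (measurable_id.prodMk measurable_const)
  rw [deltaMeasure, dif_pos hsurj]
  refine Measure.ext_of_lintegral _ fun f hf => ?_
  simp only []
  rw [lintegral_map hf (by fun_prop), lintegral_map hf m2, ← lintegral_indicator (cA hQ)]
  have m1 : Measurable fun w => (unitCube ι d).indicator (1 : (ι → Mom d) → ENNReal) (A w)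
      * f (w - s (A w - b)) := (hI.comp cA).mul (hf.comp (by fun_prop))
  have e1 : ∀ w, (A ⁻¹' unitCube ι d).indicator (fun w => f (w - s (A w - b))) w
      = (unitCube ι d).indicator (1 : (ι → Mom d) → ENNReal) (A w) * f (w - s (A w - b)) := by
    intro w
    by_cases h : A w ∈ unitCube ι d <;> simp [Set.indicator, h]
  simp only [hs] at e1 ⊢
  rw [lintegral_congr e1, ← hΦ.lintegral_comp m1]
  have e2 : (volume : Measure (N × (ι → Mom d))) = volume.prod volume := rfl
  rw [e2]
  refine (lintegral_prod_symm' _ (m1.comp hΦ.measurable)).trans ?_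
  simp only [Function.comp_apply]
  have e3 : ∀ y, ∫⁻ x, (unitCube ι d).indicator (1 : (ι → Mom d) → ENNReal) (A (Φ (x, y)))
        * f (Φ (x, y) - s (A (Φ (x, y)) - b))
      = (unitCube ι d).indicator (1 : (ι → Mom d) → ENNReal) y * ∫⁻ x, f (Φ (x, b)) := by
    intro y
    simp only [hA]
    rw [lintegral_const_mul' _ _ (by by_cases h : y ∈ unitCube ι d <;> simp [h])]
    congr 1
    rw [← lintegral_sub_right_eq_self (fun x => f (Φ (x, b))) (σ (y - b))]
    congr 1; ext x; congr 1
    rw [hσ, ← map_sub, Prod.mk_sub_mk, sub_sub_cancel]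
  rw [lintegral_congr e3, lintegral_mul_const _ hI, lintegral_indicator_one hQ, volume_unitCube, one_mul]

end MeasurePreserving

end Feynman

/-! ### Independent momenta of a graph. -/

namespace Feynman

variable {d n n' : ℕ}

/-- The edge momenta determined by the momentum at the base point and by the increments at the
vertices. -/
def walk (ξ : Mom d) (x : Option (Site n n') → Mom d) : EdgeMom d n n'
  | Sum.inl i => x none + psum (fun k => x (some (Sum.inl k))) i
  | Sum.inr j => x none - ξ + psum (fun k => -x (some (Sum.inr k))) j

theorem walk_zeroOut (ξ : Mom d) (x : Option (Site n n') → Mom d) :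
    walk ξ x (zeroOut n n') = x none := by simp [walk, zeroOut, psum_zero_right]

theorem walk_zeroIn (ξ : Mom d) (x : Option (Site n n') → Mom d) :
    walk ξ x (zeroIn n n') = x none - ξ := by simp [walk, zeroIn, psum_zero_right]

theorem walk_edgeOut (ξ : Mom d) (x : Option (Site n n') → Mom d) (v : Site n n') :
    walk ξ x (edgeOut v) = walk ξ x (edgeIn v) + x (some v) := by
  rcases v with i | j
  · simp only [walk, edgeOut, edgeIn, psum_succ]; abel
  · simp only [walk, edgeOut, edgeIn, psum_succ]; abel

/-- Independent momenta for a graph: all increments except for one in each lump, together with the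
momentum at the base point. -/
structure IsChart {K : Type*} (P : Lumps n n') (ι : K → Option (Site n n')) : Prop where
  injective : Function.Injective ι
  base : ∃ k, ι k = none
  existsUnique : ∀ v, ∃! r, r ∈ P.part v ∧ ∀ k, ι k ≠ some r

/-- The increments as functions of the independent momenta. -/
structure IsParam {K : Type*} (P : Lumps n n') (ι : K → Option (Site n n'))
    (X : (K → Mom d) → Option (Site n n') → Mom d) : Prop where
  apply_chart : ∀ y k, X y (ι k) = y k
  sum_part : ∀ y v, ∑ r ∈ P.part v, X y (some r) = 0

/-- The edge whose momentum is moved to the increment at a vertex, respectively to the base point. -/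
def ownEdge : Option (Site n n') → Edge n n'
  | none => Sum.inl 0
  | some (Sum.inl i) => Sum.inl i.succ
  | some (Sum.inr j) => Sum.inr j.succ

theorem ownEdge_injective : Function.Injective (ownEdge (n := n) (n' := n')) := by
  rintro (_ | i | i) (_ | j | j) h <;> simp_all [ownEdge, Fin.succ_ne_zero, (Fin.succ_ne_zero _).symm]

theorem ownEdge_ne (o : Option (Site n n')) : ownEdge o ≠ Sum.inr 0 := by
  rcases o with _ | i | j <;> simp [ownEdge, Fin.succ_ne_zero]

theorem eq_ownEdge (e : Edge n n') : e = Sum.inr 0 ∨ ∃ o, e = ownEdge o := by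
  rcases e with i | j
  · refine Or.inr (Fin.cases ⟨none, rfl⟩ (fun k => ⟨some (Sum.inl k), rfl⟩) i)
  · refine Fin.cases (Or.inl rfl) (fun k => Or.inr ⟨some (Sum.inr k), rfl⟩) j

/-- Conservation in all lumps forces conservation on the whole circle, so that the jump at `0`
matches the prescribed one at `0*`. -/
theorem sum_eq_zero_of_part {A : Type*} [AddCommGroup A] (P : Lumps n n') {x : Site n n' → A}
    (h : ∀ v, ∑ r ∈ P.part v, x r = 0) : ∑ v, x v = 0 := by
  rw [← P.biUnion_parts, Finset.sum_biUnion P.disjoint]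
  refine Finset.sum_eq_zero fun μ hμ => ?_
  obtain ⟨v, hv⟩ := P.nonempty_of_mem_parts hμ
  rw [← P.part_eq_of_mem hμ hv]
  exact h v

section Chart

variable {K : Type*} [Fintype K] {P : Lumps n n'} {ι : K → Option (Site n n')}

open Classical in
/-- The increments for given independent momenta and given net momenta of the lumps. -/
def fullInc (P : Lumps n n') (ι : K → Option (Site n n')) (y : K → Mom d) (u : Option P.parts → Mom d)
    (o : Option (Site n n')) : Mom d :=
  Function.extend ι y 0 o + if o ∈ Set.range ι then 0 else
    match o with
    | none => 0
    | some v => u (some ⟨P.part v, P.part_mem.2 (Finset.mem_univ v)⟩)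
        - ∑ r ∈ P.part v, Function.extend ι y 0 (some r)

/-- In each lump exactly one vertex is not a coordinate, and its increment absorbs the remainder. -/
theorem sum_fullInc (h : IsChart P ι) (y : K → Mom d) (u : Option P.parts → Mom d) (μ : P.parts) :
    ∑ v ∈ μ.1, fullInc P ι y u (some v) = u (some μ) := by
  obtain ⟨v, hv⟩ := P.nonempty_of_mem_parts μ.2
  have hpart : ∀ r ∈ μ.1, P.part r = μ.1 := fun r hr => P.part_eq_of_mem μ.2 hr
  obtain ⟨r, ⟨hr, hr'⟩, hu⟩ := h.existsUnique v
  rw [hpart v hv] at hr hu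
  simp only [fullInc]
  rw [Finset.sum_add_distrib, Finset.sum_eq_single_of_mem r hr (f := fun v => ite _ _ _)]
  · rw [if_neg (by rintro ⟨k, hk⟩; exact hr' k hk)]
    have : (⟨P.part r, P.part_mem.2 (Finset.mem_univ r)⟩ : P.parts) = μ := Subtype.ext (hpart r hr)
    rw [this, hpart r hr]
    abel
  · intro b hb hbr
    rw [if_pos]
    by_contra hk
    exact hbr (hu b ⟨hb, fun k hk' => hk ⟨k, hk'⟩⟩)

/-- The edge momenta for given independent momenta and given values of the constraints. -/
def chartMap (P : Lumps n n') (ι : K → Option (Site n n')) :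
    (K → Mom d) × (Option P.parts → Mom d) →ₗ[ℝ] EdgeMom d n n' where
  -- The jump at `0` is the one for which the net momentum at `0*` equals `q.2 none`, given the sum
  -- of all increments.
  toFun q := walk (-(q.2 none + ∑ v, fullInc P ι q.1 q.2 (some v))) (fullInc P ι q.1 q.2)
  map_add' q q' := by
    have e1 : ∀ o, Function.extend ι (q.1 + q'.1) 0 o
        = Function.extend ι q.1 0 o + Function.extend ι q'.1 0 o := by
      intro o
      have := congrFun (Function.extend_add ι q.1 q'.1 0 0) o
      simpa using this
    have e : ∀ o, fullInc P ι (q + q').1 (q + q').2 o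
        = fullInc P ι q.1 q.2 o + fullInc P ι q'.1 q'.2 o := by
      intro o
      simp only [fullInc, Prod.fst_add, Prod.snd_add, e1]
      split_ifs
      · simp
      · rcases o with _ | v
        · simp
        · simp only [Finset.sum_add_distrib, Pi.add_apply]; abel
    ext1 (i | j)
    · simp only [walk, e, psum_add, Pi.add_apply]; abel
    · simp only [walk, e, psum_neg, psum_add, Pi.add_apply, Finset.sum_add_distrib]
      simp only [Prod.snd_add, Pi.add_apply]; abel
  map_smul' c q := by
    have e1 : ∀ o, Function.extend ι (c • q.1) 0 o = c • Function.extend ι q.1 0 o := by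
      intro o
      have := congrFun (Function.extend_smul c ι q.1 0) o
      simpa using this
    have e : ∀ o, fullInc P ι (c • q).1 (c • q).2 o = c • fullInc P ι q.1 q.2 o := by
      intro o
      simp only [fullInc, Prod.smul_fst, Prod.smul_snd, e1]
      split_ifs
      · simp
      · rcases o with _ | v
        · simp
        · simp only [Finset.smul_sum, Pi.smul_apply, smul_add, smul_sub]
    ext1 (i | j)
    · simp only [walk, e, psum_smul, Pi.smul_apply, smul_add, RingHom.id_apply]
    · simp only [walk, e, psum_neg, psum_smul, Pi.smul_apply, ← Finset.smul_sum, RingHom.id_apply]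
      simp only [Prod.smul_snd, Pi.smul_apply, smul_add, smul_sub, smul_neg]

theorem constraint_chartMap (h : IsChart P ι) (y : K → Mom d) (u : Option P.parts → Mom d) :
    constraint d P (chartMap P ι (y, u)) = u := by
  ext1 o
  rcases o with _ | μ
  · change netMomentum d {Vertex.zeroStar} _ = _
    rw [netMomentum_zeroStar]
    simp only [chartMap, LinearMap.coe_mk, AddHom.coe_mk, starOut, starIn, walk, psum_last,
      Fintype.sum_sum_type, Finset.sum_neg_distrib]
    abel
  · change netMomentum d (Vertex.site '' (μ.1 : Set (Site n n'))) _ = _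
    rw [netMomentum_site, ← sum_fullInc h y u μ]
    refine Finset.sum_congr rfl fun v _ => ?_
    simp only [chartMap, LinearMap.coe_mk, AddHom.coe_mk]
    rw [walk_edgeOut, add_sub_cancel_left]

/-- On each arc the edge momenta are partial sums of the coordinates, with reversed signs on the
second arc except for its starting momentum. -/
theorem measurePreserving_arcs : MeasurePreserving (fun (c : EdgeMom d n n') =>
    (walk (n := n) (n' := n') (c (Sum.inl 0) - c (Sum.inr 0)) fun o => c (ownEdge o))) := by
  have h1 := volume_measurePreserving_sumPiEquivProdPi (fun _ : Edge n n' => Mom d)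
  have h2 : MeasurePreserving (fun (x : Fin (n' + 1) → Mom d) i => (if i = 0 then id else Neg.neg) (x i)) :=
    volume_preserving_pi fun i => by
      split_ifs
      · exact MeasurePreserving.id _
      · exact Measure.measurePreserving_neg _
  have h3 := h1.symm.comp (((measurePreserving_psum (n + 1)).prod
    ((measurePreserving_psum (n' + 1)).comp h2)).comp h1)
  have e : (fun (c : EdgeMom d n n') =>
      (walk (n := n) (n' := n') (c (Sum.inl 0) - c (Sum.inr 0)) fun o => c (ownEdge o)))
      = (MeasurableEquiv.sumPiEquivProdPi (fun _ : Edge n n' => Mom d)).symm ∘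
        (Prod.map (fun (x : Fin (n + 1) → Mom d) (i : Fin (n + 1)) => psum x i.succ)
          ((fun (x : Fin (n' + 1) → Mom d) (i : Fin (n' + 1)) => psum x i.succ) ∘
            fun (x : Fin (n' + 1) → Mom d) i => (if i = 0 then id else Neg.neg) (x i))) ∘
        MeasurableEquiv.sumPiEquivProdPi (fun _ : Edge n n' => Mom d) := by
    funext c e
    rcases e with i | j
    · simp [walk, ownEdge, MeasurableEquiv.sumPiEquivProdPi, psum_succ_cons]
    · simp [walk, ownEdge, MeasurableEquiv.sumPiEquivProdPi, psum_succ_cons, Fin.succ_ne_zero]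
  rw [e]
  exact h3

open Classical in
-- Every edge but the one into `0` is owned by a vertex or by the base point. The vertices that are
-- not coordinates correspond to the lumps, one for each, and the edge into `0` is left for the
-- constraint at `0*`.
theorem IsChart.exists_reindex (h : IsChart P ι) : ∃ e : K ⊕ Option P.parts ≃ Edge n n',
    (∀ k, e (Sum.inl k) = ownEdge (ι k)) ∧ e (Sum.inr none) = Sum.inr 0 ∧
    ∀ v, some v ∉ Set.range ι →
      e (Sum.inr (some ⟨P.part v, P.part_mem.2 (Finset.mem_univ v)⟩)) = ownEdge (some v) := by
  choose r hr hu using h.existsUnique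
  choose a ha using fun μ : P.parts => P.nonempty_of_mem_parts μ.2
  have hpa : ∀ μ : P.parts, P.part (a μ) = μ.1 := fun μ => P.part_eq_of_mem μ.2 (ha μ)
  let f : K ⊕ Option P.parts → Edge n n' := Sum.elim (fun k => ownEdge (ι k))
    fun o => o.elim (Sum.inr 0) fun μ => ownEdge (some (r (a μ)))
  have key : ∀ v, some v ∉ Set.range ι → ∀ μ : P.parts, μ.1 = P.part v → r (a μ) = v := by
    intro v hv μ hμ
    refine (hu (a μ) v ⟨?_, fun k hk => hv ⟨k, hk⟩⟩).symm
    rw [hpa, hμ]; exact P.mem_part (Finset.mem_univ v)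
  have hf : Function.Bijective f := by
    constructor
    · rintro (k | _ | μ) (k' | _ | μ') hkk
      · rw [h.injective (ownEdge_injective hkk)]
      · exact absurd hkk (ownEdge_ne _)
      · exact absurd (ownEdge_injective hkk) ((hr (a μ')).2 k)
      · exact absurd hkk.symm (ownEdge_ne _)
      · rfl
      · exact absurd hkk.symm (ownEdge_ne _)
      · exact absurd (ownEdge_injective hkk).symm ((hr (a μ)).2 k')
      · exact absurd hkk (ownEdge_ne _)
      · have h1 := Option.some_injective _ (ownEdge_injective hkk)
        have h2 := (hr (a μ)).1
        have h3 := (hr (a μ')).1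
        rw [hpa] at h2 h3
        rw [h1] at h2
        rw [Subtype.ext (P.eq_of_mem_parts μ.2 μ'.2 h2 h3)]
    · intro e
      rcases eq_ownEdge e with rfl | ⟨o, rfl⟩
      · exact ⟨Sum.inr none, rfl⟩
      · by_cases ho : o ∈ Set.range ι
        · obtain ⟨k, rfl⟩ := ho
          exact ⟨Sum.inl k, rfl⟩
        · rcases o with _ | v
          · exact absurd h.base ho
          · refine ⟨Sum.inr (some ⟨P.part v, P.part_mem.2 (Finset.mem_univ v)⟩), ?_⟩
            change ownEdge (some (r (a _))) = _
            rw [key v ho _ rfl]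
  refine ⟨Equiv.ofBijective f hf, fun k => rfl, rfl, fun v hv => ?_⟩
  change ownEdge (some (r (a _))) = _
  rw [key v hv _ rfl]

open Classical in
-- The map is a reindexing, followed by two shears and by the partial sums along the arcs, each of
-- which preserves volume.
theorem IsChart.measurePreserving_chartMap (h : IsChart P ι) :
    MeasurePreserving (chartMap (d := d) P ι) := by
  obtain ⟨e, he1, he2, he3⟩ := h.exists_reindex
  have r1 := (measurePreserving_reindex (d := d) e).comp
    (volume_measurePreserving_sumPiEquivProdPi_symm (fun _ : K ⊕ Option P.parts => Mom d))
  -- First shear: a dependent increment is corrected by the independent ones of its lump.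
  let N₁ : EdgeMom d n n' → EdgeMom d n n' := fun c e =>
    if h : ∃ v, e = ownEdge (some v) ∧ some v ∉ Set.range ι then
      -∑ r ∈ P.part h.choose, if some r ∈ Set.range ι then c (ownEdge (some r)) else 0
    else 0
  have hN₁ : ∀ c v, N₁ c (ownEdge (some v)) = if some v ∈ Set.range ι then 0 else
      -∑ r ∈ P.part v, if some r ∈ Set.range ι then c (ownEdge (some r)) else 0 := by
    intro c v
    by_cases hv : some v ∈ Set.range ι
    · rw [if_pos hv]
      refine dif_neg ?_
      rintro ⟨v', h1, h2⟩
      rw [ownEdge_injective h1] at hv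
      exact h2 hv
    · rw [if_neg hv]
      have hex : ∃ v', ownEdge (some v) = ownEdge (some v') ∧ some v' ∉ Set.range ι := ⟨v, rfl, hv⟩
      have h1 := Option.some_injective _ (ownEdge_injective hex.choose_spec.1)
      change (if h : ∃ v', ownEdge (some v) = ownEdge (some v') ∧ some v' ∉ Set.range ι then
        -∑ r ∈ P.part h.choose, if some r ∈ Set.range ι then c (ownEdge (some r)) else 0
          else 0) = _
      rw [dif_pos hex, ← h1]
  have s1 : MeasurePreserving fun c : EdgeMom d n n' => c + N₁ c := by
    refine measurePreserving_shear {e | ¬∃ v, e = ownEdge (some v) ∧ some v ∉ Set.range ι} N₁ ?_ ?_ ?_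
    · refine measurable_pi_iff.2 fun e => ?_
      simp only [N₁]
      split_ifs
      · refine (Finset.measurable_sum _ fun r _ => ?_).neg
        split_ifs
        · exact measurable_pi_apply _
        · exact measurable_const
      · exact measurable_const
    · intro c e he
      exact dif_neg he
    · intro c c' hcc
      funext e
      by_cases hex : ∃ v, e = ownEdge (some v) ∧ some v ∉ Set.range ι
      · obtain ⟨v, rfl, hv⟩ := hex
        rw [hN₁, hN₁, if_neg hv, if_neg hv]
        congr 1
        refine Finset.sum_congr rfl fun r _ => ?_
        split_ifs with hr
        · refine hcc _ ?_
          rintro ⟨v', h1, h2⟩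
          rw [ownEdge_injective h1] at hr
          exact h2 hr
        · rfl
      · have h1 : N₁ c e = 0 := dif_neg hex
        have h2 : N₁ c' e = 0 := dif_neg hex
        rw [h1, h2]
  -- Second shear: the value of the constraint at `0*` becomes the momentum into `0`.
  let N₂ : EdgeMom d n n' → EdgeMom d n n' := fun c e =>
    if e = Sum.inr 0 then c (ownEdge none) + ∑ v, c (ownEdge (some v)) else 0
  have s2 : MeasurePreserving fun c : EdgeMom d n n' => c + N₂ c := by
    refine measurePreserving_shear {e | e ≠ Sum.inr 0} N₂ ?_ (fun c e he => if_neg he) ?_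
    · refine measurable_pi_iff.2 fun e => ?_
      simp only [N₂]
      split_ifs
      · exact (measurable_pi_apply _).add (Finset.measurable_sum _ fun r _ => measurable_pi_apply _)
      · exact measurable_const
    · intro c c' hcc
      funext e
      simp only [N₂]
      split_ifs
      · rw [hcc _ (ownEdge_ne _), Finset.sum_congr rfl fun v _ => hcc _ (ownEdge_ne _)]
      · rfl
  have H := measurePreserving_arcs.comp (s2.comp (s1.comp r1))
  refine (?_ : ⇑(chartMap (d := d) P ι) = _) ▸ H
  funext ⟨y, u⟩
  set c₀ : EdgeMom d n n' := ((fun (x : K ⊕ Option P.parts → Mom d) (j : Edge n n') => x (e.symm j)) ∘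
    (MeasurableEquiv.sumPiEquivProdPi (fun _ : K ⊕ Option P.parts => Mom d)).symm) (y, u) with hc₀
  have c1 : ∀ k, c₀ (ownEdge (ι k)) = y k := by
    intro k
    rw [← he1, hc₀]; simp [MeasurableEquiv.sumPiEquivProdPi]
  have c2 : c₀ (Sum.inr 0) = u none := by
    rw [← he2, hc₀]; simp [MeasurableEquiv.sumPiEquivProdPi]
  have c3 : ∀ v, some v ∉ Set.range ι →
      c₀ (ownEdge (some v)) = u (some ⟨P.part v, P.part_mem.2 (Finset.mem_univ v)⟩) := by
    intro v hv
    rw [← he3 v hv, hc₀]; simp [MeasurableEquiv.sumPiEquivProdPi]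
  have c4 : ∀ o, (if o ∈ Set.range ι then c₀ (ownEdge o) else 0) = Function.extend ι y 0 o := by
    intro o
    split_ifs with ho
    · obtain ⟨k, rfl⟩ := ho
      rw [c1, h.injective.extend_apply]
    · rw [Function.extend_apply' _ _ _ ho]; rfl
  have d1 : ∀ o, (c₀ + N₁ c₀) (ownEdge o) = fullInc P ι y u o := by
    intro o
    rw [Pi.add_apply]
    unfold fullInc
    by_cases ho : o ∈ Set.range ι
    · rw [if_pos ho, ← c4, if_pos ho]
      rcases o with _ | v
      · congr 1
        refine dif_neg ?_
        rintro ⟨v', h1, h2⟩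
        exact absurd (ownEdge_injective h1) (by simp)
      · rw [hN₁, if_pos ho]
    · rcases o with _ | v
      · exact absurd h.base ho
      · rw [if_neg ho, ← c4, if_neg ho, hN₁, if_neg ho, c3 v ho, zero_add]
        simp only [c4, sub_eq_add_neg]
  have d2 : (c₀ + N₁ c₀) (Sum.inr 0) = u none := by
    rw [Pi.add_apply, c2]
    have : N₁ c₀ (Sum.inr 0) = 0 := by
      refine dif_neg ?_
      rintro ⟨v', h1, h2⟩
      exact ownEdge_ne _ h1.symm
    rw [this, add_zero]
  set c₁ := c₀ + N₁ c₀
  have f1 : ∀ o, (c₁ + N₂ c₁) (ownEdge o) = fullInc P ι y u o := by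
    intro o
    rw [Pi.add_apply, d1]
    simp [N₂, ownEdge_ne]
  have f2 : (c₁ + N₂ c₁) (Sum.inr 0) = u none + (fullInc P ι y u none + ∑ v, fullInc P ι y u (some v)) := by
    rw [Pi.add_apply, d2]
    simp [N₂, d1]
  change _ = walk ((c₁ + N₂ c₁) (ownEdge none) - (c₁ + N₂ c₁) (Sum.inr 0)) fun o => (c₁ + N₂ c₁) (ownEdge o)
  simp only [f1, f2, chartMap, LinearMap.coe_mk, AddHom.coe_mk]
  congr 1
  abel

open Classical in
/-- Integration over the independent momenta. -/
theorem IsChart.graphMeasure_eq (h : IsChart P ι) {X : (K → Mom d) → Option (Site n n') → Mom d}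
    (hX : IsParam P ι X) (ξ : Mom d) :
    graphMeasure ξ P (fun _ => 0) = Measure.map (fun y => walk ξ (X y)) volume := by
  rw [graphMeasure, deltaMeasure_eq_map (constraint d P) (chartMap P ι) h.measurePreserving_chartMap
    (constraint_chartMap h)]
  congr 1
  funext y
  set b : Option P.parts → Mom d := fun o => match o with
      | none => -ξ
      | some μ => 0 with hb
  have e : ∀ o, fullInc P ι y b o = X y o := by
    intro o
    unfold fullInc
    by_cases ho : o ∈ Set.range ι
    · obtain ⟨k, rfl⟩ := ho
      rw [if_pos ⟨k, rfl⟩, h.injective.extend_apply, hX.apply_chart, add_zero]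
    · rcases o with _ | v
      · exact absurd h.base ho
      · rw [if_neg ho, Function.extend_apply' _ _ _ ho]
        obtain ⟨r, hr, hu⟩ := h.existsUnique v
        have hv := P.mem_part (Finset.mem_univ v)
        -- At a dependent vertex, conservation in the lump determines the increment; all other
        -- vertices of the lump are coordinates.
        have h1 : X y (some v) = -∑ r ∈ (P.part v).erase v, X y (some r) := by
          have h2 := Finset.add_sum_erase (P.part v) (fun r => X y (some r)) hv
          rw [hX.sum_part] at h2
          exact eq_neg_of_add_eq_zero_left h2
        have h2 := Finset.add_sum_erase (P.part v) (fun r => Function.extend ι y 0 (some r)) hv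
        simp only [Function.extend_apply' (f := ι) y 0 (some v) ho] at h2
        simp only [h1, ← h2, hb, Pi.zero_apply, zero_add, zero_sub]
        congr 1
        refine Finset.sum_congr rfl fun s hs => ?_
        obtain ⟨k, hk⟩ : some s ∈ Set.range ι := by
          by_contra hk
          have h2 := hu s ⟨Finset.mem_of_mem_erase hs, fun k hk' => hk ⟨k, hk'⟩⟩
          have h3 := hu v ⟨hv, fun k hk' => ho ⟨k, hk'⟩⟩
          exact Finset.ne_of_mem_erase hs (h2.trans h3.symm)
        rw [← hk, h.injective.extend_apply, hX.apply_chart]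
  change walk (-(b none + ∑ v, fullInc P ι y b (some v))) (fullInc P ι y b) = _
  have e' : fullInc P ι y b = X y := funext e
  rw [e', sum_eq_zero_of_part P (hX.sum_part y)]
  simp [hb]

end Chart

end Feynman

namespace Feynman

/-! ### Words with blocks inserted between their letters. -/

section Words

variable {α β : Type*}

/-- The word with the given letters, and with the given blocks between them. -/
def word {m : ℕ} (s : Fin m → α) (b : Fin (m + 1) → List α) : List α :=
  ((List.finRange m).flatMap fun i => b i.castSucc ++ [s i]) ++ b (Fin.last m)

theorem word_zero (s : Fin 0 → α) (b : Fin 1 → List α) : word s b = b 0 := rfl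

theorem word_succ {m : ℕ} (s : Fin (m + 1) → α) (b : Fin (m + 2) → List α) :
    word s b = b 0 ++ s 0 :: word (fun i => s i.succ) fun i => b i.succ := by
  simp [word, List.finRange_succ, List.flatMap_map, ← Fin.castSucc_succ, ← Fin.succ_last]

theorem map_word (f : α → β) {m : ℕ} (s : Fin m → α) (b : Fin (m + 1) → List α) :
    (word s b).map f = word (fun i => f (s i)) fun i => (b i).map f := by
  simp [word, List.map_flatMap]

theorem mem_word {m : ℕ} {s : Fin m → α} {b : Fin (m + 1) → List α} {a : α} :
    a ∈ word s b ↔ (∃ i, a = s i) ∨ ∃ i, a ∈ b i := by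
  induction m with
  | zero =>
    rw [word_zero]
    refine ⟨fun h => Or.inr ⟨0, h⟩, fun h => h.elim (fun ⟨i, _⟩ => i.elim0) fun ⟨i, h⟩ => ?_⟩
    obtain rfl : i = 0 := Fin.ext (by omega)
    exact h
  | succ m ih =>
    rw [word_succ, List.mem_append, List.mem_cons, ih, @Fin.exists_fin_succ m fun i => a = s i,
      @Fin.exists_fin_succ (m + 1) fun i => a ∈ b i]
    tauto

theorem nodup_word {m : ℕ} {s : Fin m → α} {b : Fin (m + 1) → List α} (hs : Function.Injective s)
    (hb : ∀ i, (b i).Nodup) (hsb : ∀ i j, s i ∉ b j) (hbb : ∀ i j, i ≠ j → (b i).Disjoint (b j)) :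
    (word s b).Nodup := by
  induction m with
  | zero => exact hb 0
  | succ m ih =>
    rw [word_succ, List.nodup_append', List.nodup_cons]
    refine ⟨hb 0, ⟨?_, ih (fun i j h => Fin.succ_injective _ (hs h)) (fun i => hb _) (fun i j => hsb _ _)
      fun i j h => hbb _ _ fun h' => h (Fin.succ_injective _ h')⟩, ?_⟩
    · rw [mem_word]
      rintro (⟨i, hi⟩ | ⟨i, hi⟩)
      · exact Fin.succ_ne_zero i (hs hi).symm
      · exact hsb _ _ hi
    · intro a ha ha'
      rw [List.mem_cons, mem_word] at ha'
      rcases ha' with rfl | ⟨i, rfl⟩ | ⟨i, hi⟩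
      · exact hsb _ _ ha
      · exact hsb _ _ ha
      · exact hbb _ _ (Fin.succ_ne_zero i).symm ha hi

theorem sum_word {A : Type*} [AddCommGroup A] {m : ℕ} (s : Fin m → A) (b : Fin (m + 1) → List A)
    (hb : ∀ i, (b i).sum = 0) : (word s b).sum = ∑ i, s i := by
  induction m with
  | zero => simpa [word_zero] using hb 0
  | succ m ih =>
    rw [word_succ, List.sum_append, List.sum_cons, ih _ _ fun i => hb _, hb, zero_add,
      Fin.sum_univ_succ]

end Words

/-! ### Products of edge and vertex factors along an arc. -/

section Arcs

variable {A R : Type*} [AddCommGroup A] [CommRing R]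

/-- The product of the factors of the edges and vertices along an arc that starts with momentum `p`
and has the given vertices, each with a flag and with its increment of the momentum. -/
def arcProd (F Fl : A → R) (G : Bool → A → A → R) : A → List (Bool × A) → R
  | p, [] => Fl p
  | p, a :: l => F p * G a.1 p (p + a.2) * arcProd F Fl G (p + a.2) l

variable {F Fl : A → R} {G : Bool → A → A → R}

theorem arcProd_ofFn {m : ℕ} (s : Fin m → Bool × A) (p : A) :
    arcProd F Fl G p (List.ofFn s)
      = (∏ i : Fin m, F (p + psum (fun k => (s k).2) i.castSucc))
        * Fl (p + psum (fun k => (s k).2) (Fin.last m))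
        * ∏ i : Fin m, G (s i).1 (p + psum (fun k => (s k).2) i.castSucc)
            (p + psum (fun k => (s k).2) i.succ) := by
  induction m generalizing p with
  | zero => simp [arcProd, psum]
  | succ m ih =>
    rw [List.ofFn_succ, arcProd, ih, Fin.prod_univ_succ, Fin.prod_univ_succ (n := m)
      (f := fun i : Fin (m + 1) => G (s i).1 _ _)]
    simp only [psum_succ_cons, ← Fin.succ_last, Fin.castSucc_succ, Fin.castSucc_zero, psum_zero_right,
      add_zero, add_assoc]
    ring

/-- A block that returns to the momentum at which it starts only multiplies the rest of the arc by a
factor depending on this momentum; such factors can be pulled out one after another. -/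
theorem arcProd_word {m : ℕ} (s : Fin m → Bool × A) (b : Fin (m + 1) → List (Bool × A))
    (W : Fin (m + 1) → A → R) (hb : ∀ i q l, arcProd F Fl G q (b i ++ l) = W i q * arcProd F Fl G q l)
    (p : A) :
    arcProd F Fl G p (word s b)
      = (∏ i, W i (p + psum (fun k => (s k).2) i)) * arcProd F Fl G p (List.ofFn s) := by
  induction m generalizing p with
  | zero =>
    have := hb 0 p []
    rw [List.append_nil] at this
    rw [word_zero, this]
    simp [psum]
  | succ m ih =>
    rw [word_succ, hb, arcProd, ih _ _ (fun i => W i.succ) fun i => hb _, List.ofFn_succ, arcProd,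
      Fin.prod_univ_succ (f := fun i : Fin (m + 2) => W i (p + psum (fun k => (s k).2) i))]
    simp only [psum_succ_cons, psum_zero_right, add_zero, add_assoc]
    ring

theorem arcProd_flatMap {γ : Type*} (L : List γ) (b : γ → List (Bool × A)) (W : γ → A → R)
    (hb : ∀ k q l, arcProd F Fl G q (b k ++ l) = W k q * arcProd F Fl G q l) (q : A)
    (l : List (Bool × A)) :
    arcProd F Fl G q (L.flatMap b ++ l) = (L.map fun k => W k q).prod * arcProd F Fl G q l := by
  induction L with
  | nil => simp
  | cons k L ih => rw [List.flatMap_cons, List.append_assoc, hb, ih, List.map_cons, List.prod_cons, mul_assoc]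

end Arcs

/-! ### Labels for the vertices of the extended graph. -/

section Annotated

variable {n n' : ℕ} {υ : Edge n n' → ℕ}

/-- The vertices of the extended graph; the two vertices of a gate are distinguished by a flag. -/
abbrev Label {n n' : ℕ} (υ : Edge n n' → ℕ) := Site n n' ⊕ (Slot υ × Bool)

/-- The labels of the insertion in a slot. -/
def slotLabels (S : Slot υ → Insert) (k : Slot υ) : List (Label υ) :=
  match S k with
  | Insert.gate => [Sum.inr (k, false), Sum.inr (k, true)]
  | Insert.theta => [Sum.inr (k, false)]

/-- The labels inserted on an edge. -/
def labelsAt (S : Slot υ → Insert) (e : Edge n n') : List (Label υ) :=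
  (List.finRange (υ e)).flatMap fun k => slotLabels S ⟨e, k⟩

/-- The labels on the first arc. -/
def leftLabels (S : Slot υ → Insert) : List (Label υ) :=
  word (fun i => Sum.inl (Sum.inl i)) fun i => labelsAt S (Sum.inl i)

/-- The labels on the second arc. -/
def rightLabels (S : Slot υ → Insert) : List (Label υ) :=
  word (fun j => Sum.inl (Sum.inr j)) fun j => labelsAt S (Sum.inr j)

/-- The letter of a label. -/
def Label.letter : Label υ → Letter υ := Sum.map id Prod.fst

theorem map_letter_labelsAt (S : Slot υ → Insert) (e : Edge n n') :
    (labelsAt S e).map Label.letter = insertedAt S e := by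
  rw [labelsAt, List.map_flatMap, insertedAt]
  congr 1
  funext k
  rw [slotLabels]
  cases S ⟨e, k⟩ <;> rfl

theorem map_letter_leftLabels (S : Slot υ → Insert) :
    (leftLabels S).map Label.letter = leftWord S := by
  rw [leftLabels, map_word]
  simp only [map_letter_labelsAt]
  rfl

theorem map_letter_rightLabels (S : Slot υ → Insert) :
    (rightLabels S).map Label.letter = rightWord S := by
  rw [rightLabels, map_word]
  simp only [map_letter_labelsAt]
  rfl

theorem length_leftLabels (S : Slot υ → Insert) : (leftLabels S).length = (leftWord S).length := by
  rw [← map_letter_leftLabels, List.length_map]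

theorem length_rightLabels (S : Slot υ → Insert) : (rightLabels S).length = (rightWord S).length := by
  rw [← map_letter_rightLabels, List.length_map]

/-- The label of a vertex of the extended graph. -/
def label (S : Slot υ → Insert) : Site (leftWord S).length (rightWord S).length → Label υ
  | Sum.inl i => (leftLabels S)[i.1]'(by rw [length_leftLabels]; exact i.2)
  | Sum.inr j => (rightLabels S)[j.1]'(by rw [length_rightLabels]; exact j.2)

theorem ofFn_label_left (S : Slot υ → Insert) : List.ofFn (fun i => label S (Sum.inl i)) = leftLabels S :=
  List.ext_getElem (by simp [length_leftLabels]) fun i h1 h2 => by simp [label]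

theorem ofFn_label_right (S : Slot υ → Insert) : List.ofFn (fun i => label S (Sum.inr i)) = rightLabels S :=
  List.ext_getElem (by simp [length_rightLabels]) fun i h1 h2 => by simp [label]

theorem letter_label (S : Slot υ → Insert) (v : Site (leftWord S).length (rightWord S).length) :
    (label S v).letter = Sum.elim (leftWord S).get (rightWord S).get v := by
  rcases v with i | j
  · exact (List.getElem_map Label.letter (h := by simp [length_leftLabels])).symm.trans
      (List.getElem_of_eq (map_letter_leftLabels S) _)
  · exact (List.getElem_map Label.letter (h := by simp [length_rightLabels])).symm.trans
      (List.getElem_of_eq (map_letter_rightLabels S) _)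

theorem mem_slotLabels {S : Slot υ → Insert} {k : Slot υ} {a : Label υ} :
    a ∈ slotLabels S k ↔ a = Sum.inr (k, false) ∨ (a = Sum.inr (k, true) ∧ S k = Insert.gate) := by
  rw [slotLabels]
  cases S k <;> simp

theorem mem_labelsAt {S : Slot υ → Insert} {e : Edge n n'} {a : Label υ} :
    a ∈ labelsAt S e ↔ ∃ k : Slot υ, k.1 = e ∧
      (a = Sum.inr (k, false) ∨ (a = Sum.inr (k, true) ∧ S k = Insert.gate)) := by
  simp only [labelsAt, List.mem_flatMap, List.mem_finRange, true_and, mem_slotLabels]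
  constructor
  · rintro ⟨k, h⟩; exact ⟨⟨e, k⟩, rfl, h⟩
  · rintro ⟨⟨e, k⟩, rfl, h⟩; exact ⟨k, h⟩

theorem nodup_labelsAt (S : Slot υ → Insert) (e : Edge n n') : (labelsAt S e).Nodup := by
  rw [labelsAt, List.nodup_flatMap]
  refine ⟨fun k _ => ?_, ?_⟩
  · rw [slotLabels]
    cases S ⟨e, k⟩ <;> simp
  · refine (List.nodup_finRange (υ e)).imp fun {k k'} hk a ha ha' => ?_
    rw [mem_slotLabels] at ha ha'
    apply hk
    have : (⟨e, k⟩ : Slot υ) = ⟨e, k'⟩ := by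
      rcases ha with rfl | ⟨rfl, _⟩ <;> rcases ha' with h | ⟨h, _⟩ <;> simp_all
    simpa using this

theorem disjoint_labelsAt (S : Slot υ → Insert) {e e' : Edge n n'} (h : e ≠ e') :
    (labelsAt S e).Disjoint (labelsAt S e') := by
  intro a ha ha'
  rw [mem_labelsAt] at ha ha'
  obtain ⟨k, rfl, hk⟩ := ha
  obtain ⟨k', rfl, hk'⟩ := ha'
  apply h
  rcases hk with rfl | ⟨rfl, _⟩ <;> rcases hk' with h | ⟨h, _⟩ <;> simp_all

theorem inl_notMem_labelsAt (S : Slot υ → Insert) (v : Site n n') (e : Edge n n') :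
    Sum.inl v ∉ labelsAt S e := by
  rw [mem_labelsAt]
  rintro ⟨k, _, h | ⟨h, _⟩⟩ <;> simp at h

theorem nodup_leftLabels (S : Slot υ → Insert) : (leftLabels S).Nodup :=
  nodup_word (fun i j h => by simpa using h) (fun i => nodup_labelsAt S _)
    (fun i j => inl_notMem_labelsAt S _ _) fun i j h => disjoint_labelsAt S (by simpa using h)

theorem nodup_rightLabels (S : Slot υ → Insert) : (rightLabels S).Nodup :=
  nodup_word (fun i j h => by simpa using h) (fun i => nodup_labelsAt S _)
    (fun i j => inl_notMem_labelsAt S _ _) fun i j h => disjoint_labelsAt S (by simpa using h)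

theorem disjoint_leftLabels_rightLabels (S : Slot υ → Insert) :
    (leftLabels S).Disjoint (rightLabels S) := by
  intro a ha ha'
  rw [leftLabels, mem_word] at ha
  rw [rightLabels, mem_word] at ha'
  rcases ha with ⟨i, rfl⟩ | ⟨i, hi⟩ <;> rcases ha' with ⟨j, hj⟩ | ⟨j, hj⟩
  · simp at hj
  · exact inl_notMem_labelsAt S _ _ hj
  · rw [hj] at hi; exact inl_notMem_labelsAt S _ _ hi
  · exact disjoint_labelsAt S (by simp) hi hj

theorem label_inl_mem (S : Slot υ → Insert) (i : Fin (leftWord S).length) :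
    label S (Sum.inl i) ∈ leftLabels S := List.getElem_mem _

theorem label_inr_mem (S : Slot υ → Insert) (j : Fin (rightWord S).length) :
    label S (Sum.inr j) ∈ rightLabels S := List.getElem_mem _

/-- The flag separates the two vertices of a gate, which share a letter; vertices of the extended
graph can thus be identified through their labels instead of their positions. -/
theorem label_injective (S : Slot υ → Insert) : Function.Injective (label S) := by
  rintro (i | i) (j | j) h
  · have := (nodup_leftLabels S).getElem_inj_iff.1 h
    rw [Fin.ext this]
  · exact (disjoint_leftLabels_rightLabels S (label_inl_mem S i) (h ▸ label_inr_mem S j)).elim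
  · exact (disjoint_leftLabels_rightLabels S (label_inl_mem S j) (h ▸ label_inr_mem S i)).elim
  · have := (nodup_rightLabels S).getElem_inj_iff.1 h
    rw [Fin.ext this]

theorem exists_label_iff {S : Slot υ → Insert} {a : Label υ} :
    (∃ v, label S v = a) ↔ a ∈ leftLabels S ∨ a ∈ rightLabels S := by
  rw [← ofFn_label_left, ← ofFn_label_right, List.mem_ofFn, List.mem_ofFn]
  constructor
  · rintro ⟨i | j, h⟩
    · exact Or.inl ⟨i, h⟩
    · exact Or.inr ⟨j, h⟩
  · rintro (⟨i, h⟩ | ⟨j, h⟩)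
    · exact ⟨_, h⟩
    · exact ⟨_, h⟩

theorem exists_label_inl (S : Slot υ → Insert) (v : Site n n') : ∃ u, label S u = Sum.inl v := by
  rw [exists_label_iff, leftLabels, rightLabels, mem_word, mem_word]
  rcases v with i | j
  · exact Or.inl (Or.inl ⟨i, rfl⟩)
  · exact Or.inr (Or.inl ⟨j, rfl⟩)

theorem exists_label_inr {S : Slot υ → Insert} {k : Slot υ} {b : Bool} :
    (∃ u, label S u = Sum.inr (k, b)) ↔ b = false ∨ S k = Insert.gate := by
  rw [exists_label_iff, leftLabels, rightLabels, mem_word, mem_word]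
  have key : ∀ e, (Sum.inr (k, b) : Label υ) ∈ labelsAt S e ↔ k.1 = e ∧ (b = false ∨ S k = Insert.gate) := by
    intro e
    rw [mem_labelsAt]
    constructor
    · rintro ⟨k', rfl, h | ⟨h, h'⟩⟩
      · simp only [Sum.inr.injEq, Prod.mk.injEq] at h
        exact ⟨by rw [h.1], Or.inl h.2⟩
      · simp only [Sum.inr.injEq, Prod.mk.injEq] at h
        exact ⟨by rw [h.1], Or.inr (h.1 ▸ h')⟩
    · rintro ⟨h, h'⟩
      refine ⟨k, h, ?_⟩
      cases b
      · exact Or.inl rfl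
      · exact Or.inr ⟨rfl, by simpa using h'⟩
  simp only [key]
  constructor
  · rintro ((⟨i, h⟩ | ⟨i, h⟩) | (⟨i, h⟩ | ⟨i, h⟩))
    · simp at h
    · exact h.2
    · simp at h
    · exact h.2
  · intro h
    rcases hk : k.1 with i | j
    · exact Or.inl (Or.inr ⟨i, rfl, h⟩)
    · exact Or.inr (Or.inr ⟨j, rfl, h⟩)

end Annotated

end Feynman

/-! ### Charts and lumps of the extended graph. -/

namespace Feynman

variable {d n n' : ℕ}

theorem mem_part_iff {P : Lumps n n'} {u v : Site n n'} : u ∈ P.part v ↔ P.part u = P.part v :=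
  P.mem_part_iff_part_eq_part (Finset.mem_univ u) (Finset.mem_univ v)

theorem mem_part_self (P : Lumps n n') (v : Site n n') : v ∈ P.part v :=
  P.mem_part (Finset.mem_univ v)

theorem mem_singles_iff {P : Lumps n n'} {v : Site n n'} : v ∈ singles P ↔ ∀ u ∈ P.part v, u = v := by
  rw [singles, Finset.mem_filter, and_iff_right (Finset.mem_univ v)]
  constructor
  · intro h u hu
    rw [P.part_eq_of_mem h (Finset.mem_singleton_self v)] at hu
    exact Finset.mem_singleton.1 hu
  · intro h
    have : P.part v = {v} := Finset.eq_singleton_iff_unique_mem.2 ⟨mem_part_self P v, h⟩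
    rw [← this]
    exact P.part_mem.2 (Finset.mem_univ v)

/-- One representative is chosen in each lump and declared dependent; the coordinates are the other
vertices and the base point. The choice depends on the lump as a set only, so it is the same for all
vertices of the lump. -/
theorem exists_isChart (P : Lumps n n') :
    ∃ (K : Type) (_ : Fintype K) (ι : K → Option (Site n n')), IsChart P ι := by
  classical
  let rep : Finset (Site n n') → Option (Site n n') := fun μ =>
    if h : μ.Nonempty then some h.choose else none
  have hrep : ∀ v, ∃ r ∈ P.part v, rep (P.part v) = some r := by
    intro v
    have h : (P.part v).Nonempty := ⟨v, mem_part_self P v⟩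
    exact ⟨h.choose, h.choose_spec, dif_pos h⟩
  refine ⟨{o : Option (Site n n') // ∀ v, o = some v → rep (P.part v) ≠ some v}, inferInstance,
    Subtype.val, Subtype.val_injective, ⟨⟨none, by simp⟩, rfl⟩, fun v => ?_⟩
  obtain ⟨r, hr, hr'⟩ := hrep v
  have hpart := mem_part_iff.1 hr
  refine ⟨r, ⟨hr, ?_⟩, ?_⟩
  · rintro ⟨o, ho⟩ rfl
    exact ho r rfl (hpart ▸ hr')
  · rintro s ⟨hs, hs'⟩
    by_contra hne
    refine hs' ⟨some s, ?_⟩ rfl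
    rintro _ ⟨⟩
    rw [mem_part_iff.1 hs, hr']
    exact fun h => hne (Option.some_injective _ h).symm

theorem measurable_fullInc {K : Type*} [Fintype K] {P : Lumps n n'} (ι : K → Option (Site n n'))
    (u : Option P.parts → Mom d) (o : Option (Site n n')) :
    Measurable fun y : K → Mom d => fullInc P ι y u o := by
  classical
  have h : ∀ o, Measurable fun y : K → Mom d => Function.extend ι y 0 o := by
    intro o
    by_cases ho : ∃ k, ι k = o
    · simp only [Function.extend_def, ho, dif_pos]
      exact measurable_pi_apply _
    · simp only [Function.extend_def, ho, dif_neg, not_false_eq_true]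
      exact measurable_const
  unfold fullInc
  refine (h o).add ?_
  split_ifs
  · exact measurable_const
  · rcases o with _ | v
    · exact measurable_const
    · exact measurable_const.sub (Finset.measurable_sum _ fun r _ => h _)

theorem isParam_fullInc {K : Type*} [Fintype K] {P : Lumps n n'} {ι : K → Option (Site n n')}
    (h : IsChart P ι) : IsParam P ι fun y : K → Mom d => fullInc P ι y 0 := by
  refine ⟨fun y k => ?_, fun y v => ?_⟩
  · unfold fullInc
    rw [if_pos ⟨k, rfl⟩, h.injective.extend_apply, add_zero]
  · exact sum_fullInc h y 0 ⟨P.part v, P.part_mem.2 (Finset.mem_univ v)⟩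

section Extension

variable {υ : Edge n n' → ℕ}

theorem mem_part_extendLumps {P : Lumps n n'} {S : Slot υ → Insert}
    {u v : Site (leftWord S).length (rightWord S).length} :
    u ∈ (extendLumps P S).part v
      ↔ Sum.map P.part id (label S u).letter = Sum.map P.part id (label S v).letter := by
  classical
  rw [letter_label, letter_label]
  unfold extendLumps
  rw [Finpartition.mem_part_ofSetoid_iff_rel]
  exact eq_comm

/-- The old vertex `v` in the extended graph. -/
def oldSite (S : Slot υ → Insert) (v : Site n n') : Site (leftWord S).length (rightWord S).length :=
  (exists_label_inl S v).choose

theorem label_oldSite (S : Slot υ → Insert) (v : Site n n') : label S (oldSite S v) = Sum.inl v :=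
  (exists_label_inl S v).choose_spec

theorem eq_oldSite {S : Slot υ → Insert} {u : Site (leftWord S).length (rightWord S).length}
    {v : Site n n'} (h : label S u = Sum.inl v) : u = oldSite S v :=
  label_injective S (h.trans (label_oldSite S v).symm)

/-- The first vertex of the insertion in a slot. -/
def newSite (S : Slot υ → Insert) (k : Slot υ) : Site (leftWord S).length (rightWord S).length :=
  (exists_label_inr.2 (Or.inl rfl) : ∃ u, label S u = Sum.inr (k, false)).choose

theorem label_newSite (S : Slot υ → Insert) (k : Slot υ) : label S (newSite S k) = Sum.inr (k, false) :=
  (exists_label_inr.2 (Or.inl rfl) : ∃ u, label S u = Sum.inr (k, false)).choose_spec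

theorem eq_newSite {S : Slot υ → Insert} {u : Site (leftWord S).length (rightWord S).length}
    {k : Slot υ} (h : label S u = Sum.inr (k, false)) : u = newSite S k :=
  label_injective S (h.trans (label_newSite S k).symm)

theorem gate_of_label {S : Slot υ → Insert} {u : Site (leftWord S).length (rightWord S).length}
    {k : Slot υ} (h : label S u = Sum.inr (k, true)) : S k = Insert.gate := by
  simpa using exists_label_inr.1 ⟨u, h⟩

theorem exists_second {S : Slot υ → Insert} {k : Slot υ} (h : S k = Insert.gate) :
    ∃ u, label S u = Sum.inr (k, true) := exists_label_inr.2 (Or.inr h)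

theorem mem_part_of_inl {P : Lumps n n'} {S : Slot υ → Insert}
    {u v : Site (leftWord S).length (rightWord S).length} {s : Site n n'} (hv : label S v = Sum.inl s) :
    u ∈ (extendLumps P S).part v ↔ ∃ r ∈ P.part s, u = oldSite S r := by
  rw [mem_part_extendLumps, hv]
  constructor
  · intro h
    rcases hu : label S u with r | ⟨k, b⟩
    · rw [hu] at h
      exact ⟨r, mem_part_iff.2 (by simpa [Label.letter] using h), eq_oldSite hu⟩
    · rw [hu] at h
      simp [Label.letter] at h
  · rintro ⟨r, hr, rfl⟩
    rw [label_oldSite]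
    simpa [Label.letter] using mem_part_iff.1 hr

theorem mem_part_of_inr {P : Lumps n n'} {S : Slot υ → Insert}
    {u v : Site (leftWord S).length (rightWord S).length} {k : Slot υ} {b : Bool}
    (hv : label S v = Sum.inr (k, b)) :
    u ∈ (extendLumps P S).part v ↔ ∃ b', label S u = Sum.inr (k, b') := by
  rw [mem_part_extendLumps, hv]
  constructor
  · intro h
    rcases hu : label S u with r | ⟨k', b'⟩
    · rw [hu] at h
      simp [Label.letter] at h
    · rw [hu] at h
      have : k' = k := by simpa [Label.letter] using h
      exact ⟨b', by rw [this]⟩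
  · rintro ⟨b', hu⟩
    rw [hu]
    rfl

/-- The flag of a label that says whether it belongs to a single lump. -/
def isSingle (P : Lumps n n') (S : Slot υ → Insert) : Label υ → Prop
  | Sum.inl v => v ∈ singles P
  | Sum.inr (k, _) => S k = Insert.theta

/-- Old lumps keep their size, and an insertion is single exactly when it has no second vertex. -/
theorem mem_singles_extendLumps {P : Lumps n n'} {S : Slot υ → Insert}
    {v : Site (leftWord S).length (rightWord S).length} :
    v ∈ singles (extendLumps P S) ↔ isSingle P S (label S v) := by
  rw [mem_singles_iff]
  rcases hv : label S v with s | ⟨k, b⟩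
  · rw [isSingle, mem_singles_iff]
    constructor
    · intro h r hr
      have h1 := h (oldSite S r) ((mem_part_of_inl hv).2 ⟨r, hr, rfl⟩)
      rw [← h1, label_oldSite] at hv
      exact Sum.inl_injective hv
    · intro h u hu
      obtain ⟨r, hr, rfl⟩ := (mem_part_of_inl hv).1 hu
      rw [h r hr, eq_oldSite hv]
  · rw [isSingle]
    constructor
    · intro h
      by_contra hS
      have hg : S k = Insert.gate := by revert hS; cases S k <;> simp
      obtain ⟨u, hu⟩ := exists_second hg
      have h1 := h u ((mem_part_of_inr hv).2 ⟨_, hu⟩)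
      have h2 := h (newSite S k) ((mem_part_of_inr hv).2 ⟨_, label_newSite S k⟩)
      rw [h1, ← h2, label_newSite] at hu
      simp at hu
    · intro hS u hu
      obtain ⟨b', hb'⟩ := (mem_part_of_inr hv).1 hu
      have h1 : ∀ w b, label S w = Sum.inr (k, b) → b = false := by
        intro w b hw
        cases b
        · rfl
        · rw [gate_of_label hw] at hS; simp at hS
      have e1 := h1 _ _ hb'
      have e2 := h1 _ _ hv
      subst e1 e2
      exact label_injective S (hb'.trans hv.symm)

/-- The increment at a label, in terms of the increments of the old graph and of the momenta of the
gates. -/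
def labelInc {A : Type*} [AddCommGroup A] (x : Option (Site n n') → A) (z : Slot υ → A) : Label υ → A
  | Sum.inl v => x (some v)
  | Sum.inr (k, b) => if b then -z k else z k

/-- The increments of the extended graph. -/
def extInc (S : Slot υ → Insert) (x : Option (Site n n') → Mom d) (z : Slot υ → Mom d) :
    Option (Site (leftWord S).length (rightWord S).length) → Mom d
  | none => x none
  | some v => labelInc x z (label S v)

instance : DecidableEq Insert
  | Insert.gate, Insert.gate => isTrue rfl
  | Insert.theta, Insert.theta => isTrue rfl
  | Insert.gate, Insert.theta => isFalse (by simp)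
  | Insert.theta, Insert.gate => isFalse (by simp)

/-- The momenta of the gates, extended by zero to the other slots. -/
def gateExt (S : Slot υ → Insert) (z : {k // S k = Insert.gate} → Mom d) (k : Slot υ) : Mom d :=
  if h : S k = Insert.gate then z ⟨k, h⟩ else 0

theorem measurable_gateExt (S : Slot υ → Insert) (k : Slot υ) :
    Measurable fun z : {k // S k = Insert.gate} → Mom d => gateExt S z k := by
  unfold gateExt
  split_ifs
  · exact measurable_pi_apply _
  · exact measurable_const

/-- Independent momenta of the extended graph: those of the old one and one for each gate. -/
def extChart {K : Type*} (S : Slot υ → Insert) (ι : K → Option (Site n n')) :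
    K ⊕ {k // S k = Insert.gate} → Option (Site (leftWord S).length (rightWord S).length)
  | Sum.inl k => (ι k).map (oldSite S)
  | Sum.inr g => some (newSite S g.1)

theorem oldSite_injective (S : Slot υ → Insert) : Function.Injective (oldSite S) := fun u v h => by
  have := label_oldSite S u
  rw [h, label_oldSite] at this
  exact (Sum.inl_injective this).symm

theorem newSite_injective (S : Slot υ → Insert) : Function.Injective (newSite S) := fun k k' h => by
  have := label_newSite S k
  rw [h, label_newSite] at this
  simpa using this.symm

theorem oldSite_ne_newSite (S : Slot υ → Insert) (v : Site n n') (k : Slot υ) :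
    oldSite S v ≠ newSite S k := fun h => by
  have := label_oldSite S v
  rw [h, label_newSite] at this
  simp at this

/-- Of the two vertices of a gate the first is a coordinate and the second one dependent. The only
vertex of a `ϑ` is dependent, hence contributes no coordinate. -/
theorem IsChart.extChart {K : Type*} {P : Lumps n n'} {ι : K → Option (Site n n')} (h : IsChart P ι)
    (S : Slot υ → Insert) : IsChart (extendLumps P S) (extChart S ι) := by
  refine ⟨?_, ?_, fun v => ?_⟩
  · rintro (k | g) (k' | g') hk
    · rw [h.injective (Option.map_injective (oldSite_injective S) hk)]
    · obtain ⟨v, _, hv⟩ := Option.map_eq_some_iff.1 hk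
      exact absurd hv (oldSite_ne_newSite S v _)
    · obtain ⟨v, _, hv⟩ := Option.map_eq_some_iff.1 hk.symm
      exact absurd hv (oldSite_ne_newSite S v _)
    · rw [Subtype.ext (newSite_injective S (Option.some_injective _ hk))]
  · obtain ⟨k, hk⟩ := h.base
    exact ⟨Sum.inl k, by rw [Feynman.extChart, hk]; rfl⟩
  · rcases hv : label S v with s | ⟨k, b⟩
    · obtain ⟨r, ⟨hr, hr'⟩, hu⟩ := h.existsUnique s
      refine ⟨oldSite S r, ⟨(mem_part_of_inl hv).2 ⟨r, hr, rfl⟩, ?_⟩, ?_⟩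
      · rintro (k | g) hk
        · obtain ⟨w, hw, hw'⟩ := Option.map_eq_some_iff.1 hk
          rw [oldSite_injective S hw'] at hw
          exact hr' k hw
        · exact oldSite_ne_newSite S r _ (Option.some_injective _ hk).symm
      · rintro u ⟨hu1, hu2⟩
        obtain ⟨r', hr1, rfl⟩ := (mem_part_of_inl hv).1 hu1
        rw [hu r' ⟨hr1, fun k hk => hu2 (Sum.inl k) (by rw [Feynman.extChart, hk]; rfl)⟩]
    · have hold : ∀ k (w : Site (leftWord S).length (rightWord S).length) k' b',
          label S w = Sum.inr (k', b') → Feynman.extChart S ι (Sum.inl k) ≠ some w := by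
        intro k w k' b' hw hk
        obtain ⟨w', _, hw'⟩ := Option.map_eq_some_iff.1 hk
        rw [← hw', label_oldSite] at hw
        simp at hw
      rcases hS : S k with _ | _
      · obtain ⟨w, hw⟩ := exists_second hS
        refine ⟨w, ⟨(mem_part_of_inr hv).2 ⟨_, hw⟩, ?_⟩, ?_⟩
        · rintro (k' | g) hk
          · exact hold _ _ _ _ hw hk
          · rw [← Option.some_injective _ hk, label_newSite] at hw
            simp at hw
        · rintro u ⟨hu1, hu2⟩
          obtain ⟨b', hb'⟩ := (mem_part_of_inr hv).1 hu1
          cases b'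
          · exact absurd (congrArg some (eq_newSite hb').symm) (hu2 (Sum.inr ⟨k, hS⟩))
          · exact label_injective S (hb'.trans hw.symm)
      · refine ⟨newSite S k, ⟨(mem_part_of_inr hv).2 ⟨_, label_newSite S k⟩, ?_⟩, ?_⟩
        · rintro (k' | g) hk
          · exact hold _ _ _ _ (label_newSite S k) hk
          · have h1 := newSite_injective S (Option.some_injective _ hk)
            have h2 := g.2
            rw [h1, hS] at h2
            simp at h2
        · rintro u ⟨hu1, hu2⟩
          obtain ⟨b', hb'⟩ := (mem_part_of_inr hv).1 hu1
          cases b'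
          · exact eq_newSite hb'
          · have h2 := gate_of_label hb'
            rw [hS] at h2
            simp at h2

theorem IsParam.extInc {K : Type*} {P : Lumps n n'} {ι : K → Option (Site n n')}
    {X : (K → Mom d) → Option (Site n n') → Mom d} (hX : IsParam P ι X) (S : Slot υ → Insert) :
    IsParam (extendLumps P S) (Feynman.extChart S ι)
      fun y => extInc S (X fun k => y (Sum.inl k)) (gateExt S fun g => y (Sum.inr g)) := by
  classical
  refine ⟨fun y k => ?_, fun y v => ?_⟩
  · rcases k with k | g
    · rw [← hX.apply_chart (fun k => y (Sum.inl k)) k, Feynman.extChart]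
      rcases ι k with _ | v
      · rfl
      · simp only [Option.map_some, Feynman.extInc, label_oldSite, labelInc]
    · simp [Feynman.extChart, Feynman.extInc, label_newSite, labelInc, gateExt, g.2]
  · rcases hv : label S v with s | ⟨k, b⟩
    · have e : (extendLumps P S).part v = (P.part s).image (oldSite S) := by
        ext u
        rw [mem_part_of_inl hv, Finset.mem_image]
        simp only [eq_comm]
      rw [e, Finset.sum_image fun a _ b _ hab => oldSite_injective S hab, ← hX.sum_part (fun k => y (Sum.inl k)) s]
      refine Finset.sum_congr rfl fun r _ => ?_
      simp only [Feynman.extInc, label_oldSite, labelInc]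
    · rcases hS : S k with _ | _
      · obtain ⟨w, hw⟩ := exists_second hS
        have hne : newSite S k ≠ w := fun h => by
          rw [← h, label_newSite] at hw; simp at hw
        have e : (extendLumps P S).part v = {newSite S k, w} := by
          ext u
          rw [mem_part_of_inr hv, Finset.mem_insert, Finset.mem_singleton]
          constructor
          · rintro ⟨b', hb'⟩
            cases b'
            · exact Or.inl (eq_newSite hb')
            · exact Or.inr (label_injective S (hb'.trans hw.symm))
          · rintro (rfl | rfl)
            · exact ⟨_, label_newSite S k⟩
            · exact ⟨_, hw⟩
        rw [e, Finset.sum_pair hne]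
        simp [Feynman.extInc, label_newSite, hw, labelInc]
      · have e : (extendLumps P S).part v = {newSite S k} := by
          ext u
          rw [mem_part_of_inr hv, Finset.mem_singleton]
          constructor
          · rintro ⟨b', hb'⟩
            cases b'
            · exact eq_newSite hb'
            · have h2 := gate_of_label hb'
              rw [hS] at h2
              simp at h2
          · rintro rfl
            exact ⟨_, label_newSite S k⟩
        rw [e, Finset.sum_singleton]
        simp [Feynman.extInc, label_newSite, labelInc, gateExt, hS]

end Extension

end Feynman

/-! ### Factorization of the integrand over the insertions. -/

namespace Feynman

namespace Setting

variable {d n n' : ℕ} (M : Setting d)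

/-- The momentum cutoff of a single edge. -/
def cut (q : Mom d) : ℂ := if ‖q‖ ≤ M.ζ then 1 else 0

/-- The factor of an edge of the second arc. -/
def edgeR (β : ℝ) (q : Mom d) : ℂ := M.cut q * (1 / ((β : ℂ) - M.disp q + Complex.I * M.η))

/-- The factor of an edge of the first arc. -/
def edgeL (α : ℝ) (q : Mom d) : ℂ := M.cut q * (1 / ((α : ℂ) - conj (M.disp q) - Complex.I * M.η))

/-- The factor of the last edge of an arc. -/
def lastFac (trunc : Bool) (F : Mom d → ℂ) (q : Mom d) : ℂ := if trunc then M.cut q else F q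

/-- The factor of a vertex of the second arc; the flag is set for single lumps. -/
def vertexR (b : Bool) (q q' : Mom d) : ℂ :=
  M.lam * if b then M.lam * -M.θ q' else M.Bhat (q' - q)

/-- The factor of a vertex of the first arc. -/
def vertexL (b : Bool) (q q' : Mom d) : ℂ :=
  M.lam * conj (if b then M.lam * -M.θ q else M.Bhat (q - q'))

/-- The integrand of the `V`-value, with the powers of the coupling constant. -/
def integrand (trunc : Bool) (P : Lumps n n') (α β : ℝ) (w : EdgeMom d n n') : ℂ :=
  (M.lam : ℂ) ^ (n + n' + numSingles P) * (M.cutoffSet n n').indicator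
    (fun w => (∏ e ∈ propEdges trunc n n', M.prop α β e (w e)) * M.calM P w) w

theorem prod_propEdges {R : Type*} [CommMonoid R] (trunc : Bool) (f : Edge n n' → R) :
    ∏ e ∈ propEdges trunc n n', f e
      = ((∏ i : Fin n, f (Sum.inl i.castSucc)) * if trunc then 1 else f (starIn n n'))
        * ((∏ j : Fin n', f (Sum.inr j.castSucc)) * if trunc then 1 else f (starOut n n')) := by
  cases trunc
  · simp [propEdges, Fintype.prod_sum_type, Fin.prod_univ_castSucc, starIn, starOut]
  · have : propEdges true n n' = (Finset.univ : Finset (Fin n)).image (fun i => Sum.inl i.castSucc)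
        ∪ (Finset.univ : Finset (Fin n')).image (fun j => Sum.inr j.castSucc) := by
      ext e
      rcases e with i | j
      · refine Fin.lastCases ?_ (fun i => ?_) i <;>
          simp [propEdges, starIn, starOut, (Fin.castSucc_lt_last _).ne]
      · refine Fin.lastCases ?_ (fun i => ?_) j <;>
          simp [propEdges, starIn, starOut, (Fin.castSucc_lt_last _).ne]
    rw [this, Finset.prod_union, Finset.prod_image, Finset.prod_image]
    · simp
    · intro a _ b _ h; simpa using h
    · intro a _ b _ h; simpa using h
    · rw [Finset.disjoint_left]
      simp

theorem indicator_cutoffSet (f : EdgeMom d n n' → ℂ) (w : EdgeMom d n n') :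
    (M.cutoffSet n n').indicator f w = (∏ e, M.cut (w e)) * f w := by
  by_cases h : w ∈ M.cutoffSet n n'
  · have h1 : ∏ e, M.cut (w e) = 1 := Finset.prod_eq_one fun e _ => if_pos (h e)
    rw [Set.indicator_of_mem h, h1, one_mul]
  · rw [Set.indicator_of_notMem h]
    have : ∃ e, ¬‖w e‖ ≤ M.ζ := by
      simpa only [cutoffSet, Set.mem_ofPred_eq, not_forall] using h
    obtain ⟨e, he⟩ := this
    rw [Finset.prod_eq_zero (Finset.mem_univ e) (if_neg he), zero_mul]

/-- The flag and the increment at a vertex of the first arc. -/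
def leftLetter (P : Lumps n n') (x : Option (Site n n') → Mom d) (i : Fin n) : Bool × Mom d := by
  classical exact (decide (Sum.inl i ∈ singles P), x (some (Sum.inl i)))

/-- The flag and the increment at a vertex of the second arc. -/
def rightLetter (P : Lumps n n') (x : Option (Site n n') → Mom d) (j : Fin n') : Bool × Mom d := by
  classical exact (decide (Sum.inr j ∈ singles P), -x (some (Sum.inr j)))

/-- The power of `λ` is distributed as one factor per vertex and a further one per single lump. The
second arc is traversed against its orientation, so the momentum entering a vertex is the later one
there: `vertexR` evaluates `θ` at its second argument, `vertexL` at its first. -/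
theorem integrand_walk (trunc : Bool) (P : Lumps n n') (α β : ℝ) (x : Option (Site n n') → Mom d) :
    M.integrand trunc P α β (walk M.ξ x)
      = arcProd (M.edgeL α) (M.lastFac trunc (M.edgeL α)) M.vertexL (x none)
          (List.ofFn (leftLetter P x))
        * arcProd (M.edgeR β) (M.lastFac trunc (M.edgeR β)) M.vertexR (x none - M.ξ)
          (List.ofFn (rightLetter P x))
        * (conj (M.ψhat (x none)) * M.ψhat (x none - M.ξ)
          * M.Q ((1 / 2 : ℝ) • (walk M.ξ x (starIn n n') + walk M.ξ x (starOut n n')))) := by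
  classical
  have hpow : (M.lam : ℂ) ^ (n + n' + numSingles P)
      = (∏ i : Fin n, (M.lam * if Sum.inl i ∈ singles P then (M.lam : ℂ) else 1))
        * ∏ j : Fin n', (M.lam * if Sum.inr j ∈ singles P then (M.lam : ℂ) else 1) := by
    rw [← Fintype.prod_sum_type (fun v : Site n n' => (M.lam * if v ∈ singles P then (M.lam : ℂ) else 1)),
      Finset.prod_mul_distrib, Finset.prod_const, Finset.prod_ite_mem, Finset.univ_inter,
      Finset.prod_const, pow_add, Finset.card_univ, Fintype.card_sum, Fintype.card_fin, Fintype.card_fin]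
    rfl
  have wl : ∀ i, x none + psum (fun k => (leftLetter P x k).2) i = walk M.ξ x (Sum.inl i) := fun i => rfl
  have wr : ∀ i, x none - M.ξ + psum (fun k => (rightLetter P x k).2) i = walk M.ξ x (Sum.inr i) :=
    fun i => rfl
  have gl : ∀ i, M.vertexL (leftLetter P x i).1 (walk M.ξ x (Sum.inl i.castSucc)) (walk M.ξ x (Sum.inl i.succ))
      = (M.lam * if Sum.inl i ∈ singles P then (M.lam : ℂ) else 1)
        * M.vertexFactor P (walk M.ξ x) (Sum.inl i) := by
    intro i
    simp only [vertexL, leftLetter, vertexFactor, edgeIn, edgeOut]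
    by_cases h : Sum.inl i ∈ singles P <;> simp [h]
    ring
  have gr : ∀ i, M.vertexR (rightLetter P x i).1 (walk M.ξ x (Sum.inr i.castSucc)) (walk M.ξ x (Sum.inr i.succ))
      = (M.lam * if Sum.inr i ∈ singles P then (M.lam : ℂ) else 1)
        * M.vertexFactor P (walk M.ξ x) (Sum.inr i) := by
    intro i
    simp only [vertexR, rightLetter, vertexFactor, edgeIn, edgeOut]
    by_cases h : Sum.inr i ∈ singles P <;> simp [h]
    ring
  rw [integrand, indicator_cutoffSet, arcProd_ofFn, arcProd_ofFn, prod_propEdges, hpow]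
  simp only [wl, wr, gl, gr, calM, Fintype.prod_sum_type, walk_zeroOut, walk_zeroIn,
    Finset.prod_mul_distrib, edgeL, edgeR, lastFac, Fin.prod_univ_castSucc, prop, starIn, starOut]
  cases trunc <;> simp only [Bool.false_eq_true, if_true, if_false] <;> ring

/-- The factor of an insertion on an edge with momentum `q`; for a gate, `z` is its momentum. -/
def slotFac (α β : ℝ) : Edge n n' → Insert → Mom d → Mom d → ℂ
  | Sum.inl _, Insert.gate, q, z => M.lam ^ 2 * M.edgeL α q * M.edgeL α (q + z) * (‖M.Bhat z‖ ^ 2 : ℂ)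
  | Sum.inl _, Insert.theta, q, _ => M.lam ^ 2 * M.edgeL α q * conj (-M.θ q)
  | Sum.inr _, Insert.gate, q, z => M.lam ^ 2 * M.edgeR β q * M.edgeR β (q - z) * (‖M.Bhat z‖ ^ 2 : ℂ)
  | Sum.inr _, Insert.theta, q, _ => M.lam ^ 2 * M.edgeR β q * -M.θ q

variable {υ : Edge n n' → ℕ} {M} {C : ℝ}

/-- A gate leads from `q` to `q + z` and back, a `ϑ` stays at `q`; each is a block in the sense of
`arcProd_word`. Blocks precede the last edge of the arc, so an insertion on a truncated edge still
receives full propagators and its factor does not depend on `trunc`. -/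
theorem Regular.arcProd_left (hM : M.Regular C) (trunc : Bool) (P : Lumps n n') (S : Slot υ → Insert)
    (α β : ℝ) (x : Option (Site n n') → Mom d) (z : Slot υ → Mom d)
    (hz : ∀ k, S k = Insert.theta → z k = 0) (p : Mom d) :
    arcProd (M.edgeL α) (M.lastFac trunc (M.edgeL α)) M.vertexL p
        (List.ofFn (leftLetter (extendLumps P S) (extInc S x z)))
      = (∏ i : Fin (n + 1), ∏ k : Fin (υ (Sum.inl i)), M.slotFac α β (Sum.inl i : Edge n n') (S ⟨Sum.inl i, k⟩)
          (p + psum (fun k => (leftLetter P x k).2) i) (z ⟨Sum.inl i, k⟩))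
        * arcProd (M.edgeL α) (M.lastFac trunc (M.edgeL α)) M.vertexL p
          (List.ofFn (leftLetter P x)) := by
  classical
  let g : Label υ → Bool × Mom d := fun a => (decide (isSingle P S a), labelInc x z a)
  have e : List.ofFn (leftLetter (extendLumps P S) (extInc S x z))
      = word (leftLetter P x) fun i => (labelsAt S (Sum.inl i)).map g := by
    have h1 : leftLetter (extendLumps P S) (extInc S x z)
        = g ∘ fun i => label S (Sum.inl i) := by
      funext i
      simp only [leftLetter, g, Function.comp_apply, mem_singles_extendLumps]
      rfl
    rw [h1, ← List.map_ofFn, ofFn_label_left, leftLabels, map_word]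
    congr 1
    funext i
    simp [leftLetter, g, isSingle, labelInc]
    congr
  rw [e]
  refine arcProd_word _ _ (fun i q => ∏ k : Fin (υ (Sum.inl i)), M.slotFac α β (Sum.inl i : Edge n n')
    (S ⟨Sum.inl i, k⟩) q (z ⟨Sum.inl i, k⟩)) (fun i q l => ?_) p
  rw [labelsAt, List.map_flatMap, Fin.prod_univ_def]
  refine arcProd_flatMap _ _ (fun k q => M.slotFac α β (Sum.inl i : Edge n n') (S ⟨Sum.inl i, k⟩) q
    (z ⟨Sum.inl i, k⟩)) (fun k q l => ?_) q l
  set s : Slot υ := ⟨Sum.inl i, k⟩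
  rw [slotLabels]
  cases hs : S s
  · simp only [List.map_cons, List.map_nil, List.cons_append, List.nil_append, arcProd, g, labelInc,
      isSingle, hs, slotFac, vertexL, Bool.false_eq_true, if_true, if_false, add_neg_cancel_right,
      sub_add_cancel_left, add_sub_cancel_left, hM.Bhat_neg, ← Complex.mul_conj', reduceCtorEq,
      decide_false, hM.conj_Bhat]
    ring
  · simp only [List.map_cons, List.map_nil, List.cons_append, List.nil_append, arcProd, g, labelInc,
      isSingle, hs, slotFac, vertexL, Bool.false_eq_true, if_true, if_false, hz s hs, add_zero,
      decide_true, map_mul, Complex.conj_ofReal]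
    ring

theorem Regular.arcProd_right (hM : M.Regular C) (trunc : Bool) (P : Lumps n n') (S : Slot υ → Insert)
    (α β : ℝ) (x : Option (Site n n') → Mom d) (z : Slot υ → Mom d)
    (hz : ∀ k, S k = Insert.theta → z k = 0) (p : Mom d) :
    arcProd (M.edgeR β) (M.lastFac trunc (M.edgeR β)) M.vertexR p
        (List.ofFn (rightLetter (extendLumps P S) (extInc S x z)))
      = (∏ i : Fin (n' + 1), ∏ k : Fin (υ (Sum.inr i)), M.slotFac α β (Sum.inr i : Edge n n') (S ⟨Sum.inr i, k⟩)
          (p + psum (fun k => (rightLetter P x k).2) i) (z ⟨Sum.inr i, k⟩))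
        * arcProd (M.edgeR β) (M.lastFac trunc (M.edgeR β)) M.vertexR p
          (List.ofFn (rightLetter P x)) := by
  classical
  let g : Label υ → Bool × Mom d := fun a => (decide (isSingle P S a), -labelInc x z a)
  have e : List.ofFn (rightLetter (extendLumps P S) (extInc S x z))
      = word (rightLetter P x) fun i => (labelsAt S (Sum.inr i)).map g := by
    have h1 : rightLetter (extendLumps P S) (extInc S x z)
        = g ∘ fun i => label S (Sum.inr i) := by
      funext i
      simp only [rightLetter, g, Function.comp_apply, mem_singles_extendLumps]
      rfl
    rw [h1, ← List.map_ofFn, ofFn_label_right, rightLabels, map_word]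
    congr 1
    funext i
    simp [rightLetter, g, isSingle, labelInc]
    congr
  rw [e]
  refine arcProd_word _ _ (fun i q => ∏ k : Fin (υ (Sum.inr i)), M.slotFac α β (Sum.inr i : Edge n n')
    (S ⟨Sum.inr i, k⟩) q (z ⟨Sum.inr i, k⟩)) (fun i q l => ?_) p
  rw [labelsAt, List.map_flatMap, Fin.prod_univ_def]
  refine arcProd_flatMap _ _ (fun k q => M.slotFac α β (Sum.inr i : Edge n n') (S ⟨Sum.inr i, k⟩) q
    (z ⟨Sum.inr i, k⟩)) (fun k q l => ?_) q l
  set s : Slot υ := ⟨Sum.inr i, k⟩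
  rw [slotLabels]
  cases hs : S s
  · simp only [List.map_cons, List.map_nil, List.cons_append, List.nil_append, arcProd, g, labelInc,
      isSingle, hs, slotFac, vertexR, Bool.false_eq_true, if_true, if_false, neg_neg,
      neg_add_cancel_right, sub_add_cancel_left, add_sub_cancel_left, hM.Bhat_neg, ← Complex.mul_conj',
      reduceCtorEq, decide_false, hM.conj_Bhat]
    simp only [← sub_eq_add_neg]
    ring
  · simp only [List.map_cons, List.map_nil, List.cons_append, List.nil_append, arcProd, g, labelInc,
      isSingle, hs, slotFac, vertexR, Bool.false_eq_true, if_true, if_false, hz s hs, add_zero, neg_zero,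
      decide_true]
    ring

/-- Each insertion has total increment zero, hence the momenta at `0*`, and with them the argument
of `Q`, are unchanged. -/
theorem walk_extInc_star (ξ : Mom d) (S : Slot υ → Insert) (x : Option (Site n n') → Mom d)
    (z : Slot υ → Mom d) (hz : ∀ k, S k = Insert.theta → z k = 0) :
    walk ξ (extInc S x z) (starIn _ _) = walk ξ x (starIn n n')
      ∧ walk ξ (extInc S x z) (starOut _ _) = walk ξ x (starOut n n') := by
  have hb : ∀ e, ((labelsAt S e).map (labelInc x z)).sum = 0 := by
    intro e
    rw [labelsAt, List.map_flatMap, List.flatMap_def, List.sum_flatten, List.map_map]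
    refine List.sum_eq_zero fun a ha => ?_
    obtain ⟨k, _, rfl⟩ := List.mem_map.1 ha
    rw [Function.comp_apply, slotLabels]
    cases hs : S ⟨e, k⟩
    · simp [labelInc]
    · simp [labelInc, hz _ hs]
  constructor
  · have h1 : ∑ i, extInc S x z (some (Sum.inl i)) = ∑ i, x (some (Sum.inl i)) := by
      rw [← List.sum_ofFn]
      have : (fun i => extInc S x z (some (Sum.inl i))) = labelInc x z ∘ fun i => label S (Sum.inl i) := rfl
      rw [this, ← List.map_ofFn, ofFn_label_left, leftLabels, map_word, sum_word _ _ fun i => hb _]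
      rfl
    simp only [starIn, walk, psum_last, h1]
    rfl
  · have h1 : ∑ i, extInc S x z (some (Sum.inr i)) = ∑ i, x (some (Sum.inr i)) := by
      rw [← List.sum_ofFn]
      have : (fun i => extInc S x z (some (Sum.inr i))) = labelInc x z ∘ fun i => label S (Sum.inr i) := rfl
      rw [this, ← List.map_ofFn, ofFn_label_right, rightLabels, map_word, sum_word _ _ fun i => hb _]
      rfl
    simp only [starOut, walk, psum_last, Finset.sum_neg_distrib, h1]
    rfl

/-- Insertions multiply the integrand by one factor for each slot. -/
theorem Regular.integrand_extendLumps (hM : M.Regular C) (trunc : Bool) (P : Lumps n n')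
    (S : Slot υ → Insert) (α β : ℝ) (x : Option (Site n n') → Mom d) (z : Slot υ → Mom d)
    (hz : ∀ k, S k = Insert.theta → z k = 0) :
    M.integrand trunc (extendLumps P S) α β (walk M.ξ (extInc S x z))
      = M.integrand trunc P α β (walk M.ξ x)
        * ∏ k : Slot υ, M.slotFac α β k.1 (S k) (walk M.ξ x k.1) (z k) := by
  obtain ⟨h1, h2⟩ := walk_extInc_star M.ξ S x z hz
  rw [integrand_walk, integrand_walk, h1, h2, Fintype.prod_sigma, Fintype.prod_sum_type]
  have h3 : extInc S x z none = x none := rfl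
  rw [h3, hM.arcProd_left trunc P S α β x z hz, hM.arcProd_right trunc P S α β x z hz]
  have wl : ∀ i, x none + psum (fun k => (leftLetter P x k).2) i = walk M.ξ x (Sum.inl i) := fun i => rfl
  have wr : ∀ i, x none - M.ξ + psum (fun k => (rightLetter P x k).2) i = walk M.ξ x (Sum.inr i) :=
    fun i => rfl
  simp only [wl, wr]
  ring

end Setting

end Feynman

/-! ### Measurability and integrability of the integrands. -/

namespace Feynman

namespace Setting

variable {d n n' : ℕ} {M : Setting d} {C : ℝ}

theorem measurable_edge (e : Edge n n') : Measurable fun w : EdgeMom d n n' => w e :=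
  measurable_pi_apply e

theorem prod_le_pow_card {ι : Type*} (s : Finset ι) {f : ι → ℝ} {c : ℝ} (h0 : ∀ i, 0 ≤ f i)
    (h1 : ∀ i, f i ≤ c) : ∏ i ∈ s, f i ≤ c ^ s.card :=
  (Finset.prod_le_prod (fun i _ => h0 i) fun i _ => h1 i).trans_eq (Finset.prod_const c)

theorem measurable_ψhat (M : Setting d) : Measurable M.ψhat := (Lp.stronglyMeasurable _).measurable

theorem Regular.measurable_disp (hM : M.Regular C) : Measurable M.disp := by
  have h1 : Measurable fun p : Mom d => (kin p : ℂ) := by unfold kin; fun_prop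
  exact h1.add (hM.continuous_θ.measurable.const_mul _)

theorem measurable_cut (M : Setting d) : Measurable M.cut :=
  Measurable.ite (measurableSet_le measurable_norm measurable_const) measurable_const measurable_const

theorem measurableSet_cutoffSet (M : Setting d) (n n' : ℕ) : MeasurableSet (M.cutoffSet n n') := by
  have : M.cutoffSet n n' = ⋂ e, {w | ‖w e‖ ≤ M.ζ} := by ext w; simp [cutoffSet]
  rw [this]
  exact MeasurableSet.iInter fun e => measurableSet_le (measurable_pi_apply e).norm measurable_const

theorem Regular.le_norm_resolvent (hM : M.Regular C) (a : ℝ) (p : Mom d) :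
    M.η ≤ ‖(a : ℂ) - M.disp p + Complex.I * M.η‖ := by
  have h1 : M.η ≤ ((a : ℂ) - M.disp p + Complex.I * M.η).im := by
    have e2 : (M.lam : ℂ) ^ 2 = ((M.lam ^ 2 : ℝ) : ℂ) := by push_cast; rfl
    rw [disp, e2]
    simp only [Complex.add_im, Complex.sub_im, Complex.ofReal_re, Complex.mul_im, Complex.I_re,
      Complex.I_im, Complex.ofReal_im]
    nlinarith [mul_nonneg (sq_nonneg M.lam) (neg_nonneg.2 (hM.θ_im_nonpos p))]
  exact h1.trans ((le_abs_self _).trans (Complex.abs_im_le_norm _))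

theorem conj_resolvent (M : Setting d) (a : ℝ) (p : Mom d) :
    conj ((a : ℂ) - M.disp p + Complex.I * M.η) = (a : ℂ) - conj (M.disp p) - Complex.I * M.η := by
  simp only [map_add, map_sub, map_mul, Complex.conj_ofReal, Complex.conj_I]; ring

/-- The energies of the edges. -/
def energy (n n' : ℕ) (α β : ℝ) : Edge n n' → ℝ := Sum.elim (fun _ => α) (fun _ => β)

theorem norm_prop (M : Setting d) (α β : ℝ) (e : Edge n n') (p : Mom d) :
    ‖M.prop α β e p‖ = 1 / ‖(energy n n' α β e : ℂ) - M.disp p + Complex.I * M.η‖ := by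
  rcases e with i | j
  · rw [prop, ← conj_resolvent, norm_div, RCLike.norm_conj, norm_one]; rfl
  · rw [prop, norm_div, norm_one]; rfl

theorem Regular.measurable_prop (hM : M.Regular C) (e : Edge n n') :
    Measurable fun q : (ℝ × ℝ) × EdgeMom d n n' => M.prop q.1.1 q.1.2 e (q.2 e) := by
  have h1 : Measurable fun q : (ℝ × ℝ) × EdgeMom d n n' => M.disp (q.2 e) :=
    hM.measurable_disp.comp ((measurable_pi_apply e).comp measurable_snd)
  rcases e with i | j
  · simp only [prop]
    have h2 : Measurable fun q : (ℝ × ℝ) × EdgeMom d n n' => conj (M.disp (q.2 (Sum.inl i))) :=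
      Complex.continuous_conj.measurable.comp h1
    refine measurable_const.div ((Measurable.sub ?_ h2).sub measurable_const)
    fun_prop
  · simp only [prop]
    refine measurable_const.div ((Measurable.sub ?_ h1).add measurable_const)
    fun_prop

theorem Regular.measurable_vertexFactor (hM : M.Regular C) (P : Lumps n n') (v : Site n n') :
    Measurable fun w : EdgeMom d n n' => M.vertexFactor P w v := by
  have h : Measurable fun w : EdgeMom d n n' => (if v ∈ singles P then -M.θ (w (edgeIn v))
      else M.Bhat (w (edgeIn v) - w (edgeOut v))) := by
    split_ifs
    · exact (hM.continuous_θ.measurable.comp (measurable_edge (edgeIn v))).neg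
    · exact hM.continuous_Bhat.measurable.comp ((measurable_edge _).sub (measurable_edge _))
  rcases v with i | j
  · exact Complex.continuous_conj.measurable.comp h
  · exact h

theorem Regular.measurable_calM (hM : M.Regular C) (hQ : Measurable M.Q) (P : Lumps n n') :
    Measurable fun w : EdgeMom d n n' => M.calM P w := by
  unfold calM
  refine (((Finset.measurable_prod _ fun v _ => hM.measurable_vertexFactor P v).mul ?_).mul ?_).mul ?_
  · exact Complex.continuous_conj.measurable.comp (M.measurable_ψhat.comp (measurable_edge _))
  · exact M.measurable_ψhat.comp (measurable_edge _)
  · exact hQ.comp (((measurable_edge (starIn n n')).add (measurable_edge (starOut n n'))).const_smul (1 / 2 : ℝ))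

theorem Regular.measurable_integrand (hM : M.Regular C) (hQ : Measurable M.Q) (trunc : Bool)
    (P : Lumps n n') :
    Measurable fun q : (ℝ × ℝ) × EdgeMom d n n' => M.integrand trunc P q.1.1 q.1.2 q.2 := by
  unfold integrand
  refine measurable_const.mul ?_
  simp only [indicator_cutoffSet]
  refine Measurable.mul ?_ (Measurable.mul ?_ ((hM.measurable_calM hQ P).comp measurable_snd))
  · exact Finset.measurable_prod _ fun e _ =>
      M.measurable_cut.comp ((measurable_pi_apply e).comp measurable_snd)
  · exact Finset.measurable_prod _ fun e _ => hM.measurable_prop e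

/-- The integrand of the `E`-value, with the powers of the coupling constant. -/
def absIntegrand (M : Setting d) (trunc : Bool) (G : Finset (Site n n')) (α β : ℝ)
    (w : EdgeMom d n n') : ℝ :=
  M.lam ^ (n + n') * (M.cutoffSet n n').indicator (fun w =>
    (∏ e ∈ propEdges trunc n n', 1 / ‖(energy n n' α β e : ℂ) - M.disp (w e) + Complex.I * M.η‖)
      * M.N G w) w

theorem continuous_bracket : Continuous (bracket (d := d)) := by unfold bracket; fun_prop

theorem bracket_pos (p : Mom d) : 0 < bracket p := Real.sqrt_pos.2 (by positivity)

theorem one_le_bracket (p : Mom d) : 1 ≤ bracket p := by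
  rw [bracket, Real.one_le_sqrt]; nlinarith [sq_nonneg ‖p‖]

theorem bracket_zpow_le_one (p : Mom d) : bracket p ^ (-(2 * d : ℤ)) ≤ 1 :=
  zpow_le_one_of_nonpos₀ (one_le_bracket p) (by simp)

theorem Regular.measurable_N (hM : M.Regular C) (G : Finset (Site n n')) :
    Measurable fun w : EdgeMom d n n' => M.N G w := by
  unfold N
  have hsub : ∀ v : Site n n', Measurable fun w : EdgeMom d n n' => w (edgeIn v) - w (edgeOut v) :=
    fun v => (measurable_edge _).sub (measurable_edge _)
  refine (((M.measurable_ψhat.comp (measurable_edge (zeroOut n n'))).norm.mul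
    (M.measurable_ψhat.comp (measurable_edge (zeroIn n n'))).norm).mul ?_).mul ?_
  · exact Finset.measurable_prod _ fun v _ => (hM.continuous_Bhat.measurable.comp (hsub v)).norm
  · refine Finset.measurable_prod _ fun v _ => Measurable.comp (g := fun p => bracket p ^ (-(2 * d : ℤ))) ?_ (hsub v)
    exact (continuous_bracket.zpow₀ _ fun p => Or.inl (bracket_pos p).ne').measurable

theorem Regular.measurable_absIntegrand (hM : M.Regular C) (trunc : Bool) (G : Finset (Site n n')) :
    Measurable fun q : (ℝ × ℝ) × EdgeMom d n n' => M.absIntegrand trunc G q.1.1 q.1.2 q.2 := by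
  unfold absIntegrand
  refine measurable_const.mul ?_
  have h : Measurable fun q : (ℝ × ℝ) × EdgeMom d n n' =>
      (∏ e ∈ propEdges trunc n n', ‖M.prop q.1.1 q.1.2 e (q.2 e)‖) * M.N G q.2 :=
    (Finset.measurable_prod _ fun e _ => (hM.measurable_prop e).norm).mul
      ((hM.measurable_N G).comp measurable_snd)
  simp only [norm_prop] at h
  have := h.indicator (measurable_snd (M.measurableSet_cutoffSet n n'))
  exact this

theorem N_nonneg (M : Setting d) (G : Finset (Site n n')) (w : EdgeMom d n n') : 0 ≤ M.N G w := by
  unfold N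
  have : ∀ v : Site n n', 0 ≤ bracket (w (edgeIn v) - w (edgeOut v)) ^ (-(2 * d : ℤ)) := fun v =>
    (zpow_pos (bracket_pos _) _).le
  exact mul_nonneg (mul_nonneg (by positivity) (Finset.prod_nonneg fun v _ => norm_nonneg _))
    (Finset.prod_nonneg fun v _ => this v)

theorem Regular.absIntegrand_nonneg (hM : M.Regular C) (trunc : Bool) (G : Finset (Site n n')) (α β : ℝ)
    (w : EdgeMom d n n') : 0 ≤ M.absIntegrand trunc G α β w := by
  unfold absIntegrand
  refine mul_nonneg (pow_nonneg hM.lam_pos.le _) (Set.indicator_nonneg (fun w _ => ?_) _)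
  exact mul_nonneg (Finset.prod_nonneg fun e _ => by positivity) (M.N_nonneg G w)

/-- The wave functions at the edges adjacent to the vertex `0`, with the cutoff of all momenta. -/
def waveFactor (M : Setting d) (n n' : ℕ) (w : EdgeMom d n n') : ℝ :=
  (M.cutoffSet n n').indicator (fun w => ‖M.ψhat (w (zeroOut n n'))‖ * ‖M.ψhat (w (zeroIn n n'))‖) w

theorem Regular.const_nonneg (hM : M.Regular C) : 0 ≤ C := (norm_nonneg _).trans (hM.norm_Bhat_le 0)

theorem Regular.prod_resolvent_le (hM : M.Regular C) (trunc : Bool) (α β : ℝ) (w : EdgeMom d n n') :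
    ∏ e ∈ propEdges trunc n n', 1 / ‖(energy n n' α β e : ℂ) - M.disp (w e) + Complex.I * M.η‖
      ≤ (1 / M.η) ^ (propEdges trunc n n').card :=
  prod_le_pow_card _ (fun e => by positivity)
    fun e => one_div_le_one_div_of_le hM.η_pos (hM.le_norm_resolvent _ _)

theorem Regular.norm_vertexFactor_le (hM : M.Regular C) (P : Lumps n n') (w : EdgeMom d n n')
    (v : Site n n') : ‖M.vertexFactor P w v‖ ≤ C := by
  have h : ‖(if v ∈ singles P then -M.θ (w (edgeIn v)) else M.Bhat (w (edgeIn v) - w (edgeOut v)))‖ ≤ C := by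
    split_ifs
    · rw [norm_neg]; exact hM.norm_θ_le _
    · exact hM.norm_Bhat_le _
  rcases v with i | j
  · exact (RCLike.norm_conj _).trans_le h
  · exact h

/-- A crude bound, for integrability only: `K` depends on `η` and on the size of the graph, and does
not enter the final estimate. -/
theorem Regular.exists_norm_integrand_le (hM : M.Regular C) (hQ : ∀ p, ‖M.Q p‖ ≤ 1) (trunc : Bool)
    (P : Lumps n n') :
    ∃ K : ℝ, ∀ α β w, ‖M.integrand trunc P α β w‖ ≤ K * M.waveFactor n n' w := by
  have hC := hM.const_nonneg
  have hη := hM.η_pos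
  refine ⟨M.lam ^ (n + n' + numSingles P) * ((1 / M.η) ^ (propEdges trunc n n').card
    * C ^ Fintype.card (Site n n')), fun α β w => ?_⟩
  rw [integrand, waveFactor, norm_mul, norm_pow, Complex.norm_real, Real.norm_of_nonneg hM.lam_pos.le,
    mul_assoc]
  refine mul_le_mul_of_nonneg_left ?_ (pow_nonneg hM.lam_pos.le _)
  by_cases hw : w ∈ M.cutoffSet n n'
  · rw [Set.indicator_of_mem hw, Set.indicator_of_mem hw, calM, norm_mul, norm_mul, norm_mul, norm_mul,
      norm_prod, norm_prod, RCLike.norm_conj]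
    simp only [norm_prop]
    have h1 := hM.prod_resolvent_le trunc α β w
    have h2 : ∏ v, ‖M.vertexFactor P w v‖ ≤ C ^ Fintype.card (Site n n') :=
      (prod_le_pow_card _ (fun v => norm_nonneg _)
        fun v => hM.norm_vertexFactor_le P w v).trans_eq (by rw [Finset.card_univ])
    have h3 := hQ ((1 / 2 : ℝ) • (w (starIn n n') + w (starOut n n')))
    have h4 : (0 : ℝ) ≤ ∏ v, ‖M.vertexFactor P w v‖ := Finset.prod_nonneg fun v _ => norm_nonneg _
    rw [mul_assoc ((1 / M.η) ^ _)]
    refine mul_le_mul h1 ?_ (by positivity) (by positivity)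
    refine (mul_le_of_le_one_right (by positivity) h3).trans ?_
    rw [mul_assoc]
    exact mul_le_mul_of_nonneg_right h2 (by positivity)
  · rw [Set.indicator_of_notMem hw, Set.indicator_of_notMem hw, norm_zero, mul_zero]

theorem Regular.exists_absIntegrand_le (hM : M.Regular C) (trunc : Bool) (G : Finset (Site n n')) :
    ∃ K : ℝ, ∀ α β w, M.absIntegrand trunc G α β w ≤ K * M.waveFactor n n' w := by
  have hC := hM.const_nonneg
  have hη := hM.η_pos
  refine ⟨M.lam ^ (n + n') * ((1 / M.η) ^ (propEdges trunc n n').card * C ^ Gᶜ.card), fun α β w => ?_⟩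
  rw [absIntegrand, waveFactor, mul_assoc]
  refine mul_le_mul_of_nonneg_left ?_ (pow_nonneg hM.lam_pos.le _)
  by_cases hw : w ∈ M.cutoffSet n n'
  · rw [Set.indicator_of_mem hw, Set.indicator_of_mem hw, mul_assoc]
    refine mul_le_mul (hM.prod_resolvent_le trunc α β w) ?_ (M.N_nonneg G w) (by positivity)
    rw [N]
    have h2 : ∏ v ∈ Gᶜ, ‖M.Bhat (w (edgeIn v) - w (edgeOut v))‖ ≤ C ^ Gᶜ.card :=
      prod_le_pow_card _ (fun v => norm_nonneg _) fun v => hM.norm_Bhat_le _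
    have h3 : ∏ v ∈ G, bracket (w (edgeIn v) - w (edgeOut v)) ^ (-(2 * d : ℤ)) ≤ 1 :=
      Finset.prod_le_one (fun v _ => (zpow_pos (bracket_pos _) _).le) fun v _ => bracket_zpow_le_one _
    have h4 : (0 : ℝ) ≤ ∏ v ∈ Gᶜ, ‖M.Bhat (w (edgeIn v) - w (edgeOut v))‖ :=
      Finset.prod_nonneg fun v _ => norm_nonneg _
    refine (mul_le_of_le_one_right (by positivity) h3).trans ?_
    rw [mul_comm (C ^ _)]
    exact mul_le_mul_of_nonneg_left h2 (by positivity)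
  · rw [Set.indicator_of_notMem hw, Set.indicator_of_notMem hw, mul_zero]

theorem measurable_walk {X : Type*} [MeasurableSpace X] (ξ : Mom d)
    {x : X → Option (Site n n') → Mom d} (hx : ∀ o, Measurable fun y => x y o) :
    Measurable fun y => walk ξ (x y) := by
  refine measurable_pi_iff.2 fun e => ?_
  rcases e with i | j
  · exact (hx none).add (measurable_psum (fun k => hx _) i)
  · exact ((hx none).sub measurable_const).add (measurable_psum (fun k => (hx _).neg) j)

theorem measurable_waveFactor (M : Setting d) (n n' : ℕ) : Measurable (M.waveFactor n n') :=
  ((M.measurable_ψhat.comp (measurable_edge (zeroOut n n'))).norm.mul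
    (M.measurable_ψhat.comp (measurable_edge (zeroIn n n'))).norm).indicator (M.measurableSet_cutoffSet n n')

/-- In the base momentum the product of the wave function and its translate is integrable by
Cauchy-Schwarz. Every other coordinate is a difference of two edge momenta, confined by the cutoff
to a ball of radius `2ζ`. -/
theorem integrable_waveFactor (M : Setting d) {K : Type*} [Fintype K] {P : Lumps n n'}
    {ι : K → Option (Site n n')} (hι : IsChart P ι) {X : (K → Mom d) → Option (Site n n') → Mom d}
    (hX : IsParam P ι X) (hXm : ∀ o, Measurable fun y => X y o) :
    Integrable fun y => M.waveFactor n n' (walk M.ξ (X y)) := by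
  classical
  obtain ⟨k₀, hk₀⟩ := hι.base
  let h : K → Mom d → ℝ := fun k p => if k = k₀ then ‖M.ψhat p‖ * ‖M.ψhat (p - M.ξ)‖
    else (Metric.closedBall (0 : Mom d) (2 * M.ζ)).indicator 1 p
  have hψ : MemLp M.ψhat 2 := Lp.memLp _
  have hψ' : MemLp (fun p => M.ψhat (p - M.ξ)) 2 :=
    hψ.comp_measurePreserving (measurePreserving_sub_right volume M.ξ)
  have ih : ∀ k, Integrable (h k) := by
    intro k
    by_cases hk : k = k₀
    · simp only [h, hk, if_true]
      exact MemLp.integrable_mul hψ.norm hψ'.norm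
    · simp only [h, hk, if_false]
      exact (integrable_indicator_iff measurableSet_closedBall).2
        (integrableOn_const measure_closedBall_lt_top.ne)
  have hnn : ∀ k p, 0 ≤ h k p := by
    intro k p
    simp only [h]
    split_ifs
    · positivity
    · exact Set.indicator_nonneg (fun _ _ => zero_le_one) _
  refine (Integrable.fintype_prod (f := h) ih).mono'
    ((M.measurable_waveFactor n n').comp (measurable_walk _ hXm)).aestronglyMeasurable
    (ae_of_all _ fun y => ?_)
  rw [waveFactor]
  by_cases hw : walk M.ξ (X y) ∈ M.cutoffSet n n'
  · rw [Set.indicator_of_mem hw, Real.norm_of_nonneg (by positivity), walk_zeroOut, walk_zeroIn, ← hk₀,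
      hX.apply_chart, ← Finset.mul_prod_erase _ _ (Finset.mem_univ k₀)]
    have h1 : h k₀ (y k₀) = ‖M.ψhat (y k₀)‖ * ‖M.ψhat (y k₀ - M.ξ)‖ := if_pos rfl
    rw [h1]
    refine le_mul_of_one_le_right (by positivity) (le_of_eq (Finset.prod_eq_one fun k hk => ?_).symm)
    have hne := Finset.ne_of_mem_erase hk
    simp only [h, hne, if_false]
    refine Set.indicator_of_mem ?_ _
    rw [mem_closedBall_zero_iff]
    rcases hv : ι k with _ | v
    · exact absurd (hι.injective (hv.trans hk₀.symm)) hne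
    · have h2 := walk_edgeOut M.ξ (X y) v
      rw [← hv, hX.apply_chart] at h2
      have h3 : y k = walk M.ξ (X y) (edgeOut v) - walk M.ξ (X y) (edgeIn v) := by rw [h2]; abel
      rw [h3, two_mul]
      exact (norm_sub_le _ _).trans (add_le_add (hw _) (hw _))
  · rw [Set.indicator_of_notMem hw, norm_zero]
    exact Finset.prod_nonneg fun k _ => hnn _ _

end Setting

end Feynman

/-! ### Integration over gate momenta, and the cancellation. -/

namespace Feynman

namespace Setting

variable {d n n' : ℕ} {M : Setting d} {C : ℝ}

section Charts

variable {K : Type*} [Fintype K] {P : Lumps n n'} {ι : K → Option (Site n n')}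
  {X : (K → Mom d) → Option (Site n n') → Mom d}

theorem Regular.integrable_integrand (hM : M.Regular C) (hQm : Measurable M.Q) (hQ : ∀ p, ‖M.Q p‖ ≤ 1)
    (hι : IsChart P ι) (hX : IsParam P ι X) (hXm : ∀ o, Measurable fun y => X y o) (trunc : Bool)
    (α β : ℝ) : Integrable fun y => M.integrand trunc P α β (walk M.ξ (X y)) := by
  obtain ⟨B, hB⟩ := hM.exists_norm_integrand_le hQ trunc P
  refine ((M.integrable_waveFactor hι hX hXm).const_mul B).mono' ?_ (ae_of_all _ fun y => hB α β _)
  exact ((hM.measurable_integrand hQm trunc P).comp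
    ((measurable_const (a := (α, β))).prodMk (measurable_walk M.ξ hXm))).aestronglyMeasurable

theorem Regular.Vint_eq (hM : M.Regular C) (hQm : Measurable M.Q)
    (hι : IsChart P ι) (hX : IsParam P ι X) (hXm : ∀ o, Measurable fun y => X y o) (trunc : Bool)
    (α β : ℝ) : M.Vint trunc P α β = ∫ y, M.integrand trunc P α β (walk M.ξ (X y)) := by
  have hm : Measurable fun w => M.integrand trunc P α β w := by
    have h1 : Measurable fun w : EdgeMom d n n' => ((α, β), w) := measurable_prodMk_left
    have h2 := (hM.measurable_integrand hQm trunc P).comp h1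
    simp only [Function.comp_def] at h2
    exact h2
  have hw : Measurable fun y => walk M.ξ (X y) := measurable_walk M.ξ hXm
  have h : ∫ w, M.integrand trunc P α β w ∂(Measure.map (fun y => walk M.ξ (X y)) volume)
      = ∫ y, M.integrand trunc P α β (walk M.ξ (X y)) :=
    integral_map hw.aemeasurable hm.aestronglyMeasurable
  rw [← hι.graphMeasure_eq hX] at h
  refine Eq.trans ?_ h
  rw [Vint, ← integral_indicator (M.measurableSet_cutoffSet n n'), ← integral_const_mul]
  rfl

theorem Regular.integral_absIntegrand_eq (hM : M.Regular C)
    (hι : IsChart P ι) (hX : IsParam P ι X) (hXm : ∀ o, Measurable fun y => X y o) (trunc : Bool)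
    (G : Finset (Site n n')) (α β : ℝ) :
    ∫ y, M.absIntegrand trunc G α β (walk M.ξ (X y))
      = M.lam ^ (n + n') * ∫ w in M.cutoffSet n n',
      (∏ e ∈ propEdges trunc n n', 1 / ‖(energy n n' α β e : ℂ) - M.disp (w e) + Complex.I * M.η‖)
        * M.N G w ∂(graphMeasure M.ξ P fun _ => 0) := by
  have hm : Measurable fun w => M.absIntegrand trunc G α β w := by
    have h1 : Measurable fun w : EdgeMom d n n' => ((α, β), w) := measurable_prodMk_left
    have h2 := (hM.measurable_absIntegrand trunc G).comp h1
    simp only [Function.comp_def] at h2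
    exact h2
  have hw : Measurable fun y => walk M.ξ (X y) := measurable_walk M.ξ hXm
  have h : ∫ w, M.absIntegrand trunc G α β w ∂(Measure.map (fun y => walk M.ξ (X y)) volume)
      = ∫ y, M.absIntegrand trunc G α β (walk M.ξ (X y)) :=
    integral_map hw.aemeasurable hm.aestronglyMeasurable
  rw [← hι.graphMeasure_eq hX] at h
  refine h.symm.trans ?_
  rw [← integral_indicator (M.measurableSet_cutoffSet n n'), ← integral_const_mul]
  rfl

theorem Regular.integral_absIntegrand_le (hM : M.Regular C)
    (hι : IsChart P ι) (hX : IsParam P ι X) (hXm : ∀ o, Measurable fun y => X y o) (trunc : Bool)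
    {g : ℕ} {G : Finset (Site n n')} (hG : G.card ≤ g) (α β : ℝ) :
    ∫ y, M.absIntegrand trunc G α β (walk M.ξ (X y))
      ≤ M.Eint trunc g P (fun _ => 0) (energy n n' α β) := by
  rw [hM.integral_absIntegrand_eq hι hX hXm, Eint]
  refine mul_le_mul_of_nonneg_left ?_ (pow_nonneg hM.lam_pos.le _)
  exact le_ciSup (f := fun G : {G : Finset (Site n n') // G.card ≤ g} => ∫ w in M.cutoffSet n n',
      (∏ e ∈ propEdges trunc n n', 1 / ‖(energy n n' α β e : ℂ) - M.disp (w e) + Complex.I * M.η‖)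
        * M.N G.1 w ∂(graphMeasure M.ξ P fun _ => 0)) (Set.finite_range _).bddAbove ⟨G, hG⟩

end Charts

section Slots

/-- The factor of an insertion after integration over the momentum of the gate. -/
def slotBar (M : Setting d) (α β : ℝ) (e : Edge n n') (x : Insert) (q : Mom d) : ℂ :=
  match x with
  | Insert.gate => ∫ z, M.slotFac α β e Insert.gate q z
  | Insert.theta => M.slotFac α β e Insert.theta q 0

variable {υ : Edge n n' → ℕ}

/-- At fixed momenta of the old graph, each gate momentum occurs in exactly one factor, so the
integral splits. -/
theorem integral_prod_slotFac (M : Setting d) (α β : ℝ) (S : Slot υ → Insert) (w : EdgeMom d n n') :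
    ∫ z : {k // S k = Insert.gate} → Mom d, ∏ k : Slot υ, M.slotFac α β k.1 (S k) (w k.1) (gateExt S z k)
      = ∏ k : Slot υ, M.slotBar α β k.1 (S k) (w k.1) := by
  have h1 : ∀ z : {k // S k = Insert.gate} → Mom d,
      ∏ k : Slot υ, M.slotFac α β k.1 (S k) (w k.1) (gateExt S z k)
        = (∏ k : {k // S k = Insert.gate}, M.slotFac α β k.1.1 Insert.gate (w k.1.1) (z k))
          * ∏ k : {k // ¬S k = Insert.gate}, M.slotFac α β k.1.1 Insert.theta (w k.1.1) 0 := by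
    intro z
    rw [← Fintype.prod_subtype_mul_prod_subtype fun k => S k = Insert.gate]
    congr 1
    · refine Finset.prod_congr rfl fun k _ => ?_
      simp only [k.2, gateExt, dif_pos]
    · refine Finset.prod_congr rfl fun k _ => ?_
      have hk : S k.1 = Insert.theta := by
        have := k.2
        revert this
        cases S k.1 <;> simp
      simp [gateExt, hk]
  simp only [h1]
  rw [integral_mul_const, integral_fintype_prod_volume_eq_prod
    (fun (k : {k // S k = Insert.gate}) z => M.slotFac α β k.1.1 Insert.gate (w k.1.1) z),
    ← Fintype.prod_subtype_mul_prod_subtype fun k => S k = Insert.gate]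
  congr 1
  · refine Finset.prod_congr rfl fun k _ => ?_
    simp only [k.2, slotBar]
  · refine Finset.prod_congr rfl fun k _ => ?_
    have hk : S k.1 = Insert.theta := by
      have := k.2
      revert this
      cases S k.1 <;> simp
    simp only [hk, slotBar]

theorem measurable_extInc {K : Type*} [Fintype K] {X : (K → Mom d) → Option (Site n n') → Mom d}
    (hXm : ∀ o, Measurable fun y => X y o) (S : Slot υ → Insert)
    (o : Option (Site (leftWord S).length (rightWord S).length)) :
    Measurable fun y : K ⊕ {k // S k = Insert.gate} → Mom d =>
      extInc S (X fun k => y (Sum.inl k)) (gateExt S fun g => y (Sum.inr g)) o := by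
  have h1 : Measurable fun (y : K ⊕ {k // S k = Insert.gate} → Mom d) k => y (Sum.inl k) :=
    measurable_pi_iff.2 fun k => measurable_pi_apply _
  have h2 : Measurable fun (y : K ⊕ {k // S k = Insert.gate} → Mom d) g => y (Sum.inr g) :=
    measurable_pi_iff.2 fun k => measurable_pi_apply _
  rcases o with _ | v
  · exact (hXm none).comp h1
  · simp only [extInc]
    rcases label S v with s | ⟨k, b⟩
    · exact (hXm (some s)).comp h1
    · have h3 := (measurable_gateExt (d := d) S k).comp h2
      simp only [labelInc]
      cases b
      · exact h3
      · exact h3.neg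

variable {K : Type*} [Fintype K] {P : Lumps n n'} {ι : K → Option (Site n n')}
  {X : (K → Mom d) → Option (Site n n') → Mom d}

/-- Integration over the momenta of the gates. -/
theorem Regular.Vint_extendLumps (hM : M.Regular C) (hQm : Measurable M.Q) (hQ : ∀ p, ‖M.Q p‖ ≤ 1)
    (hι : IsChart P ι) (hX : IsParam P ι X) (hXm : ∀ o, Measurable fun y => X y o) (trunc : Bool)
    (S : Slot υ → Insert) (α β : ℝ) :
    Integrable (fun y => M.integrand trunc P α β (walk M.ξ (X y))
        * ∏ k : Slot υ, M.slotBar α β k.1 (S k) (walk M.ξ (X y) k.1)) ∧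
      M.Vint trunc (extendLumps P S) α β = ∫ y, M.integrand trunc P α β (walk M.ξ (X y))
        * ∏ k : Slot υ, M.slotBar α β k.1 (S k) (walk M.ξ (X y) k.1) := by
  have hι' := hι.extChart S
  have hX' := hX.extInc S
  have hXm' := measurable_extInc hXm S
  have hint := hM.integrable_integrand hQm hQ hι' hX' hXm' trunc α β
  have hV := hM.Vint_eq hQm hι' hX' hXm' trunc α β
  have mp := volume_measurePreserving_sumPiEquivProdPi_symm
    (fun _ : K ⊕ {k // S k = Insert.gate} => Mom d)
  rw [← mp.integral_comp' (g := fun y => M.integrand trunc (extendLumps P S) α β (walk M.ξ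
    (extInc S (X fun k => y (Sum.inl k)) (gateExt S fun g => y (Sum.inr g)))))] at hV
  have hint' := (mp.integrable_comp_emb (MeasurableEquiv.measurableEmbedding _)).2 hint
  have key : ∀ q : (K → Mom d) × ({k // S k = Insert.gate} → Mom d),
      M.integrand trunc (extendLumps P S) α β (walk M.ξ (extInc S (X fun k =>
        (MeasurableEquiv.sumPiEquivProdPi fun _ : K ⊕ {k // S k = Insert.gate} => Mom d).symm q (Sum.inl k))
        (gateExt S fun g =>
        (MeasurableEquiv.sumPiEquivProdPi fun _ : K ⊕ {k // S k = Insert.gate} => Mom d).symm q (Sum.inr g))))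
      = M.integrand trunc P α β (walk M.ξ (X q.1))
        * ∏ k : Slot υ, M.slotFac α β k.1 (S k) (walk M.ξ (X q.1) k.1) (gateExt S q.2 k) := by
    rintro ⟨y, z⟩
    exact hM.integrand_extendLumps trunc P S α β (X y) (gateExt S z)
      fun k hk => dif_neg (by rw [hk]; simp)
  have e : ∀ y, ∫ z, M.integrand trunc P α β (walk M.ξ (X y))
        * ∏ k : Slot υ, M.slotFac α β k.1 (S k) (walk M.ξ (X y) k.1) (gateExt S z k)
      = M.integrand trunc P α β (walk M.ξ (X y))
        * ∏ k : Slot υ, M.slotBar α β k.1 (S k) (walk M.ξ (X y) k.1) := by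
    intro y
    rw [integral_const_mul, integral_prod_slotFac]
  simp only [key] at hV
  have hint2 : Integrable (fun q : (K → Mom d) × ({k // S k = Insert.gate} → Mom d) =>
      M.integrand trunc P α β (walk M.ξ (X q.1))
        * ∏ k : Slot υ, M.slotFac α β k.1 (S k) (walk M.ξ (X q.1) k.1) (gateExt S q.2 k))
      (volume.prod volume) := by
    refine hint'.congr (ae_of_all _ fun q => ?_)
    exact key q
  constructor
  · have := hint2.integral_prod_left
    simpa only [e] using this
  · rw [hV]
    have := integral_prod _ hint2
    simp only [e] at this
    exact this

theorem edgeL_eq_conj (M : Setting d) (α : ℝ) (q : Mom d) : M.edgeL α q = conj (M.edgeR α q) := by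
  have : conj (M.cut q) = M.cut q := by unfold cut; split_ifs <;> simp
  rw [edgeL, edgeR, map_mul, this, map_div₀, map_one, conj_resolvent]

/-- The reflection `z ↦ -z` and the evenness of the potential reduce the first arc to the second. -/
theorem Regular.integral_edgeL (hM : M.Regular C) (α : ℝ) (q : Mom d) :
    ∫ z, M.edgeL α (q + z) * (‖M.Bhat z‖ ^ 2 : ℂ)
          = conj (∫ z, M.edgeR α (q - z) * (‖M.Bhat z‖ ^ 2 : ℂ)) := by
  have h0 : ∫ z, M.edgeL α (q + -z) * (‖M.Bhat (-z)‖ ^ 2 : ℂ) =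
     ∫ z, M.edgeL α (q + z) * (‖M.Bhat z‖ ^ 2 : ℂ) :=
     integral_neg_eq_self (μ := volume) (fun z => M.edgeL α (q + z) * (‖M.Bhat z‖ ^ 2 : ℂ)) 
  rw [← h0]
  have h3 : ∫ z, conj (M.edgeR α (q - z) * (‖M.Bhat z‖ ^ 2 : ℂ)) =  conj (∫ z, M.edgeR α (q - z) * (‖M.Bhat z‖ ^ 2 : ℂ)) := integral_conj
  rw [← h3]
  congr 1
  funext z
  rw [hM.Bhat_neg, edgeL_eq_conj, map_mul, map_pow, Complex.conj_ofReal, ← sub_eq_add_neg]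
/-- The cancellation between a gate and a self-energy label. -/
theorem Regular.norm_slotBar_add_le (hM : M.Regular C) (α β : ℝ) (e : Edge n n') {q : Mom d}
    (hq : ‖q‖ + M.lam ^ (-M.δ) ≤ M.ζ) :
    ‖M.slotBar α β e Insert.gate q + M.slotBar α β e Insert.theta q‖
      ≤ C * M.lam ^ 2 * M.η ^ (-(1 / 2) : ℝ) := by
  have hlam : 0 ≤ M.lam ^ (-M.δ) := Real.rpow_nonneg hM.lam_pos.le _
  have hcut : M.cut q = 1 := if_pos (by linarith)
  -- The potential vanishes beyond `λ^{-δ}`, and up to there the inner momentum of the gate lies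
  -- below `ζ` by `hq`; the cutoff on the inner edge can be dropped.
  have hR : ∀ a : ℝ, ∫ z, M.edgeR a (q - z) * (‖M.Bhat z‖ ^ 2 : ℂ)
      = ∫ p, (‖M.Bhat (p - q)‖ ^ 2 : ℂ) / ((a : ℂ) - M.disp p + Complex.I * M.η) := by
    intro a
    rw [← integral_sub_left_eq_self (fun p => (‖M.Bhat (p - q)‖ ^ 2 : ℂ)
      / ((a : ℂ) - M.disp p + Complex.I * M.η)) volume q]
    congr 1; ext z
    rw [sub_sub_cancel_left, hM.Bhat_neg, edgeR]
    by_cases hz : M.lam ^ (-M.δ) < ‖z‖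
    · rw [hM.Bhat_eq_zero z hz]; simp
    · have : M.cut (q - z) = 1 := if_pos ((norm_sub_le _ _).trans (by linarith))
      rw [this]; ring
  -- The modulus of the denominator in the gate estimate cancels the outer propagator.
  have key : ∀ a : ℝ, ‖(M.lam : ℂ) ^ 2 * M.edgeR a q
        * ((∫ z, M.edgeR a (q - z) * (‖M.Bhat z‖ ^ 2 : ℂ)) - M.θ q)‖
      ≤ C * M.lam ^ 2 * M.η ^ (-(1 / 2) : ℝ) := by
    intro a
    have h0 := hM.η_pos.trans_le (hM.le_norm_resolvent a q)
    rw [hR, norm_mul, norm_mul, edgeR, hcut, one_mul, norm_div, norm_one, norm_pow, Complex.norm_real,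
      Real.norm_of_nonneg hM.lam_pos.le]
    refine (mul_le_mul_of_nonneg_left (hM.norm_gate_sub_le a q) (by positivity)).trans_eq ?_
    field_simp
  rcases e with i | j
  · have h1 : M.slotBar α β (Sum.inl i : Edge n n') Insert.gate q
        = conj ((M.lam : ℂ) ^ 2 * M.edgeR α q * ∫ z, M.edgeR α (q - z) * (‖M.Bhat z‖ ^ 2 : ℂ)) := by
      simp only [slotBar, slotFac, mul_assoc]
      rw [integral_const_mul, integral_const_mul, hM.integral_edgeL, edgeL_eq_conj]
      simp only [map_mul, map_pow, Complex.conj_ofReal]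
    have h2 : M.slotBar α β (Sum.inl i : Edge n n') Insert.theta q
        = conj (-((M.lam : ℂ) ^ 2 * M.edgeR α q * M.θ q)) := by
      simp only [slotBar, slotFac, edgeL_eq_conj, map_neg, map_mul, map_pow, Complex.conj_ofReal]
      ring
    rw [h1, h2, ← map_add, RCLike.norm_conj, ← sub_eq_add_neg, ← mul_sub]
    exact key α
  · have h1 : M.slotBar α β (Sum.inr j : Edge n n') Insert.gate q
        = (M.lam : ℂ) ^ 2 * M.edgeR β q * ∫ z, M.edgeR β (q - z) * (‖M.Bhat z‖ ^ 2 : ℂ) := by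
      simp only [slotBar, slotFac, mul_assoc]
      rw [integral_const_mul, integral_const_mul]
    have h2 : M.slotBar α β (Sum.inr j : Edge n n') Insert.theta q
        = -((M.lam : ℂ) ^ 2 * M.edgeR β q * M.θ q) := by
      simp only [slotBar, slotFac]
      ring
    rw [h1, h2, ← sub_eq_add_neg, ← mul_sub]
    exact key β

end Slots

section Support

variable {K : Type*} {P : Lumps n n'} {ι : K → Option (Site n n')}
  {X : (K → Mom d) → Option (Site n n') → Mom d}

theorem norm_psum_le {m : ℕ} {x : Fin m → Mom d} {r : ℝ} (hr : 0 ≤ r) (h : ∀ k, ‖x k‖ ≤ r)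
    (i : Fin (m + 1)) : ‖psum x i‖ ≤ m * r := by
  have h1 : ∀ k, ‖if k.castSucc < i then x k else 0‖ ≤ r := fun k => by
    split_ifs
    · exact h k
    · simpa using hr
  calc ‖psum x i‖ ≤ ∑ k, ‖if k.castSucc < i then x k else 0‖ := norm_sum_le _ _
    _ ≤ ∑ _k : Fin m, r := Finset.sum_le_sum fun k _ => h1 k
    _ = m * r := by simp

theorem inc_eq_zero_of_single (hX : IsParam P ι X) (y : K → Mom d) {v : Site n n'} (hv : v ∈ singles P) :
    X y (some v) = 0 := by
  have : P.part v = {v} := Finset.eq_singleton_iff_unique_mem.2 ⟨mem_part_self P v, mem_singles_iff.1 hv⟩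
  have h := hX.sum_part y v
  rwa [this, Finset.sum_singleton] at h

/-- Where the integrand does not vanish, the increments are bounded by the range of the potential. -/
theorem Regular.norm_walk_le (hM : M.Regular C) (hX : IsParam P ι X) (y : K → Mom d) {R : ℝ}
    (h1 : R < ‖X y none‖ → M.ψhat (X y none) = 0)
    (h2 : R < ‖X y none - M.ξ‖ → M.ψhat (X y none - M.ξ) = 0) (trunc : Bool) (α β : ℝ)
    (hne : M.integrand trunc P α β (walk M.ξ (X y)) ≠ 0) (e : Edge n n') :
    ‖walk M.ξ (X y) e‖ ≤ R + (max n n' : ℕ) * M.lam ^ (-M.δ) := by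
  have hlam : 0 ≤ M.lam ^ (-M.δ) := Real.rpow_nonneg hM.lam_pos.le _
  have hc : M.calM P (walk M.ξ (X y)) ≠ 0 := by
    intro h0
    apply hne
    rw [integrand, indicator_cutoffSet, h0]
    simp
  rw [calM, walk_zeroOut, walk_zeroIn] at hc
  simp only [mul_ne_zero_iff, Finset.prod_ne_zero_iff] at hc
  obtain ⟨⟨⟨hv, hp⟩, hp'⟩, _⟩ := hc
  -- Increments vanish at single lumps; elsewhere the factor of the vertex is nonzero only within
  -- the range of the potential.
  have hinc : ∀ v, ‖X y (some v)‖ ≤ M.lam ^ (-M.δ) := by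
    intro v
    by_cases hs : v ∈ singles P
    · rw [inc_eq_zero_of_single hX y hs, norm_zero]; exact hlam
    · by_contra hlt
      have h3 : M.Bhat (walk M.ξ (X y) (edgeIn v) - walk M.ξ (X y) (edgeOut v)) = 0 := by
        rw [walk_edgeOut, sub_add_cancel_left, hM.Bhat_neg]
        exact hM.Bhat_eq_zero _ (not_le.1 hlt)
      refine hv v (Finset.mem_univ v) ?_
      unfold vertexFactor
      rcases v with i | j <;> simp [hs, h3]
  have hb : ‖X y none‖ ≤ R := not_lt.1 fun h => hp (by rw [h1 h, map_zero])
  have hb' : ‖X y none - M.ξ‖ ≤ R := not_lt.1 fun h => hp' (h2 h)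
  rcases e with i | j
  · refine (norm_add_le _ _).trans (add_le_add hb ((norm_psum_le hlam (fun k => hinc _) i).trans ?_))
    exact mul_le_mul_of_nonneg_right (by exact_mod_cast le_max_left n n') hlam
  · refine (norm_add_le _ _).trans (add_le_add hb' ((norm_psum_le hlam
      (fun k => (norm_neg _).trans_le (hinc _)) j).trans ?_))
    exact mul_le_mul_of_nonneg_right (by exact_mod_cast le_max_right n n') hlam

/-- The integrand of the `V`-value is bounded by the one of the `E`-value in which the single lumps
carry the weights. -/
theorem Regular.norm_integrand_le (hM : M.Regular C) (hQ : ∀ p, ‖M.Q p‖ ≤ 1) (hX : IsParam P ι X)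
    (hC : M.lam * C ≤ (bracket (0 : Mom d)) ^ (-(2 * d : ℤ))) (trunc : Bool) (α β : ℝ) (y : K → Mom d) :
    ‖M.integrand trunc P α β (walk M.ξ (X y))‖
      ≤ M.absIntegrand trunc (singles P) α β (walk M.ξ (X y)) := by
  classical
  set w := walk M.ξ (X y) with hw
  have hl := hM.lam_pos
  rw [integrand, absIntegrand, norm_mul, norm_pow, Complex.norm_real, Real.norm_of_nonneg hl.le, pow_add,
    mul_assoc]
  refine mul_le_mul_of_nonneg_left ?_ (pow_nonneg hl.le _)
  by_cases hcut : w ∈ M.cutoffSet n n'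
  · rw [Set.indicator_of_mem hcut, Set.indicator_of_mem hcut, calM, norm_mul, norm_mul, norm_mul, norm_mul,
      norm_prod, norm_prod, RCLike.norm_conj, N]
    simp only [norm_prop]
    have hv : ∀ v, ‖M.vertexFactor P w v‖ = if v ∈ singles P then ‖M.θ (w (edgeIn v))‖
        else ‖M.Bhat (w (edgeIn v) - w (edgeOut v))‖ := by
      rintro (i | j)
      · unfold vertexFactor
        rw [RCLike.norm_conj]
        split_ifs <;> simp
      · unfold vertexFactor
        split_ifs <;> simp
    have h1 : M.lam ^ numSingles P * ∏ v, ‖M.vertexFactor P w v‖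
        ≤ (∏ v ∈ (singles P)ᶜ, ‖M.Bhat (w (edgeIn v) - w (edgeOut v))‖)
          * ∏ v ∈ singles P, bracket (w (edgeIn v) - w (edgeOut v)) ^ (-(2 * d : ℤ)) := by
      have h2 : ∏ v, ‖M.vertexFactor P w v‖ = (∏ v ∈ singles P, ‖M.θ (w (edgeIn v))‖)
          * ∏ v ∈ (singles P)ᶜ, ‖M.Bhat (w (edgeIn v) - w (edgeOut v))‖ := by
        rw [← Finset.prod_mul_prod_compl (singles P)]
        congr 1
        · exact Finset.prod_congr rfl fun v hvs => by rw [hv, if_pos hvs]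
        · exact Finset.prod_congr rfl fun v hvs => by rw [hv, if_neg (Finset.mem_compl.1 hvs)]
      rw [h2, numSingles, ← Finset.prod_const, ← mul_assoc, ← Finset.prod_mul_distrib, mul_comm]
      refine mul_le_mul_of_nonneg_left (Finset.prod_le_prod (fun v _ => by positivity) fun v hvs => ?_)
        (Finset.prod_nonneg fun v _ => norm_nonneg _)
      -- At a single lump momentum is conserved, so the weight is the constant `⟨0⟩^{-2d}`, and `hC`
      -- applies.
      have h3 : w (edgeIn v) - w (edgeOut v) = 0 := by
        rw [hw, walk_edgeOut, inc_eq_zero_of_single hX y hvs, add_zero, sub_self]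
      rw [h3]
      exact (mul_le_mul_of_nonneg_left (hM.norm_θ_le _) hl.le).trans hC
    have h4 := hQ ((1 / 2 : ℝ) • (w (starIn n n') + w (starOut n n')))
    set A := ∏ e ∈ propEdges trunc n n', 1 / ‖(energy n n' α β e : ℂ) - M.disp (w e) + Complex.I * M.η‖
    have hA : 0 ≤ A := Finset.prod_nonneg fun e _ => by positivity
    set V := ∏ v, ‖M.vertexFactor P w v‖
    have hV : 0 ≤ V := Finset.prod_nonneg fun v _ => norm_nonneg _
    set a := ‖M.ψhat (w (zeroOut n n'))‖
    set b := ‖M.ψhat (w (zeroIn n n'))‖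
    have ha : 0 ≤ a := norm_nonneg _
    have hb : 0 ≤ b := norm_nonneg _
    calc M.lam ^ numSingles P * (A * (V * a * b * ‖M.Q ((1 / 2 : ℝ) • (w (starIn n n') + w (starOut n n')))‖))
        ≤ M.lam ^ numSingles P * (A * (V * a * b * 1)) := by gcongr
      _ = A * (a * b * (M.lam ^ numSingles P * V)) := by ring
      _ ≤ A * (a * b * _) := mul_le_mul_of_nonneg_left (mul_le_mul_of_nonneg_left h1 (by positivity)) hA
      _ = _ := by ring
  · rw [Set.indicator_of_notMem hcut, Set.indicator_of_notMem hcut, norm_zero, mul_zero]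

end Support

end Setting

end Feynman

/-! ### Summation over the insertions and integration over the energies. -/

namespace Feynman

theorem intervalIntegral_intervalIntegral_eq {E : Type*} [NormedAddCommGroup E] [NormedSpace ℝ E]
    {f : ℝ × ℝ → E} {Y : ℝ} (hY : 0 ≤ Y)
    (hf : IntegrableOn f (Set.Ioc (-Y) Y ×ˢ Set.Ioc (-Y) Y)) :
    ∫ α in (-Y)..Y, ∫ β in (-Y)..Y, f (α, β) = ∫ q in Set.Ioc (-Y) Y ×ˢ Set.Ioc (-Y) Y, f q := by
  have h := setIntegral_prod f (μ := volume) (ν := volume) hf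
  rw [← Measure.volume_eq_prod] at h
  rw [h]
  simp only [intervalIntegral.integral_of_le (neg_le_self hY)]

theorem integrableOn_square_of_bounded {E : Type*} [NormedAddCommGroup E] {f : ℝ × ℝ → E}
    (hf : StronglyMeasurable f) (hb : ∃ K, ∀ q, ‖f q‖ ≤ K) (Y : ℝ) :
    IntegrableOn f (Set.Ioc (-Y) Y ×ˢ Set.Ioc (-Y) Y) := by
  obtain ⟨K, hK⟩ := hb
  refine Measure.integrableOn_of_bounded (M := K) ?_ hf.aestronglyMeasurable (ae_of_all _ hK)
  rw [Measure.volume_eq_prod, Measure.prod_prod]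
  exact ENNReal.mul_ne_top measure_Ioc_lt_top.ne measure_Ioc_lt_top.ne

theorem sum_insert {A : Type*} [AddCommMonoid A] (f : Insert → A) :
    ∑ x, f x = f Insert.gate + f Insert.theta := by
  have : (Finset.univ : Finset Insert) = {Insert.gate, Insert.theta} := by
    ext x; cases x <;> simp
  rw [this, Finset.sum_pair (by simp)]

theorem card_slot {n n' : ℕ} (υ : Edge n n' → ℕ) : Fintype.card (Slot υ) = ∑ e, υ e := by
  rw [Fintype.card_sigma]
  simp only [Fintype.card_fin]

namespace Setting

variable {d n n' : ℕ} {M : Setting d} {C : ℝ}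

section Energies

theorem Regular.stronglyMeasurable_Vint (hM : M.Regular C) (hQm : Measurable M.Q) (trunc : Bool)
    (P : Lumps n n') : StronglyMeasurable fun q : ℝ × ℝ => M.Vint trunc P q.1 q.2 := by
  obtain ⟨K, _, ι, hι⟩ := exists_isChart P
  have hX := isParam_fullInc (d := d) hι
  have hXm := measurable_fullInc (d := d) (P := P) ι 0
  simp only [hM.Vint_eq hQm hι hX hXm trunc]
  have h1 : Measurable fun q : (ℝ × ℝ) × (K → Mom d) => (q.1, walk M.ξ (fullInc P ι q.2 0)) :=
    measurable_fst.prodMk ((measurable_walk M.ξ hXm).comp measurable_snd)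
  have h2 := (hM.measurable_integrand hQm trunc P).comp h1
  simp only [Function.comp_def] at h2
  exact h2.stronglyMeasurable.integral_prod_right' (ν := volume)

theorem Regular.exists_norm_Vint_le (hM : M.Regular C) (hQm : Measurable M.Q) (hQ : ∀ p, ‖M.Q p‖ ≤ 1)
    (trunc : Bool) (P : Lumps n n') : ∃ K, ∀ q : ℝ × ℝ, ‖M.Vint trunc P q.1 q.2‖ ≤ K := by
  obtain ⟨K, _, ι, hι⟩ := exists_isChart P
  have hX := isParam_fullInc (d := d) hι
  have hXm := measurable_fullInc (d := d) (P := P) ι 0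
  obtain ⟨B, hB⟩ := hM.exists_norm_integrand_le hQ trunc P
  refine ⟨∫ y, B * M.waveFactor n n' (walk M.ξ (fullInc P ι y 0)), fun q => ?_⟩
  rw [hM.Vint_eq hQm hι hX hXm trunc]
  exact norm_integral_le_of_norm_le ((M.integrable_waveFactor hι hX hXm).const_mul B)
    (ae_of_all _ fun y => hB _ _ _)

theorem Regular.Eint_eq (hM : M.Regular C) {K : Type*} [Fintype K] {P : Lumps n n'}
    {ι : K → Option (Site n n')} {X : (K → Mom d) → Option (Site n n') → Mom d}
    (hι : IsChart P ι) (hX : IsParam P ι X) (hXm : ∀ o, Measurable fun y => X y o) (trunc : Bool)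
    (g : ℕ) (α β : ℝ) :
    M.Eint trunc g P (fun _ => 0) (energy n n' α β)
      = ⨆ G : {G : Finset (Site n n') // G.card ≤ g}, ∫ y, M.absIntegrand trunc G.1 α β (walk M.ξ (X y)) := by
  simp only [hM.integral_absIntegrand_eq hι hX hXm]
  rw [← Real.mul_iSup_of_nonneg (pow_nonneg hM.lam_pos.le _), Eint]

theorem Regular.measurable_Eint (hM : M.Regular C) (trunc : Bool) (g : ℕ) (P : Lumps n n') :
    Measurable fun q : ℝ × ℝ => M.Eint trunc g P (fun _ => 0) (energy n n' q.1 q.2) := by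
  obtain ⟨K, _, ι, hι⟩ := exists_isChart P
  have hX := isParam_fullInc (d := d) hι
  have hXm := measurable_fullInc (d := d) (P := P) ι 0
  simp only [hM.Eint_eq hι hX hXm trunc]
  refine Measurable.iSup fun G => ?_
  have h1 : Measurable fun q : (ℝ × ℝ) × (K → Mom d) => (q.1, walk M.ξ (fullInc P ι q.2 0)) :=
    measurable_fst.prodMk ((measurable_walk M.ξ hXm).comp measurable_snd)
  have h2 := (hM.measurable_absIntegrand trunc G.1).comp h1
  simp only [Function.comp_def] at h2
  exact (h2.stronglyMeasurable.integral_prod_right' (ν := volume)).measurable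

theorem Regular.exists_norm_Eint_le (hM : M.Regular C) (trunc : Bool) (g : ℕ) (P : Lumps n n') :
    ∃ K, ∀ q : ℝ × ℝ, ‖M.Eint trunc g P (fun _ => 0) (energy n n' q.1 q.2)‖ ≤ K := by
  obtain ⟨K, _, ι, hι⟩ := exists_isChart P
  have hX := isParam_fullInc (d := d) hι
  have hXm := measurable_fullInc (d := d) (P := P) ι 0
  choose B hB using hM.exists_absIntegrand_le (n := n) (n' := n') trunc
  have hw := M.integrable_waveFactor hι hX hXm
  have : Nonempty {G : Finset (Site n n') // G.card ≤ g} := ⟨⟨∅, by simp⟩⟩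
  refine ⟨⨆ G : {G : Finset (Site n n') // G.card ≤ g},
    ∫ y, B G.1 * M.waveFactor n n' (walk M.ξ (fullInc P ι y 0)), fun q => ?_⟩
  rw [hM.Eint_eq hι hX hXm trunc, Real.norm_of_nonneg (Real.iSup_nonneg fun G =>
    integral_nonneg fun y => hM.absIntegrand_nonneg trunc _ _ _ _)]
  refine ciSup_mono (Set.finite_range _).bddAbove fun G => ?_
  exact integral_mono_of_nonneg (ae_of_all _ fun y => hM.absIntegrand_nonneg trunc _ _ _ _)
    (hw.const_mul _) (ae_of_all _ fun y => hB _ _ _ _)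

end Energies

variable {υ : Edge n n' → ℕ}

/-- The sum over all insertions at fixed energies. -/
theorem Regular.norm_sum_Vint_le (hM : M.Regular C) (hQm : Measurable M.Q) (hQ : ∀ p, ‖M.Q p‖ ≤ 1)
    {R : ℝ} (hR : ∀ᵐ p : Mom d, R < ‖p‖ → M.ψhat p = 0)
    (hζ : R + (max n n' : ℕ) * M.lam ^ (-M.δ) + M.lam ^ (-M.δ) ≤ M.ζ)
    (hC : M.lam * C ≤ (bracket (0 : Mom d)) ^ (-(2 * d : ℤ))) (trunc : Bool) (P : Lumps n n') (α β : ℝ) :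
    ‖∑ S : Slot υ → Insert, M.Vint trunc (extendLumps P S) α β‖
      ≤ (C * M.lam ^ 2 * M.η ^ (-(1 / 2) : ℝ)) ^ (∑ e, υ e)
        * M.Eint trunc (numSingles P) P (fun _ => 0) (energy n n' α β) := by
  classical
  obtain ⟨K, _, ι, hι⟩ := exists_isChart P
  have hX := isParam_fullInc (d := d) hι
  have hXm := measurable_fullInc (d := d) (P := P) ι 0
  set X : (K → Mom d) → Option (Site n n') → Mom d := fun y => fullInc P ι y 0
  have hηp : 0 ≤ M.η ^ (-(1 / 2) : ℝ) := Real.rpow_nonneg hM.η_pos.le _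
  have hC0 := hM.const_nonneg
  set ρ := C * M.lam ^ 2 * M.η ^ (-(1 / 2) : ℝ)
  have hρ : 0 ≤ ρ := by positivity
  have hV := fun S : Slot υ → Insert => hM.Vint_extendLumps hQm hQ hι hX hXm trunc S α β
  -- The slots are independent, so the sum over all `S` of products is the product over the slots of
  -- gate plus `ϑ`.
  have hsum : ∑ S : Slot υ → Insert, M.Vint trunc (extendLumps P S) α β
      = ∫ y, M.integrand trunc P α β (walk M.ξ (X y)) * ∏ k : Slot υ,
        (M.slotBar α β k.1 Insert.gate (walk M.ξ (X y) k.1)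
          + M.slotBar α β k.1 Insert.theta (walk M.ξ (X y) k.1)) := by
    rw [Finset.sum_congr rfl fun S _ => (hV S).2, ← integral_finsetSum _ fun S _ => (hV S).1]
    refine integral_congr_ae (ae_of_all _ fun y => ?_)
    dsimp only
    rw [← Finset.mul_sum, ← Fintype.prod_sum
      (f := fun (k : Slot υ) x => M.slotBar α β k.1 x (walk M.ξ (X y) k.1))]
    simp only [sum_insert]
  obtain ⟨k₀, hk₀⟩ := hι.base
  have hnone : ∀ y, X y none = y k₀ := fun y => by rw [← hk₀, hX.apply_chart]
  have hev := Measure.quasiMeasurePreserving_eval (fun _ : K => (volume : Measure (Mom d))) k₀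
  -- The support condition on the wave function holds almost everywhere only, and is pulled back
  -- along the base coordinate and its shift by `ξ`.
  have ae1 : ∀ᵐ y : K → Mom d, R < ‖y k₀‖ → M.ψhat (y k₀) = 0 := hev.ae hR
  have ae2 : ∀ᵐ y : K → Mom d, R < ‖y k₀ - M.ξ‖ → M.ψhat (y k₀ - M.ξ) = 0 :=
    hev.ae ((measurePreserving_sub_right volume M.ξ).quasiMeasurePreserving.ae hR)
  have hint := hM.integrable_integrand hQm hQ hι hX hXm trunc α β
  rw [hsum, ← card_slot]
  refine (norm_integral_le_of_norm_le (hint.norm.const_mul (ρ ^ Fintype.card (Slot υ))) ?_).trans ?_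
  · filter_upwards [ae1, ae2] with y h1 h2
    rw [norm_mul, mul_comm]
    by_cases hne : M.integrand trunc P α β (walk M.ξ (X y)) = 0
    · rw [hne, norm_zero, mul_zero, mul_zero]
    · refine mul_le_mul_of_nonneg_right ?_ (norm_nonneg _)
      rw [norm_prod, ← Finset.card_univ]
      refine (Finset.prod_le_prod (fun k _ => norm_nonneg _) fun k _ => ?_).trans_eq
        (Finset.prod_const ρ)
      -- Needed only where the integrand of `P` does not vanish, and there all edge momenta leave
      -- room for one more step `λ^{-δ}` below `ζ`.
      refine hM.norm_slotBar_add_le α β k.1 (le_trans (add_le_add_left ?_ _) hζ)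
      exact hM.norm_walk_le hX y (by rw [hnone]; exact h1) (by rw [hnone]; exact h2) trunc α β hne k.1
  · rw [integral_const_mul]
    refine mul_le_mul_of_nonneg_left ?_ (pow_nonneg hρ _)
    refine le_trans ?_ (hM.integral_absIntegrand_le hι hX hXm trunc (g := numSingles P)
      (G := singles P) le_rfl α β)
    obtain ⟨B, hB⟩ := hM.exists_absIntegrand_le trunc (singles P)
    refine integral_mono hint.norm ?_ fun y => hM.norm_integrand_le hQ hX hC trunc α β y
    refine ((M.integrable_waveFactor hι hX hXm).const_mul B).mono' ?_ (ae_of_all _ fun y => ?_)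
    · have h1 : Measurable fun y => ((α, β), walk M.ξ (X y)) :=
        measurable_const.prodMk (measurable_walk M.ξ hXm)
      have h2 := (hM.measurable_absIntegrand trunc (singles P)).comp h1
      simp only [Function.comp_def] at h2
      exact h2.aestronglyMeasurable
    · rw [Real.norm_of_nonneg (hM.absIntegrand_nonneg trunc _ _ _ _)]
      exact hB _ _ _

/-- The sum of the values of all graphs with prescribed numbers of insertions. -/
theorem Regular.norm_sum_V_le (hM : M.Regular C) (hQm : Measurable M.Q) (hQ : ∀ p, ‖M.Q p‖ ≤ 1)
    {R : ℝ} (hR : ∀ᵐ p : Mom d, R < ‖p‖ → M.ψhat p = 0)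
    (hζ : R + (max n n' : ℕ) * M.lam ^ (-M.δ) + M.lam ^ (-M.δ) ≤ M.ζ)
    (hC : M.lam * C ≤ (bracket (0 : Mom d)) ^ (-(2 * d : ℤ))) (trunc : Bool) (P : Lumps n n')
    (υ : Edge n n' → ℕ) :
    ‖∑ S : Slot υ → Insert, M.V trunc (extendLumps P S)‖
      ≤ (C * M.lam ^ 2 * M.η ^ (-(1 / 2) : ℝ)) ^ (∑ e, υ e) * M.E trunc (numSingles P) P := by
  have hY : 0 ≤ M.Y := (zpow_pos hM.lam_pos _).le
  set A : ℝ := Real.exp (2 * M.t * M.η) / (2 * Real.pi) ^ 2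
  have hA : 0 ≤ A := by positivity
  set ρ := (C * M.lam ^ 2 * M.η ^ (-(1 / 2) : ℝ)) ^ (∑ e, υ e)
  have hphase : ∀ q : ℝ × ℝ, ‖Complex.exp (Complex.I * M.t * (q.1 - q.2))‖ = 1 := by
    intro q
    have : Complex.I * M.t * (q.1 - q.2) = ((M.t * (q.1 - q.2) : ℝ) : ℂ) * Complex.I := by
      push_cast; ring
    rw [this, Complex.norm_exp_ofReal_mul_I]
  have hphm : StronglyMeasurable fun q : ℝ × ℝ => Complex.exp (Complex.I * M.t * (q.1 - q.2)) := by
    have : Continuous fun q : ℝ × ℝ => Complex.exp (Complex.I * M.t * (q.1 - q.2)) := by fun_prop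
    exact this.stronglyMeasurable
  have hi : ∀ S : Slot υ → Insert, IntegrableOn (fun q : ℝ × ℝ =>
      Complex.exp (Complex.I * M.t * (q.1 - q.2)) * M.Vint trunc (extendLumps P S) q.1 q.2)
      (Set.Ioc (-M.Y) M.Y ×ˢ Set.Ioc (-M.Y) M.Y) := by
    intro S
    refine integrableOn_square_of_bounded (hphm.mul (hM.stronglyMeasurable_Vint hQm trunc _)) ?_ _
    obtain ⟨K, hK⟩ := hM.exists_norm_Vint_le hQm hQ trunc (extendLumps P S)
    exact ⟨K, fun q => ((norm_mul _ _).trans (by rw [hphase, one_mul])).trans_le (hK q)⟩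
  have hE : IntegrableOn (fun q : ℝ × ℝ =>
      M.Eint trunc (numSingles P) P (fun _ => 0) (energy n n' q.1 q.2))
      (Set.Ioc (-M.Y) M.Y ×ˢ Set.Ioc (-M.Y) M.Y) :=
    integrableOn_square_of_bounded (hM.measurable_Eint trunc _ P).stronglyMeasurable
      (hM.exists_norm_Eint_le trunc _ P) _
  have hVeq : ∀ S : Slot υ → Insert, M.V trunc (extendLumps P S) = (A : ℂ) *
      ∫ q in Set.Ioc (-M.Y) M.Y ×ˢ Set.Ioc (-M.Y) M.Y,
        Complex.exp (Complex.I * M.t * (q.1 - q.2)) * M.Vint trunc (extendLumps P S) q.1 q.2 :=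
    fun S => congrArg _ (intervalIntegral_intervalIntegral_eq hY (hi S))
  have hEeq : M.E trunc (numSingles P) P = A * ∫ q in Set.Ioc (-M.Y) M.Y ×ˢ Set.Ioc (-M.Y) M.Y,
      M.Eint trunc (numSingles P) P (fun _ => 0) (energy n n' q.1 q.2) :=
    congrArg _ (intervalIntegral_intervalIntegral_eq hY hE)
  simp only [hVeq]
  rw [← Finset.mul_sum, ← integral_finsetSum _ fun S _ => hi S, hEeq, norm_mul, Complex.norm_real,
    Real.norm_of_nonneg hA, mul_left_comm, ← integral_const_mul]
  refine mul_le_mul_of_nonneg_left ?_ hA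
  refine norm_integral_le_of_norm_le (hE.const_mul ρ) (ae_of_all _ fun q => ?_)
  simp only [← Finset.mul_sum]
  rw [norm_mul, hphase, one_mul]
  exact hM.norm_sum_Vint_le hQm hQ hR hζ hC trunc P q.1 q.2

/-- The number of vertices and the support of the initial wave function keep the momenta below the
cutoff. -/
theorem walk_bound_le {R T₀ : ℝ} (hl : 0 < M.lam) (hl1 : M.lam ≤ 1) (hκ : 0 < M.κ)
    (hδ : 0 < M.δ) (ht0 : 0 ≤ M.t) (ht : M.t ≤ T₀ * M.lam ^ (-2 - M.κ))
    (hR : |R| + 1 + T₀ ≤ M.lam ^ (-M.δ)) (hn : n ≤ M.K) (hn' : n' ≤ M.K) :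
    R + (max n n' : ℕ) * M.lam ^ (-M.δ) + M.lam ^ (-M.δ) ≤ M.ζ := by
  have hδ0 : 0 < M.lam ^ (-M.δ) := Real.rpow_pos_of_pos hl _
  -- The scale of the walk: at most `T₀ λ^{-κ-δ}` steps of size `λ^{-δ}`. As `ζ = λ^{-δ} u`, the
  -- spare power of `λ` absorbs the constants.
  set u := M.lam ^ (-M.κ - 2 * M.δ) with hu
  have hu0 : 0 < u := Real.rpow_pos_of_pos hl _
  have h1 : ((max n n' : ℕ) : ℝ) ≤ T₀ * M.lam ^ (-M.κ - M.δ) := by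
    calc ((max n n' : ℕ) : ℝ) ≤ M.K := by exact_mod_cast max_le hn hn'
      _ ≤ M.lam ^ (-M.δ) * (M.lam ^ 2 * M.t) := Nat.floor_le (by positivity)
      _ ≤ M.lam ^ (-M.δ) * (M.lam ^ 2 * (T₀ * M.lam ^ (-2 - M.κ))) := by gcongr
      _ = T₀ * (M.lam ^ (-M.δ) * (M.lam ^ (2 : ℝ) * M.lam ^ (-2 - M.κ))) := by
        rw [← Real.rpow_natCast]; push_cast; ring
      _ = T₀ * M.lam ^ (-M.κ - M.δ) := by
        rw [← Real.rpow_add hl, ← Real.rpow_add hl]; congr 2; ring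
  have h2 : ((max n n' : ℕ) : ℝ) * M.lam ^ (-M.δ) ≤ T₀ * u := by
    calc ((max n n' : ℕ) : ℝ) * M.lam ^ (-M.δ) ≤ T₀ * M.lam ^ (-M.κ - M.δ) * M.lam ^ (-M.δ) := by gcongr
      _ = T₀ * u := by rw [mul_assoc, ← Real.rpow_add hl, hu]; congr 2; ring
  have h3 : M.lam ^ (-M.δ) ≤ u := Real.rpow_le_rpow_of_exponent_ge hl hl1 (by linarith)
  have h4 : R ≤ |R| * u := by
    have : 1 ≤ u := Real.one_le_rpow_of_pos_of_le_one_of_nonpos hl hl1 (by linarith)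
    exact (le_abs_self R).trans (le_mul_of_one_le_right (abs_nonneg R) this)
  calc R + (max n n' : ℕ) * M.lam ^ (-M.δ) + M.lam ^ (-M.δ) ≤ (|R| + 1 + T₀) * u := by linarith
    _ ≤ M.lam ^ (-M.δ) * u := by gcongr
    _ = M.ζ := by rw [hu, ζ, ← Real.rpow_add hl]; congr 1; ring

end Setting

/-- A single insertion is a gate or a self-energy label. -/
theorem sum_insertOne {d n n' : ℕ} (M : Setting d) (trunc : Bool) (P : Lumps n n') (e : Edge n n') :
    ∑ S : Slot (Pi.single e 1 : Edge n n' → ℕ) → Insert, M.V trunc (extendLumps P S)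
      = M.V trunc (insertOne P e Insert.theta) + M.V trunc (insertOne P e Insert.gate) := by
  have hu : ∀ k : Slot (Pi.single e 1 : Edge n n' → ℕ), k = ⟨e, ⟨0, by simp⟩⟩ := by
    rintro ⟨e', k⟩
    by_cases he : e' = e
    · subst he
      have h1 : (k : ℕ) < 1 := k.2.trans_eq (Pi.single_eq_same _ _)
      rw [show k = ⟨0, by simp⟩ from Fin.ext (Nat.lt_one_iff.1 h1)]
    · exact absurd (k.2.trans_eq (Pi.single_eq_of_ne he _)) (Nat.not_lt_zero _)
  let : Unique (Slot (Pi.single e 1 : Edge n n' → ℕ)) := ⟨⟨⟨e, ⟨0, by simp⟩⟩⟩, hu⟩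
  rw [← (Equiv.funUnique (Slot (Pi.single e 1 : Edge n n' → ℕ)) Insert).symm.sum_comp, sum_insert,
    add_comm]
  rfl

end Feynman

end

theorem lemma5p4 (d : ℕ) (hd : 3 ≤ d)
    (B : 𝓢(Feynman.Mom d, ℝ)) (hB : ∀ x y, ‖x‖ = ‖y‖ → B x = B y)
    (hB0 : (0 : Feynman.Mom d) ∈ tsupport (𝓕 (fun x => (B x : ℂ))))
    (χ : Feynman.Mom d → ℝ) (hχ : ContDiff ℝ ∞ χ) (hχrad : ∀ p q, ‖p‖ = ‖q‖ → χ p = χ q)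
    (hχ01 : ∀ p, χ p ∈ Set.Icc (0 : ℝ) 1) (hχone : ∀ᶠ p in 𝓝 0, χ p = 1)
    (hχsupp : ∀ p, 1 < ‖p‖ → χ p = 0)
    (ψ₀ : Lp ℂ 2 (volume : Measure (Feynman.Mom d)))
    (hψ₀ : ∃ R : ℝ, ∀ᵐ p : Feynman.Mom d, R < ‖p‖ →
      (𝓕 ψ₀ : Lp ℂ 2 (volume : Measure (Feynman.Mom d))) p = 0)
    (T₀ : ℝ) (hT₀ : 0 < T₀) :
    ∃ C : ℝ, 0 < C ∧ ∀ κ δ : ℝ, 0 < κ → 0 < δ → ∃ c : ℝ, 0 < c ∧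
      ∀ M : Feynman.Setting d,
        M.B = B → M.χ = χ → M.ψ₀ = ψ₀ → M.κ = κ → M.δ = δ →
        Measurable M.Q → (∀ p, ‖M.Q p‖ ≤ 1) →
        0 < M.lam → M.lam ≤ c → M.lam ^ 3 ≤ c * M.η → M.η ≤ c * M.lam ^ 2 →
        0 ≤ M.t → M.t ≤ T₀ * M.lam ^ (-2 - κ) →
      ∀ n n' : ℕ, n ≤ M.K → n' ≤ M.K → ∀ (P : Feynman.Lumps n n') (trunc : Bool),
        (Feynman.singles P = ∅ → ∀ e : Feynman.Edge n n',
          ‖M.V trunc (Feynman.insertOne P e .theta) + M.V trunc (Feynman.insertOne P e .gate)‖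
            ≤ C * M.lam ^ 2 * M.η ^ (-(1 / 2) : ℝ) * M.E trunc 0 P) ∧
        (∀ υ : Feynman.Edge n n' → ℕ,
          ‖∑ S : Feynman.Slot υ → Feynman.Insert, M.V trunc (Feynman.extendLumps P S)‖
            ≤ (C * M.lam ^ 2 * M.η ^ (-(1 / 2) : ℝ)) ^ (∑ e, υ e)
              * M.E trunc (Feynman.numSingles P) P) := by
  obtain ⟨C, hC, hreg⟩ := Feynman.Setting.exists_regular hd B hB χ hχ hχrad hχsupp
  obtain ⟨R, hR⟩ := hψ₀
  refine ⟨C, hC, fun κ δ hκ hδ => ?_⟩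
  set b : ℝ := Feynman.Setting.bracket (0 : Feynman.Mom d) ^ (-(2 * d : ℤ))
  have hb : 0 < b := zpow_pos (Feynman.Setting.bracket_pos _) _
  set r : ℝ := |R| + 1 + T₀
  have hr : 0 < r := by positivity
  have hc3 : 0 < r ^ (-δ⁻¹) := Real.rpow_pos_of_pos hr _
  -- The bound `b / C` gives `λC ≤ ⟨0⟩^{-2d}` for the single lumps, and `r^{-1/δ}` gives `λ^{-δ} ≥
  -- |R| + 1 + T₀` for the cutoff; with `c ≤ 1` also `λ ≤ 1` and `λ³ ≤ η`.
  refine ⟨min 1 (min (b / C) (r ^ (-δ⁻¹))), lt_min one_pos (lt_min (div_pos hb hC) hc3), ?_⟩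
  intro M hMB hMχ hMψ hMκ hMδ hQm hQ hl hlc hη3 _ ht0 ht n n' hn hn' P trunc
  subst hMκ hMδ
  have hl1 : M.lam ≤ 1 := hlc.trans (min_le_left _ _)
  have hlC : M.lam ≤ b / C := hlc.trans ((min_le_right _ _).trans (min_le_left _ _))
  have hlr : M.lam ≤ r ^ (-M.δ⁻¹) := hlc.trans ((min_le_right _ _).trans (min_le_right _ _))
  have hη : 0 < M.η := by
    by_contra! h
    have h1 : 0 < M.lam ^ 3 := pow_pos hl 3
    have h2 := mul_nonpos_of_nonneg_of_nonpos (hl.le.trans hlc) h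
    linarith
  have hM := hreg M hMB hMχ hδ hl hl1
    (hη3.trans (mul_le_of_le_one_left hη.le (min_le_left _ _)))
  have hrδ : |R| + 1 + T₀ ≤ M.lam ^ (-M.δ) := by
    have h := Real.rpow_le_rpow_of_nonpos hl hlr (neg_nonpos.2 hδ.le)
    rwa [← Real.rpow_mul hr.le, neg_mul_neg, inv_mul_cancel₀ hδ.ne', Real.rpow_one] at h
  have hζ := Feynman.Setting.walk_bound_le hl hl1 hκ hδ ht0 ht hrδ hn hn'
  have hψ : ∀ᵐ p : Feynman.Mom d, R < ‖p‖ → M.ψhat p = 0 := by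
    subst hMψ
    exact hR
  have main := hM.norm_sum_V_le hQm hQ hψ hζ ((le_div_iff₀ hC).1 hlC) trunc P
  refine ⟨fun hs e => ?_, main⟩
  -- The first assertion is the second one with a single slot, on an edge of a graph with no single
  -- lump.
  have h := main (Pi.single e 1)
  have h0 : Feynman.numSingles P = 0 := by rw [Feynman.numSingles, hs, Finset.card_empty]
  rwa [Feynman.sum_insertOne, Fintype.sum_pi_single', pow_one, h0] at h
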